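/- Let $\Bbbk$ be a field. All DG-categories are over $\Bbbk$ and graded cohomologically; $[\mathcal D]$ denotes the homotopy category of a DG-category $\mathcal D$ (same objects, $\operatorname{Hom}_{[\mathcal D]}=H^0\operatorname{Hom}_{\mathcal D}$), $\mathcal D\text{-dgm}$ is the DG-category of right DG-modules over $\mathcal D$, and $\mathsf Y^X=\operatorname{Hom}_{\mathcal D}(-,X)$. A DG-category $\mathcal D$ is *pretriangulated* if it is non-empty, and for every object $X$ and every $i\in\mathbb Z$ the DG-module $\mathsf Y^X[i]$, and for every closed morphism $f:X\to Y$ of degree $0$ the DG-module $\operatorname{Cone}(\mathsf Y^f:\mathsf Y^X\to\mathsf Y^Y)$, is isomorphic in $[\mathcal D\text{-dgm}]$ to a representable DG-module. Then $[\mathcal D]$ is triangulated, as a full subcategory of $[\mathcal D\text{-dgm}]$ via the Yoneda embedding. An object is *contractible* if its identity is $d h$ for some $h$ of degree $-1$, i.e. if it is a zero object of $[\mathcal D]$. Let $\mathcal D_1,\mathcal D_2$ be DG-categories and let $\varphi$ be a DG-bimodule, i.e. a right DG-module over $\mathcal D_2^{\mathrm{op}}\otimes\mathcal D_1$; so $\varphi(M_2,M_1)$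 is a complex, with a left action of $\mathcal D_2$ and a right action of $\mathcal D_1$. The *gluing* $\mathcal D=\mathcal D_1\times_\varphi\mathcal D_2$ is the DG-category whose objects are the triples $(M_1,M_2,\mu)$ with $M_i\in\mathcal D_i$ and $\mu\in\varphi(M_2,M_1)$ closed of degree $0$, with $$\operatorname{Hom}^n_{\mathcal D}\big((M_1,M_2,\mu),(N_1,N_2,\nu)\big)=\operatorname{Hom}^n_{\mathcal D_1}(M_1,N_1)\oplus\operatorname{Hom}^n_{\mathcal D_2}(M_2,N_2)\oplus\varphi^{\,n-1}(N_2,M_1),$$ $$d(f_1,f_2,f_{21})=(df_1,\,df_2,\,-df_{21}-f_2\circ\mu+\nu\circ f_1),$$ $$(f_1,f_2,f_{21})\circ(g_1,g_2,g_{21})=(f_1\circ g_1,\ f_2\circ g_2,\ f_{21}\circ g_1+(-1)^{\deg f_2}f_2\circ g_{21}),$$ and identities $(\mathrm{id},\mathrm{id},0)$. **Theorem.** Assume that $\mathcal D_1$ and $\mathcal D_2$ are pretriangulated. Then $\mathcal D=\mathcal D_1\times_\varphi\mathcal D_2$ is pretriangulated. Moreover $\mathcal D_1$ and $\mathcal D_2$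 have contractible objects, and for any contractible objects $0=O_1\in\mathcal D_1$ and $0=O_2\in\mathcal D_2$ the functors $$i_1:[\mathcal D_1]\to[\mathcal D],\ M_1\mapsto(M_1,0,0),\ f\mapsto(f,0,0),\qquad i_2:[\mathcal D_2]\to[\mathcal D],\ M_2\mapsto(0,M_2,0),\ f\mapsto(0,f,0)$$ are triangulated and fully faithful, and give a semiorthogonal decomposition $[\mathcal D]=\langle[\mathcal D_1],[\mathcal D_2]\rangle$: the essential images $\mathcal T_1$, $\mathcal T_2$ of $i_1$, $i_2$ are strictly full triangulated subcategories, $\operatorname{Hom}_{[\mathcal D]}(\mathcal T_2,\mathcal T_1)=0$, and each $F\in[\mathcal D]$ fits into a distinguished triangle $F_2\to F\to F_1\to F_2[1]$ with $F_1\in\mathcal T_1$ and $F_2\in\mathcal T_2$. Its gluing bifunctor is the one induced by $\varphi$: there is an isomorphism $$\operatorname{Hom}_{[\mathcal D]}\big(i_1M_1,\,(i_2M_2)[1]\big)\cong H^0\big(\varphi(M_2,M_1)\big)$$ of functors $[\mathcal D_1]^{\mathrm{op}}\times[\mathcal D_2]\to\Bbbk\text{-mod}$. -/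

import Mathlib

open CategoryTheory CategoryTheory.Limits CategoryTheory.Pretriangulated

universe w v u u₁ u₂

set_option linter.checkUnivs false in
/-- A DG-category over the field `k`: a class of objects, a complex of `k`-vector spaces
`Hom X Y` for any two objects (cohomological grading by `ℤ`), and an associative unital composition
`Hom Y Z ⊗ Hom X Y ⟶ Hom X Z`, `f ⊗ g ↦ f ∘ g`, which is a morphism of complexes, that is
`d (f ∘ g) = (d f) ∘ g + (-1) ^ (deg f) • f ∘ (d g)`. -/
structure DGCategory (k : Type w) [Field k] where
  Obj : Type u
  Hom : Obj → Obj → ℤ → Type v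
  [addCommGroup : ∀ X Y n, AddCommGroup (Hom X Y n)]
  [module : ∀ X Y n, Module k (Hom X Y n)]
  d : ∀ {X Y : Obj} {n m : ℤ}, n + 1 = m → (Hom X Y n →ₗ[k] Hom X Y m)
  comp : ∀ {X Y Z : Obj} {a b c : ℤ}, a + b = c → (Hom Y Z a →ₗ[k] Hom X Y b →ₗ[k] Hom X Z c)
  id : ∀ X : Obj, Hom X X 0
  d_d : ∀ {X Y : Obj} {n m l : ℤ} (h : n + 1 = m) (h' : m + 1 = l) (f : Hom X Y n),
    d h' (d h f) = 0
  d_comp : ∀ {X Y Z : Obj} {a b c a' b' c' : ℤ} (h : a + b = c) (ha : a + 1 = a')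
    (hb : b + 1 = b') (hc : c + 1 = c') (f : Hom Y Z a) (g : Hom X Y b),
    d hc (comp h f g) = comp (by lia) (d ha f) g + a.negOnePow • comp (by lia) f (d hb g)
  assoc : ∀ {X Y Z W : Obj} {a b c ab bc abc : ℤ} (hab : a + b = ab) (hbc : b + c = bc)
    (h : ab + c = abc) (f : Hom Z W a) (g : Hom Y Z b) (e : Hom X Y c),
    comp h (comp hab f g) e = comp (by lia) f (comp hbc g e)
  id_comp : ∀ {X Y : Obj} {n : ℤ} (f : Hom X Y n), comp (zero_add n) (id Y) f = f
  comp_id : ∀ {X Y : Obj} {n : ℤ} (f : Hom X Y n), comp (add_zero n) f (id X) = f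

attribute [instance] DGCategory.addCommGroup DGCategory.module

namespace DGCategory

variable {k : Type w} [Field k] (D : DGCategory.{w, v, u} k)

/-- The identity morphisms are closed (a consequence of the Leibniz rule). -/
theorem d_id {n : ℤ} (h : 0 + 1 = n) (X : D.Obj) : D.d h (D.id X) = 0 := by
  obtain rfl : n = 1 := by lia
  have := D.d_comp (add_zero 0) (zero_add 1) (zero_add 1) (zero_add 1) (D.id X) (D.id X)
  rw [D.id_comp, D.comp_id (D.d _ (D.id X)), D.id_comp (D.d _ (D.id X))] at this
  simpa using this

/-! ### The homotopy category -/

/-- Closed morphisms of degree `0`. -/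
def cocycles (X Y : D.Obj) : Submodule k (D.Hom X Y 0) :=
  LinearMap.ker (D.d (zero_add 1))

/-- The closed morphisms of degree `0` which are of the form `d h`, with `h` of degree `-1`. -/
def boundaries (X Y : D.Obj) : Submodule k (D.cocycles X Y) :=
  (LinearMap.range (D.d (neg_add_cancel 1) : D.Hom X Y (-1) →ₗ[k] D.Hom X Y 0)).comap
    (D.cocycles X Y).subtype

variable {D}

theorem mem_cocycles {X Y : D.Obj} {f : D.Hom X Y 0} :
    f ∈ D.cocycles X Y ↔ D.d (zero_add 1) f = 0 := Iff.rfl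

theorem mem_boundaries {X Y : D.Obj} {f : D.cocycles X Y} :
    f ∈ D.boundaries X Y ↔ ∃ h : D.Hom X Y (-1), D.d (neg_add_cancel 1) h = f.1 := Iff.rfl

/-- Composition of closed morphisms of degree `0`. -/
def cocyclesComp {X Y Z : D.Obj} (f : D.cocycles Y Z) (g : D.cocycles X Y) : D.cocycles X Z :=
  ⟨D.comp (add_zero 0) f.1 g.1, by
    rw [mem_cocycles, D.d_comp (add_zero 0) (zero_add 1) (zero_add 1) (zero_add 1),
      mem_cocycles.1 f.2, mem_cocycles.1 g.2]
    simp⟩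

theorem cocyclesComp_mem_left {X Y Z : D.Obj} {f : D.cocycles Y Z} (g : D.cocycles X Y)
    (hf : f ∈ D.boundaries Y Z) : cocyclesComp f g ∈ D.boundaries X Z := by
  obtain ⟨h, hh⟩ := hf
  refine ⟨D.comp (add_zero (-1)) h g.1, ?_⟩
  rw [D.d_comp (add_zero (-1)) (neg_add_cancel 1) (zero_add 1) (neg_add_cancel 1),
    mem_cocycles.1 g.2, hh]
  simp [cocyclesComp]

theorem cocyclesComp_mem_right {X Y Z : D.Obj} (f : D.cocycles Y Z) {g : D.cocycles X Y}
    (hg : g ∈ D.boundaries X Y) : cocyclesComp f g ∈ D.boundaries X Z := by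
  obtain ⟨h, hh⟩ := hg
  refine ⟨D.comp (zero_add (-1)) f.1 h, ?_⟩
  rw [D.d_comp (zero_add (-1)) (zero_add 1) (neg_add_cancel 1) (neg_add_cancel 1),
    mem_cocycles.1 f.2, hh]
  simp [cocyclesComp]

variable (D)

/-- The homotopy category `[D]`: its objects are those of `D`. -/
structure Ho where
  obj : D.Obj

variable {D}

/-- The morphisms of `[D]` are `H ^ 0` of the complexes of morphisms of `D`. -/
def HoHom (X Y : D.Ho) : Type v := D.cocycles X.obj Y.obj ⧸ D.boundaries X.obj Y.obj

instance (X Y : D.Ho) : AddCommGroup (HoHom X Y) :=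
  inferInstanceAs (AddCommGroup (D.cocycles X.obj Y.obj ⧸ D.boundaries X.obj Y.obj))

instance (X Y : D.Ho) : Module k (HoHom X Y) :=
  inferInstanceAs (Module k (D.cocycles X.obj Y.obj ⧸ D.boundaries X.obj Y.obj))

/-- The homotopy class of a closed morphism of degree `0`. -/
def cls {X Y : D.Ho} : D.cocycles X.obj Y.obj →ₗ[k] HoHom X Y :=
  (D.boundaries X.obj Y.obj).mkQ

theorem cls_surjective {X Y : D.Ho} (f : HoHom X Y) : ∃ f', cls f' = f :=
  Submodule.mkQ_surjective _ f

theorem cls_eq_iff {X Y : D.Ho} {f g : D.cocycles X.obj Y.obj} :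
    (cls f : HoHom X Y) = cls g ↔
      ∃ h : D.Hom X.obj Y.obj (-1), D.d (neg_add_cancel 1) h = f.1 - g.1 :=
  (Submodule.Quotient.eq _).trans mem_boundaries

/-- Composition in `[D]`, in diagrammatic order. -/
def hoComp {X Y Z : D.Ho} (f : HoHom X Y) (g : HoHom Y Z) : HoHom X Z :=
  Quotient.liftOn₂' f g (fun f g => (cls (cocyclesComp g f) : HoHom X Z)) (by
    intro f g f' g' hf hg
    have hf' := (Submodule.quotientRel_def _).1 hf
    have hg' := (Submodule.quotientRel_def _).1 hg
    refine (Submodule.Quotient.eq _).2 ?_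
    have : cocyclesComp g f - cocyclesComp g' f' =
        cocyclesComp (g - g') f + cocyclesComp g' (f - f') := by
      ext
      simp [cocyclesComp]
    rw [this]
    exact add_mem (cocyclesComp_mem_left _ hg') (cocyclesComp_mem_right _ hf'))

theorem hoComp_cls {X Y Z : D.Ho} (f : D.cocycles X.obj Y.obj) (g : D.cocycles Y.obj Z.obj) :
    hoComp (cls f : HoHom X Y) (cls g : HoHom Y Z) = cls (cocyclesComp g f) := rfl

instance : Category.{v} D.Ho where
  Hom X Y := HoHom X Y
  id X := (cls ⟨D.id X.obj, D.d_id _ _⟩ : HoHom X X)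
  comp f g := hoComp f g
  id_comp f := by
    obtain ⟨f, rfl⟩ := cls_surjective f
    rw [hoComp_cls]
    congr 1
    ext
    exact D.comp_id _
  comp_id f := by
    obtain ⟨f, rfl⟩ := cls_surjective f
    rw [hoComp_cls]
    congr 1
    ext
    exact D.id_comp _
  assoc f g h := by
    obtain ⟨f, rfl⟩ := cls_surjective f
    obtain ⟨g, rfl⟩ := cls_surjective g
    obtain ⟨h, rfl⟩ := cls_surjective h
    rw [hoComp_cls, hoComp_cls, hoComp_cls, hoComp_cls]
    congr 1
    ext
    exact (D.assoc _ _ _ _ _ _).symm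

/-- The morphism of `[D]` defined by a closed morphism of degree `0`. -/
def homMk {X Y : D.Ho} (f : D.cocycles X.obj Y.obj) : X ⟶ Y := (cls f : HoHom X Y)

theorem homMk_surjective {X Y : D.Ho} (f : X ⟶ Y) : ∃ f', homMk f' = f := cls_surjective f

theorem homMk_eq_iff {X Y : D.Ho} {f g : D.cocycles X.obj Y.obj} :
    (homMk f : X ⟶ Y) = homMk g ↔
      ∃ h : D.Hom X.obj Y.obj (-1), D.d (neg_add_cancel 1) h = f.1 - g.1 := cls_eq_iff

theorem homMk_comp {X Y Z : D.Ho} (f : D.cocycles X.obj Y.obj) (g : D.cocycles Y.obj Z.obj) :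
    (homMk f : X ⟶ Y) ≫ (homMk g : Y ⟶ Z) = homMk (cocyclesComp g f) := rfl

theorem id_eq_homMk (X : D.Ho) : 𝟙 X = homMk ⟨D.id X.obj, D.d_id _ _⟩ := rfl

theorem add_hoComp {X Y Z : D.Ho} (f f' : HoHom X Y) (g : HoHom Y Z) :
    hoComp (f + f') g = hoComp f g + hoComp f' g := by
  obtain ⟨f, rfl⟩ := cls_surjective f
  obtain ⟨f', rfl⟩ := cls_surjective f'
  obtain ⟨g, rfl⟩ := cls_surjective g
  rw [← map_add, hoComp_cls, hoComp_cls, hoComp_cls, ← map_add]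
  congr 1
  ext
  simp [cocyclesComp]

theorem hoComp_add {X Y Z : D.Ho} (f : HoHom X Y) (g g' : HoHom Y Z) :
    hoComp f (g + g') = hoComp f g + hoComp f g' := by
  obtain ⟨f, rfl⟩ := cls_surjective f
  obtain ⟨g, rfl⟩ := cls_surjective g
  obtain ⟨g', rfl⟩ := cls_surjective g'
  rw [← map_add, hoComp_cls, hoComp_cls, hoComp_cls, ← map_add]
  congr 1
  ext
  simp [cocyclesComp]

theorem smul_hoComp {X Y Z : D.Ho} (r : k) (f : HoHom X Y) (g : HoHom Y Z) :
    hoComp (r • f) g = r • hoComp f g := by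
  obtain ⟨f, rfl⟩ := cls_surjective f
  obtain ⟨g, rfl⟩ := cls_surjective g
  rw [← map_smul, hoComp_cls, hoComp_cls, ← map_smul]
  congr 1
  ext
  simp [cocyclesComp]

theorem hoComp_smul {X Y Z : D.Ho} (f : HoHom X Y) (r : k) (g : HoHom Y Z) :
    hoComp f (r • g) = r • hoComp f g := by
  obtain ⟨f, rfl⟩ := cls_surjective f
  obtain ⟨g, rfl⟩ := cls_surjective g
  rw [← map_smul, hoComp_cls, hoComp_cls, ← map_smul]
  congr 1
  ext
  simp [cocyclesComp]

instance : Preadditive D.Ho where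
  homGroup X Y := inferInstanceAs (AddCommGroup (HoHom X Y))
  add_comp _ _ _ f f' g := add_hoComp f f' g
  comp_add _ _ _ f g g' := hoComp_add f g g'

instance : Linear k D.Ho where
  homModule X Y := inferInstanceAs (Module k (HoHom X Y))
  smul_comp _ _ _ r f g := smul_hoComp r f g
  comp_smul _ _ _ f r g := hoComp_smul f r g

theorem homMk_add {X Y : D.Ho} (f g : D.cocycles X.obj Y.obj) :
    (homMk (f + g) : X ⟶ Y) = homMk f + homMk g := map_add (cls (X := X) (Y := Y)) f g

theorem homMk_smul {X Y : D.Ho} (r : k) (f : D.cocycles X.obj Y.obj) :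
    (homMk (r • f) : X ⟶ Y) = r • homMk f := map_smul (cls (X := X) (Y := Y)) r f

end DGCategory

/-- A right DG-module over `D`: a complex `X A` of vector spaces for each object `A` of `D`, with an
associative unital right action `X B ⊗ Hom A B ⟶ X A`, `x ⊗ f ↦ x · f`, of the morphisms of `D` which
is a morphism of complexes: `d (x · f) = (d x) · f + (-1) ^ (deg x) • x · (d f)`. Equivalently, a
DG-functor from the opposite of `D` to complexes, the functor being `f ↦ (x ↦ ± x · f)`
with the Koszul sign. -/
structure DGModule {k : Type w} [Field k] (D : DGCategory.{w, v, u} k) where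
  X : D.Obj → ℤ → Type v
  [addCommGroup : ∀ A n, AddCommGroup (X A n)]
  [module : ∀ A n, Module k (X A n)]
  d : ∀ {A : D.Obj} {n m : ℤ}, n + 1 = m → (X A n →ₗ[k] X A m)
  act : ∀ {A B : D.Obj} {a b c : ℤ}, a + b = c → (X B a →ₗ[k] D.Hom A B b →ₗ[k] X A c)
  d_d : ∀ {A : D.Obj} {n m l : ℤ} (h : n + 1 = m) (h' : m + 1 = l) (x : X A n),
    d h' (d h x) = 0
  d_act : ∀ {A B : D.Obj} {a b c a' b' c' : ℤ} (h : a + b = c) (ha : a + 1 = a')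
    (hb : b + 1 = b') (hc : c + 1 = c') (x : X B a) (f : D.Hom A B b),
    d hc (act h x f) = act (by lia) (d ha x) f + a.negOnePow • act (by lia) x (D.d hb f)
  act_act : ∀ {A B C : D.Obj} {a b c ab bc abc : ℤ} (hab : a + b = ab) (hbc : b + c = bc)
    (h : ab + c = abc) (x : X C a) (f : D.Hom B C b) (g : D.Hom A B c),
    act h (act hab x f) g = act (by lia) x (D.comp hbc f g)
  act_id : ∀ {A : D.Obj} {n : ℤ} (x : X A n), act (add_zero n) x (D.id A) = x

attribute [instance] DGModule.addCommGroup DGModule.module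

namespace DGModule

variable {k : Type w} [Field k] {D : DGCategory.{w, v, u} k}

/-- Closed morphisms of degree `0` in the DG-category of right DG-modules: families of linear maps
which preserve the degree and commute with the differentials and with the action. -/
def homs (M N : DGModule D) : AddSubgroup (∀ (A : D.Obj) (n : ℤ), M.X A n →ₗ[k] N.X A n) where
  carrier := {f | (∀ (A : D.Obj) (n m : ℤ) (h : n + 1 = m) (x : M.X A n),
      f A m (M.d h x) = N.d h (f A n x)) ∧
    ∀ (A B : D.Obj) (a b c : ℤ) (h : a + b = c) (x : M.X B a) (g : D.Hom A B b),
      f A c (M.act h x g) = N.act h (f B a x) g}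
  add_mem' := by
    rintro f g ⟨hf, hf'⟩ ⟨hg, hg'⟩
    refine ⟨fun A n m h x => ?_, fun A B a b c h x e => ?_⟩
    · simp [hf, hg]
    · simp [hf', hg']
  zero_mem' := by
    refine ⟨fun A n m h x => ?_, fun A B a b c h x e => ?_⟩ <;> simp
  neg_mem' := by
    rintro f ⟨hf, hf'⟩
    refine ⟨fun A n m h x => ?_, fun A B a b c h x e => ?_⟩
    · simp [hf]
    · simp [hf']

/-- The category with the right DG-modules over `D` as objects and the closed morphisms of
degree `0` as morphisms. -/
instance : Category (DGModule D) where
  Hom M N := homs M N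
  id M := ⟨fun _ _ => LinearMap.id, by refine ⟨?_, ?_⟩ <;> intros <;> rfl⟩
  comp f g := ⟨fun A n => (g.1 A n) ∘ₗ (f.1 A n), by
    refine ⟨fun A n m h x => ?_, fun A B a b c h x e => ?_⟩
    · simp [f.2.1 A n m h, g.2.1 A n m h]
    · simp [f.2.2 A B a b c h, g.2.2 A B a b c h]⟩

/-- The component of a closed morphism of degree `0`. -/
def app {M N : DGModule D} (f : M ⟶ N) (A : D.Obj) (n : ℤ) : M.X A n →ₗ[k] N.X A n := f.1 A n

/-- Constructor for closed morphisms of degree `0`. -/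
def mkHom {M N : DGModule D} (f : ∀ (A : D.Obj) (n : ℤ), M.X A n →ₗ[k] N.X A n)
    (hd : ∀ (A : D.Obj) (n m : ℤ) (h : n + 1 = m) (x : M.X A n),
      f A m (M.d h x) = N.d h (f A n x))
    (ha : ∀ (A B : D.Obj) (a b c : ℤ) (h : a + b = c) (x : M.X B a) (g : D.Hom A B b),
      f A c (M.act h x g) = N.act h (f B a x) g) : M ⟶ N := ⟨f, hd, ha⟩

@[simp] theorem mkHom_app {M N : DGModule D} (f : ∀ (A : D.Obj) (n : ℤ), M.X A n →ₗ[k] N.X A n)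
    (hd ha) (A : D.Obj) (n : ℤ) : app (mkHom (M := M) (N := N) f hd ha) A n = f A n := rfl

@[ext] theorem hom_ext {M N : DGModule D} {f g : M ⟶ N}
    (h : ∀ (A : D.Obj) (n : ℤ) (x : M.X A n), app f A n x = app g A n x) : f = g :=
  Subtype.ext (funext fun A => funext fun n => LinearMap.ext (h A n))

@[simp] theorem id_app (M : DGModule D) (A : D.Obj) (n : ℤ) (x : M.X A n) :
    app (𝟙 M) A n x = x := rfl

@[simp] theorem comp_app {M N L : DGModule D} (f : M ⟶ N) (g : N ⟶ L) (A : D.Obj) (n : ℤ)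
    (x : M.X A n) : app (f ≫ g) A n x = app g A n (app f A n x) := rfl

theorem app_d {M N : DGModule D} (f : M ⟶ N) {A : D.Obj} {n m : ℤ} (h : n + 1 = m)
    (x : M.X A n) : app f A m (M.d h x) = N.d h (app f A n x) := f.2.1 A n m h x

theorem app_act {M N : DGModule D} (f : M ⟶ N) {A B : D.Obj} {a b c : ℤ} (h : a + b = c)
    (x : M.X B a) (g : D.Hom A B b) : app f A c (M.act h x g) = N.act h (app f B a x) g :=
  f.2.2 A B a b c h x g

instance : Preadditive (DGModule D) where
  homGroup M N := inferInstanceAs (AddCommGroup (homs M N))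
  add_comp _ _ _ _ _ g := hom_ext fun A n _ => map_add (app g A n) _ _
  comp_add _ _ _ _ _ _ := hom_ext fun _ _ _ => rfl

@[simp] theorem add_app {M N : DGModule D} (f g : M ⟶ N) (A : D.Obj) (n : ℤ) (x : M.X A n) :
    app (f + g) A n x = app f A n x + app g A n x := rfl

@[simp] theorem neg_app {M N : DGModule D} (f : M ⟶ N) (A : D.Obj) (n : ℤ) (x : M.X A n) :
    app (-f) A n x = - app f A n x := rfl

@[simp] theorem sub_app {M N : DGModule D} (f g : M ⟶ N) (A : D.Obj) (n : ℤ) (x : M.X A n) :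
    app (f - g) A n x = app f A n x - app g A n x := by
  rw [sub_eq_add_neg, sub_eq_add_neg, add_app, neg_app]

@[simp] theorem zero_app {M N : DGModule D} (A : D.Obj) (n : ℤ) (x : M.X A n) :
    app (0 : M ⟶ N) A n x = 0 := rfl

/-! ### Homotopies -/

/-- A morphism of degree `-1` in the DG-category of right DG-modules: a family of linear
maps of degree `-1` which commutes with the action. -/
structure Htpy (M N : DGModule D) where
  h : ∀ (A : D.Obj) {p q : ℤ}, q + 1 = p → (M.X A p →ₗ[k] N.X A q)
  h_act : ∀ {A B : D.Obj} {a b c a' c' : ℤ} (e : a + b = c) (ha : a' + 1 = a) (hc : c' + 1 = c)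
    (x : M.X B a) (g : D.Hom A B b), h A hc (M.act e x g) = N.act (by lia) (h B ha x) g

/-- Two closed morphisms of degree `0` of right DG-modules are homotopic if their difference is the
differential `d ∘ h + h ∘ d` of a morphism `h` of degree `-1`. -/
def homotopic (D : DGCategory.{w, v, u} k) : HomRel (DGModule D) := fun M N f g =>
  ∃ H : Htpy M N, ∀ (A : D.Obj) (p q r : ℤ) (hq : q + 1 = p) (hr : p + 1 = r) (x : M.X A p),
    app f A p x - app g A p x = N.d hq (H.h A hq x) + H.h A hr (M.d hr x)

theorem homotopic_add {M N : DGModule D} {f f' g g' : M ⟶ N} (h : homotopic D f g)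
    (h' : homotopic D f' g') : homotopic D (f + f') (g + g') := by
  obtain ⟨H, hH⟩ := h
  obtain ⟨H', hH'⟩ := h'
  refine ⟨⟨fun A _ _ e => H.h A e + H'.h A e, fun e ha hc x g => ?_⟩,
    fun A p q r hq hr x => ?_⟩
  · simp [H.h_act e ha hc, H'.h_act e ha hc]
  · rw [add_app, add_app, add_sub_add_comm, hH A p q r hq hr, hH' A p q r hq hr]
    simp only [LinearMap.add_apply, map_add]
    abel

instance : Congruence (homotopic D) where
  equivalence := {
    refl := fun f => ⟨⟨fun _ _ _ _ => 0, fun _ _ _ _ _ => by simp⟩, fun _ _ _ _ _ _ _ => by simp⟩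
    symm := by
      rintro f g ⟨H, hH⟩
      refine ⟨⟨fun A _ _ e => - H.h A e, fun e ha hc x g => ?_⟩, fun A p q r hq hr x => ?_⟩
      · simp [H.h_act e ha hc]
      · rw [← neg_sub, hH A p q r hq hr]
        simp only [LinearMap.neg_apply, map_neg]
        abel
    trans := by
      rintro f g e ⟨H, hH⟩ ⟨H', hH'⟩
      refine ⟨⟨fun A _ _ e => H.h A e + H'.h A e, fun e ha hc x g => ?_⟩,
        fun A p q r hq hr x => ?_⟩
      · simp [H.h_act e ha hc, H'.h_act e ha hc]
      · rw [← sub_add_sub_cancel _ (app g A p x), hH A p q r hq hr, hH' A p q r hq hr]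
        simp only [LinearMap.add_apply, map_add]
        abel }
  comp_left := by
    rintro M N L f g g' ⟨H, hH⟩
    refine ⟨⟨fun A p _ e => H.h A e ∘ₗ app f A p, fun e ha hc x g => ?_⟩,
      fun A p q r hq hr x => ?_⟩
    · simp [app_act, H.h_act e ha hc]
    · simp [hH A p q r hq hr, app_d]
  comp_right := by
    rintro M N L f f' g ⟨H, hH⟩
    refine ⟨⟨fun A _ q e => app g A q ∘ₗ H.h A e, fun e ha hc x g => ?_⟩,
      fun A p q r hq hr x => ?_⟩
    · simp [app_act, H.h_act e ha hc]
    · simp [← map_sub, hH A p q r hq hr, app_d]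

variable (D) in
/-- The homotopy category `[D-dgm]` of right DG-modules over `D`. -/
abbrev Ho := Quotient (homotopic D)

/-- The functor which sends a closed morphism of degree `0` to its homotopy class. -/
abbrev toHo (D : DGCategory.{w, v, u} k) : DGModule D ⥤ Ho D := Quotient.functor (homotopic D)

theorem toHo_map_eq_iff {M N : DGModule D} (f g : M ⟶ N) :
    (toHo D).map f = (toHo D).map g ↔ homotopic D f g := Quotient.functor_map_eq_iff _ _ _

instance : Preadditive (Ho D) :=
  Quotient.preadditive _ fun _ _ _ _ _ _ h h' => homotopic_add h h'

instance : (toHo D).Additive := Quotient.functor_additive _ _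

/-! ### Shifts -/

/-- The shift `M[k]`: `M[k]ⁿ = Mⁿ⁺ᵏ`, with differential `(-1) ^ k • d` and the same right action. -/
abbrev shiftObj (M : DGModule D) (i : ℤ) : DGModule D where
  X A n := M.X A (n + i)
  d {A n m} h := i.negOnePow • M.d (A := A) (n := n + i) (m := m + i) (by lia)
  act {A B a b c} h := M.act (a := a + i) (b := b) (c := c + i) (by lia)
  d_d h h' x := by
    simp only [LinearMap.smul_apply, LinearMap.map_smul_of_tower, M.d_d, smul_zero]
  d_act {A B a b c a' b' c'} h ha hb hc x f := by
    simp only [LinearMap.smul_apply, LinearMap.map_smul_of_tower]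
    rw [M.d_act (b' := b') (a' := a' + i) _ (by lia) hb, smul_add, smul_smul, Int.negOnePow_add,
      mul_comm a.negOnePow, ← mul_assoc, Int.units_mul_self, one_mul]
  act_act _ _ _ x f g := M.act_act _ _ _ x f g
  act_id x := M.act_id x

theorem shiftObj_d (M : DGModule D) (i : ℤ) {A : D.Obj} {n m : ℤ} (h : n + 1 = m)
    (x : M.X A (n + i)) : (shiftObj M i).d (A := A) h x = i.negOnePow • M.d (by lia) x := rfl

/-- The identification of the components of a DG-module in equal degrees. -/
def cast (M : DGModule D) (A : D.Obj) {p q : ℤ} (h : p = q) : M.X A p →ₗ[k] M.X A q :=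
  h ▸ LinearMap.id

@[simp] theorem cast_rfl (M : DGModule D) (A : D.Obj) {p : ℤ} (x : M.X A p) :
    M.cast A rfl x = x := rfl

@[simp] theorem cast_cast (M : DGModule D) (A : D.Obj) {p q r : ℤ} (h : p = q) (h' : q = r)
    (x : M.X A p) : M.cast A h' (M.cast A h x) = M.cast A (h.trans h') x := by
  subst h h'; rfl

theorem d_cast (M : DGModule D) {A : D.Obj} {p q r : ℤ} (h : p = q) (h' : q + 1 = r)
    (x : M.X A p) : M.d h' (M.cast A h x) = M.d (by lia) x := by
  subst h; rfl

theorem cast_d (M : DGModule D) {A : D.Obj} {p q r : ℤ} (h : p + 1 = q) (h' : q = r)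
    (x : M.X A p) : M.cast A h' (M.d h x) = M.d (by lia) x := by
  subst h'; rfl

theorem act_cast (M : DGModule D) {A B : D.Obj} {p q b c : ℤ} (h : p = q) (h' : q + b = c)
    (x : M.X B p) (f : D.Hom A B b) : M.act h' (M.cast B h x) f = M.act (by lia) x f := by
  subst h; rfl

theorem cast_act (M : DGModule D) {A B : D.Obj} {p q b c : ℤ} (h : p + b = c) (h' : c = q)
    (x : M.X B p) (f : D.Hom A B b) : M.cast A h' (M.act h x f) = M.act (by lia) x f := by
  subst h'; rfl

theorem app_cast {M N : DGModule D} (f : M ⟶ N) {A : D.Obj} {p q : ℤ} (h : p = q)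
    (x : M.X A p) : app f A q (M.cast A h x) = N.cast A h (app f A p x) := by
  subst h; rfl

/-- The shift functor on right DG-modules and closed morphisms of degree `0`. -/
abbrev shiftFun (D : DGCategory.{w, v, u} k) (i : ℤ) : DGModule D ⥤ DGModule D where
  obj M := shiftObj M i
  map {M N} f := mkHom (M := shiftObj M i) (N := shiftObj N i) (fun A n => app f A (n + i))
    (fun A n m h x => by
      rw [shiftObj_d, shiftObj_d, LinearMap.map_smul_of_tower, app_d])
    (fun A B a b c h x g => app_act f _ x g)
  map_id M := rfl
  map_comp f g := rfl


theorem shiftFun_map_app {M N : DGModule D} (f : M ⟶ N) (i : ℤ) (A : D.Obj) (n : ℤ)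
    (x : M.X A (n + i)) : app ((shiftFun D i).map f) A n x = app f A (n + i) x := rfl

/-- The canonical isomorphism `M[0] ≅ M`. -/
abbrev shiftZeroIso (M : DGModule D) : shiftObj M 0 ≅ M where
  hom := mkHom (M := shiftObj M 0) (N := M) (fun A n => M.cast A (add_zero n))
    (fun A n m h x => by
      rw [shiftObj_d, LinearMap.map_smul_of_tower, cast_d, d_cast, Int.negOnePow_zero, one_smul])
    (fun A B a b c h x g => by
      rw [act_cast]
      exact M.cast_act (by lia) _ x g)
  inv := mkHom (M := M) (N := shiftObj M 0) (fun A n => M.cast A (add_zero n).symm)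
    (fun A n m h x => by
      rw [shiftObj_d, cast_d, d_cast, Int.negOnePow_zero, one_smul])
    (fun A B a b c h x g => by
      rw [cast_act]
      exact (M.act_cast _ _ x g).symm)
  hom_inv_id := hom_ext fun A n x => M.cast_cast A _ _ x
  inv_hom_id := hom_ext fun A n x => M.cast_cast A _ _ x

/-- The canonical isomorphism `M[i + j] ≅ M[i][j]`. -/
abbrev shiftAddIso (M : DGModule D) (i j : ℤ) :
    shiftObj M (i + j) ≅ shiftObj (shiftObj M i) j where
  hom := mkHom (M := shiftObj M (i + j)) (N := shiftObj (shiftObj M i) j)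
    (fun A n => M.cast A (show n + (i + j) = n + j + i by lia))
    (fun A n m h x => by
      rw [shiftObj_d, shiftObj_d, shiftObj_d, LinearMap.map_smul_of_tower, cast_d, d_cast,
        smul_smul, Int.negOnePow_add, mul_comm])
    (fun A B a b c h x g => by
      refine (M.cast_act _ _ x g).trans ?_
      exact (M.act_cast _ _ x g).symm)
  inv := mkHom (M := shiftObj (shiftObj M i) j) (N := shiftObj M (i + j))
    (fun A n => M.cast A (show n + j + i = n + (i + j) by lia))
    (fun A n m h x => by
      rw [shiftObj_d, shiftObj_d, shiftObj_d, LinearMap.map_smul_of_tower,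
        LinearMap.map_smul_of_tower, cast_d, d_cast,
        smul_smul, Int.negOnePow_add, mul_comm])
    (fun A B a b c h x g => by
      refine (M.cast_act _ _ x g).trans ?_
      exact (M.act_cast _ _ x g).symm)
  hom_inv_id := hom_ext fun A n x => M.cast_cast A _ _ x
  inv_hom_id := hom_ext fun A n x => M.cast_cast A _ _ x

theorem shiftObj_cast (M : DGModule D) (i : ℤ) (A : D.Obj) {p q : ℤ} (h : p = q)
    (x : M.X A (p + i)) :
    (shiftObj M i).cast A h x = M.cast A (show p + i = q + i by rw [h]) x := by
  subst h; rfl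

theorem eqToHom_app_shift (M : DGModule D) {i j : ℤ} (h : i = j)
    (h' : shiftObj M i = shiftObj M j) (A : D.Obj) (n : ℤ) (x : M.X A (n + i)) :
    app (eqToHom h') A n x = M.cast A (show n + i = n + j by rw [h]) x := by
  subst h; rfl

instance hasShift (D : DGCategory.{w, v, u} k) : HasShift (DGModule D) ℤ :=
  hasShiftMk (DGModule D) ℤ
    { F := shiftFun D
      zero := NatIso.ofComponents (fun M => shiftZeroIso M)
        (fun f => hom_ext fun A n x => (app_cast f (add_zero n) x).symm)
      add := fun i j => NatIso.ofComponents (fun M => shiftAddIso M i j)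
        (fun f => hom_ext fun A n x => (app_cast f (show n + (i + j) = n + j + i by lia) x).symm)
      assoc_hom_app := fun a b c M => hom_ext fun A n x => by
        rw [comp_app, comp_app, comp_app, eqToHom_app_shift M (add_assoc a b c)]
        refine (M.cast_cast A _ _ x).trans ?_
        refine ((shiftObj_cast M a A _ _).trans ?_).symm
        refine (M.cast_cast A _ _ _).trans ?_
        exact M.cast_cast A _ _ x
      zero_add_hom_app := fun i M => hom_ext fun A n x => by
        rw [comp_app, eqToHom_app_shift M (zero_add i)]
        exact (M.cast_cast A _ _ x).symm
      add_zero_hom_app := fun i M => hom_ext fun A n x => by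
        rw [comp_app, eqToHom_app_shift M (add_zero i)]
        refine ((shiftObj_cast M i A _ _).trans ?_).symm
        exact M.cast_cast A _ _ x }

theorem shift_map_app {M N : DGModule D} (f : M ⟶ N) (i : ℤ) (A : D.Obj) (n : ℤ)
    (x : M.X A (n + i)) : app (f⟦i⟧') A n x = app f A (n + i) x := rfl

instance : (homotopic D).IsCompatibleWithShift ℤ where
  condition i M N f g := by
    rintro ⟨H, hH⟩
    refine ⟨⟨fun A p q e => i.negOnePow • H.h A (p := p + i) (q := q + i) (by lia),
      fun {A B a b c a' c'} e ha hc x g => ?_⟩, fun A p q r hq hr x => ?_⟩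
    · have := H.h_act (a := a + i) (c := c + i) (a' := a' + i) (c' := c' + i) (b := b)
        (by lia) (by lia) (by lia) x g
      simp only [LinearMap.smul_apply, LinearMap.map_smul_of_tower]
      exact congrArg (i.negOnePow • ·) this
    · have := hH A (p + i) (q + i) (r + i) (by lia) (by lia) x
      have e : ∀ y : N.X A (p + i), i.negOnePow • i.negOnePow • y = y := fun y => by
        rw [smul_smul, Int.units_mul_self, one_smul]
      refine this.trans (congrArg₂ (· + ·) ?_ ?_)
      · exact (e _).symm.trans
          (congrArg (i.negOnePow • ·) (LinearMap.map_smul_of_tower (N.d _) i.negOnePow _).symm)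
      · exact (e _).symm.trans
          (congrArg (i.negOnePow • ·) (LinearMap.map_smul_of_tower (H.h A _) i.negOnePow _).symm)

instance (i : ℤ) : (shiftFunctor (DGModule D) i).Additive where
  map_add := rfl

instance (i : ℤ) : (shiftFunctor (Ho D) i).Additive := by
  have : (toHo D ⋙ shiftFunctor (Ho D) i).Additive :=
    Functor.additive_of_iso ((toHo D).commShiftIso i)
  exact Functor.additive_of_full_essSurj_comp (toHo D) _

/-- The zero DG-module. -/
def zeroObj (D : DGCategory.{w, v, u} k) : DGModule D where
  X _ _ := PUnit
  d _ := 0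
  act _ := 0
  d_d _ _ _ := rfl
  d_act _ _ _ _ _ _ := rfl
  act_act _ _ _ _ _ _ := rfl
  act_id _ := rfl

theorem isZero_zeroObj : IsZero (zeroObj D) where
  unique_to M := ⟨⟨⟨0⟩, fun f => hom_ext fun A n x => by
    obtain rfl : x = 0 := rfl
    rw [map_zero, map_zero]⟩⟩
  unique_from M := ⟨⟨⟨0⟩, fun f => hom_ext fun A n x => rfl⟩⟩

instance : HasZeroObject (DGModule D) := ⟨⟨_, isZero_zeroObj⟩⟩

instance : HasZeroObject (Ho D) := ⟨⟨_, (toHo D).map_isZero isZero_zeroObj⟩⟩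

/-! ### Cones -/

/-- The cone of a closed morphism `f : M ⟶ N` of degree `0`: as a graded module it is `N ⊕ M[1]`,
with the differential `d (y, x) = (d y + f x, - d x)`. -/
abbrev cone {M N : DGModule D} (f : M ⟶ N) : DGModule D where
  X A n := N.X A n × M.X A (n + 1)
  d {A n m} h := LinearMap.prod
    (N.d h ∘ₗ LinearMap.fst k (N.X A n) (M.X A (n + 1)) +
      app f A m ∘ₗ M.cast A h ∘ₗ LinearMap.snd k (N.X A n) (M.X A (n + 1)))
    (- M.d (n := n + 1) (m := m + 1) (by lia) ∘ₗ LinearMap.snd k (N.X A n) (M.X A (n + 1)))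
  act {A B a b c} h := LinearMap.mk₂ k
    (fun x g => (N.act h x.1 g, M.act (a := a + 1) (c := c + 1) (by lia) x.2 g))
    (by intros; simp) (by intros; simp) (by intros; simp) (by intros; simp)
  d_d h h' x := by
    subst h h'
    simp [N.d_d, M.d_d, app_d]
  d_act h ha hb hc x g := by
    subst ha hb hc
    simp only [LinearMap.mk₂_apply, LinearMap.prod_apply, LinearMap.add_apply, LinearMap.coe_comp,
      Function.comp_apply, LinearMap.fst_apply, LinearMap.snd_apply, LinearMap.neg_apply, cast_rfl,
      Function.prod, Prod.smul_mk, Prod.mk_add_mk, map_add, map_neg]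
    refine Prod.ext ?_ ?_
    · simp only [app_act]
      rw [N.d_act h rfl rfl rfl]
      abel
    · simp only
      rw [M.d_act (by lia) rfl rfl rfl, Int.negOnePow_succ]
      simp only [Units.neg_smul, neg_add, neg_neg]
  act_act hab hbc h x g g' := by
    simp [N.act_act hab hbc h, M.act_act (ab := _ + 1) _ hbc]
  act_id x := by
    refine Prod.ext (N.act_id _) (M.act_id _)


/-- The inclusion `N ⟶ cone f`, `y ↦ (y, 0)`. -/
def coneIn {M N : DGModule D} (f : M ⟶ N) : N ⟶ cone f :=
  mkHom (N := cone f) (fun A n => LinearMap.inl k (N.X A n) (M.X A (n + 1)))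
    (fun A n m h x => by subst h; simp [Function.prod])
    (fun A B a b c h x g => by simp)

/-- The projection `cone f ⟶ M[1]`, `(y, x) ↦ x`. -/
def conePr {M N : DGModule D} (f : M ⟶ N) : cone f ⟶ M⟦(1 : ℤ)⟧ :=
  mkHom (M := cone f) (N := shiftObj M 1) (fun A n => LinearMap.snd k (N.X A n) (M.X A (n + 1)))
    (fun A n m h x => by simp [Function.prod])
    (fun A B a b c h x g => by simp)

theorem coneIn_app {M N : DGModule D} (f : M ⟶ N) (A : D.Obj) (n : ℤ) (y : N.X A n) :
    app (coneIn f) A n y = ((y, 0) : N.X A n × M.X A (n + 1)) := rfl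

theorem conePr_app {M N : DGModule D} (f : M ⟶ N) (A : D.Obj) (n : ℤ) (y : N.X A n)
    (x : M.X A (n + 1)) :
    app (conePr f) A n ((y, x) : N.X A n × M.X A (n + 1)) = x := rfl

/-- The standard triangle `M ⟶ N ⟶ cone f ⟶ M[1]`. -/
abbrev triangle {M N : DGModule D} (f : M ⟶ N) : Triangle (DGModule D) :=
  Triangle.mk f (coneIn f) (conePr f)

/-- The image in the homotopy category of the standard triangle `M ⟶ N ⟶ cone f ⟶ M[1]`. -/
noncomputable abbrev triangleh {M N : DGModule D} (f : M ⟶ N) : Triangle (Ho D) :=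
  (toHo D).mapTriangle.obj (triangle f)

theorem isZero_cone_id (M : DGModule D) : IsZero ((toHo D).obj (cone (𝟙 M))) := by
  rw [IsZero.iff_id_eq_zero, ← (toHo D).map_id, ← (toHo D).map_zero, toHo_map_eq_iff]
  refine ⟨⟨fun A p q e => LinearMap.inr k _ _ ∘ₗ M.cast A e.symm ∘ₗ LinearMap.fst k _ _,
    fun {A B a b c a' c'} e ha hc x g => ?_⟩, fun A p q r hq hr x => ?_⟩
  · subst ha hc
    simp
  · subst hq hr
    rw [id_app, zero_app, sub_zero]
    refine Prod.ext ?_ ?_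
    · simp [Function.prod]
    · simp [Function.prod]

theorem shiftAdd_hom_app (M : DGModule D) {i j m : ℤ} (h : i + j = m) (A : D.Obj) (n : ℤ)
    (x : M.X A (n + m)) :
    app ((shiftFunctorAdd' (DGModule D) i j m h).hom.app M) A n x =
      M.cast A (show n + m = n + j + i by lia) x := by
  subst h
  rw [shiftFunctorAdd'_eq_shiftFunctorAdd]
  rfl

theorem shiftAdd_inv_app (M : DGModule D) {i j m : ℤ} (h : i + j = m) (A : D.Obj) (n : ℤ)
    (x : M.X A (n + j + i)) :
    app ((shiftFunctorAdd' (DGModule D) i j m h).inv.app M) A n x =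
      M.cast A (show n + j + i = n + m by lia) x := by
  subst h
  rw [shiftFunctorAdd'_eq_shiftFunctorAdd]
  rfl

theorem shiftComm_app (M : DGModule D) (i j : ℤ) (A : D.Obj) (n : ℤ) (x : M.X A (n + j + i)) :
    app ((shiftFunctorComm (DGModule D) i j).hom.app M) A n x =
      M.cast A (show n + j + i = n + i + j by lia) x := by
  rw [shiftFunctorComm_eq _ i j (i + j) rfl]
  refine (congrArg (app ((shiftFunctorAdd' (DGModule D) j i (i + j) (add_comm j i)).hom.app M) A n)
    (shiftAdd_inv_app M rfl A n x)).trans ?_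
  refine (shiftAdd_hom_app M (add_comm j i) A n _).trans ?_
  exact M.cast_cast A _ _ x

theorem smul_cast_smul_cast (M : DGModule D) (A : D.Obj) {p q : ℤ} (h : p = q) (h' : q = p)
    (e : ℤˣ) (x : M.X A p) : e • M.cast A h' (e • M.cast A h x) = x := by
  rw [LinearMap.map_smul_of_tower, cast_cast, cast_rfl, smul_smul, Int.units_mul_self, one_smul]

theorem units_smul_app {M N : DGModule D} (e : ℤˣ) (f : M ⟶ N) (A : D.Obj) (n : ℤ)
    (x : M.X A n) : app (e • f) A n x = e • app f A n x := by
  rcases Int.units_eq_one_or e with rfl | rfl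
  · rw [one_smul, one_smul]
  · rw [Units.neg_smul, Units.neg_smul, one_smul, one_smul, neg_app]

/-- The isomorphism `(cone f)[i] ≅ cone (f[i])`. -/
def coneShiftIso {M N : DGModule D} (f : M ⟶ N) (i : ℤ) : (cone f)⟦i⟧ ≅ cone (f⟦i⟧') where
  hom := mkHom (M := shiftObj (cone f) i) (N := cone ((shiftFun D i).map f))
    (fun A n => LinearMap.prodMap LinearMap.id
      (i.negOnePow • M.cast A (show n + i + 1 = n + 1 + i by lia)))
    (fun A n m h x => by
      subst h
      refine Prod.ext ?_ ?_
      · simp [Function.prod, smul_smul]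
      · simp [Function.prod, cast_d, d_cast, smul_smul])
    (fun A B a b c h x g => by
      refine Prod.ext rfl ?_
      simp [cast_act, act_cast])
  inv := mkHom (M := cone ((shiftFun D i).map f)) (N := shiftObj (cone f) i)
    (fun A n => LinearMap.prodMap LinearMap.id
      (i.negOnePow • M.cast A (show n + 1 + i = n + i + 1 by lia)))
    (fun A n m h x => by
      subst h
      refine Prod.ext ?_ ?_
      · simp [Function.prod, smul_smul]
      · simp [Function.prod, cast_d, d_cast, smul_smul])
    (fun A B a b c h x g => by
      refine Prod.ext rfl ?_
      simp [cast_act, act_cast])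
  hom_inv_id := hom_ext fun A n x => by
    exact Prod.ext rfl (M.smul_cast_smul_cast A _ _ _ _)
  inv_hom_id := hom_ext fun A n x => by
    exact Prod.ext rfl (M.smul_cast_smul_cast A _ _ _ _)


/-- The shift of a standard triangle is isomorphic to a standard triangle. -/
noncomputable def triangleShiftIso {M N : DGModule D} (f : M ⟶ N) (i : ℤ) :
    (Triangle.shiftFunctor _ i).obj (triangle f) ≅ triangle (f⟦i⟧') := by
  let e : N⟦i⟧ ≅ N⟦i⟧ := i.negOnePow • Iso.refl _
  refine Triangle.isoMk _ _ (Iso.refl _) e (coneShiftIso f i) ?_ ?_ ?_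
  · change (i.negOnePow • f⟦i⟧') ≫ (i.negOnePow • 𝟙 _) = 𝟙 _ ≫ f⟦i⟧'
    rw [Linear.comp_units_smul, Linear.units_smul_comp, Category.comp_id, Category.id_comp,
      smul_smul, Int.units_mul_self, one_smul]
  · change (i.negOnePow • (coneIn f)⟦i⟧') ≫ (coneShiftIso f i).hom =
      (i.negOnePow • 𝟙 _) ≫ coneIn (f⟦i⟧')
    rw [Linear.units_smul_comp, Linear.units_smul_comp, Category.id_comp]
    congr 1
    refine hom_ext fun A n x => Prod.ext rfl ?_
    change i.negOnePow • M.cast A _ 0 = 0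
    rw [map_zero, smul_zero]
  · change (i.negOnePow • ((conePr f)⟦i⟧' ≫ (shiftFunctorComm (DGModule D) 1 i).hom.app M)) ≫
      ((𝟙 (M⟦i⟧))⟦(1 : ℤ)⟧') = (coneShiftIso f i).hom ≫ conePr (f⟦i⟧')
    rw [CategoryTheory.Functor.map_id]
    refine (Category.comp_id _).trans ?_
    refine hom_ext fun A n x => ?_
    rw [units_smul_app, comp_app]
    exact congrArg (i.negOnePow • ·) (shiftComm_app M 1 i A n _)

/-- The rotation of a standard triangle is isomorphic to a standard triangle. -/
noncomputable def triangleRotateIso {M N : DGModule D} (f : M ⟶ N) :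
    (triangleh f).rotate ≅ triangleh (coneIn f) := by
  let a : M⟦(1 : ℤ)⟧ ⟶ cone (coneIn f) :=
    mkHom (M := shiftObj M 1) (N := cone (coneIn f))
      (fun A n => LinearMap.prod (LinearMap.inr k (N.X A n) (M.X A (n + 1))) (- app f A (n + 1)))
      (fun A n m h x => by
        subst h
        refine Prod.ext (Prod.ext ?_ ?_) ?_
        · simp only [Function.prod, LinearMap.prod_apply, LinearMap.coe_inr, LinearMap.neg_apply,
            LinearMap.add_apply, LinearMap.coe_comp, Function.comp_apply, LinearMap.fst_apply,
            LinearMap.snd_apply, map_zero, zero_add, cast_rfl, map_neg]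
          exact (add_neg_cancel _).symm
        · simp only [Function.prod, LinearMap.prod_apply, LinearMap.coe_inr, LinearMap.neg_apply,
            LinearMap.add_apply, LinearMap.coe_comp, Function.comp_apply, LinearMap.fst_apply,
            LinearMap.snd_apply, map_zero, cast_rfl, map_neg]
          rw [shiftObj_d _ _ rfl, Int.negOnePow_one, Units.neg_smul, one_smul]
          have e : ∀ y : M.X A (n + 1 + 1), y = y + -(0 : M.X A (n + 1 + 1)) := fun y => by
            rw [neg_zero, add_zero]
          exact e _
        · simp [Function.prod, app_d])
      (fun A B a b c h x g => by
        refine Prod.ext (Prod.ext ?_ ?_) ?_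
        · simp [Function.prod]
        · simp [Function.prod]
        · simp [Function.prod, app_act])
  let b : cone (coneIn f) ⟶ M⟦(1 : ℤ)⟧ :=
    mkHom (M := cone (coneIn f)) (N := shiftObj M 1)
      (fun A n => LinearMap.snd k (N.X A n) (M.X A (n + 1)) ∘ₗ LinearMap.fst k _ _)
      (fun A n m h x => by
        subst h
        simp [Function.prod]
        rfl)
      (fun A B a b c h x g => by simp)
  have hab : a ≫ b = 𝟙 _ := rfl
  have hba : (toHo D).map b ≫ (toHo D).map a = 𝟙 _ := by
    rw [← Functor.map_comp, ← (toHo D).map_id, toHo_map_eq_iff]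
    refine ⟨⟨fun A p q e => LinearMap.inr k (N.X A q × M.X A (q + 1)) (N.X A (q + 1)) ∘ₗ
      (- N.cast A e.symm) ∘ₗ LinearMap.fst k (N.X A p) (M.X A (p + 1)) ∘ₗ LinearMap.fst k _ _,
      fun {A B a b c a' c'} e ha hc x g => ?_⟩, fun A p q r hq hr x => ?_⟩
    · subst ha hc
      simp
      rfl
    · subst hq hr
      rw [comp_app, id_app]
      refine Prod.ext (Prod.ext ?_ ?_) ?_
      · simp [Function.prod]
        exact zero_sub x.1.1
      · simp [Function.prod]
        exact (sub_self x.1.2).trans neg_zero.symm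
      · simp [Function.prod]
        change - app f A (q + 1 + 1) x.1.2 - x.2 = N.d rfl x.1.1 +
          (- x.2 + (- app f A (q + 1 + 1) x.1.2 + - N.d rfl x.1.1))
        abel
  let e : ((toHo D).obj M)⟦(1 : ℤ)⟧ ≅ (toHo D).obj (cone (coneIn f)) :=
    ((toHo D).commShiftIso (1 : ℤ)).symm.app M ≪≫
      { hom := (toHo D).map a
        inv := (toHo D).map b
        hom_inv_id := by rw [← Functor.map_comp, hab]; exact (toHo D).map_id _
        inv_hom_id := hba }
  have h₂ : coneIn (coneIn f) ≫ b = conePr f := rfl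
  have h₃ : a ≫ conePr (coneIn f) = - f⟦(1 : ℤ)⟧' := rfl
  refine Triangle.isoMk _ _ (Iso.refl _) (Iso.refl _) e ?_ ?_ ?_
  · exact (Category.comp_id _).trans (Category.id_comp _).symm
  · change ((toHo D).map (conePr f) ≫ ((toHo D).commShiftIso (1 : ℤ)).hom.app M) ≫
      ((toHo D).commShiftIso (1 : ℤ)).inv.app M ≫ (toHo D).map a =
        𝟙 _ ≫ (toHo D).map (coneIn (coneIn f))
    rw [Category.assoc, Iso.hom_inv_id_app_assoc, ← h₂, Functor.map_comp, Category.assoc, hba]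
    exact (Category.comp_id _).trans (Category.id_comp _).symm
  · change (- ((toHo D).map f)⟦(1 : ℤ)⟧') ≫ (𝟙 ((toHo D).obj N))⟦(1 : ℤ)⟧' =
      (((toHo D).commShiftIso (1 : ℤ)).inv.app M ≫ (toHo D).map a) ≫
        (toHo D).map (conePr (coneIn f)) ≫ ((toHo D).commShiftIso (1 : ℤ)).hom.app N
    rw [CategoryTheory.Functor.map_id, Category.comp_id, Category.assoc, ← Functor.map_comp_assoc,
      h₃, Functor.map_neg, Preadditive.neg_comp, Functor.commShiftIso_hom_naturality,
      Preadditive.comp_neg, Iso.inv_hom_id_app_assoc]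

/-- A square which commutes up to homotopy extends to a morphism of standard triangles. -/
theorem exists_coneMap {M N M' N' : DGModule D} (f : M ⟶ N) (f' : M' ⟶ N') (a : M ⟶ M')
    (b : N ⟶ N') (h : homotopic D (f ≫ b) (a ≫ f')) :
    ∃ c : cone f ⟶ cone f', coneIn f ≫ c = b ≫ coneIn f' ∧
      conePr f ≫ a⟦(1 : ℤ)⟧' = c ≫ conePr f' := by
  obtain ⟨H, hH⟩ := h
  refine ⟨mkHom (M := cone f) (N := cone f') (fun A n => LinearMap.prod
      (app b A n ∘ₗ LinearMap.fst k (N.X A n) (M.X A (n + 1)) +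
        H.h A rfl ∘ₗ LinearMap.snd k (N.X A n) (M.X A (n + 1)))
      (app a A (n + 1) ∘ₗ LinearMap.snd k (N.X A n) (M.X A (n + 1))))
      (fun A n m h x => ?_) (fun A B a b c h x g => ?_), ?_, ?_⟩
  · subst h
    refine Prod.ext ?_ ?_
    · have := hH A (n + 1) n (n + 1 + 1) rfl rfl x.2
      rw [comp_app, comp_app, sub_eq_iff_eq_add] at this
      simp [Function.prod, app_d, this]
      abel
    · simp [Function.prod, app_d]
  · refine Prod.ext ?_ ?_
    · simp [Function.prod, app_act]
      exact H.h_act (a := a + 1) (c := c + 1) (by lia) rfl rfl x.2 g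
    · simp [Function.prod, app_act]
  · refine hom_ext fun A n x => Prod.ext ?_ ?_
    · change app b A n x + H.h A rfl 0 = app b A n x
      rw [map_zero, add_zero]
    · change app a A (n + 1) 0 = 0
      rw [map_zero]
  · rfl

/-! ### The triangulated structure on the homotopy category of DG-modules -/

/-- The distinguished triangles in `[D-dgm]`: those isomorphic to a standard triangle
`M ⟶ N ⟶ cone f ⟶ M[1]`. -/
def distTriangles (D : DGCategory.{w, v, u} k) : Set (Triangle (Ho D)) :=
  {T | ∃ (M N : DGModule D) (f : M ⟶ N), Nonempty (T ≅ triangleh f)}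

theorem iso_distTriangles (T₁ : Triangle (Ho D)) (hT₁ : T₁ ∈ distTriangles D)
    (T₂ : Triangle (Ho D)) (e : T₂ ≅ T₁) : T₂ ∈ distTriangles D := by
  obtain ⟨X, Y, f, ⟨e'⟩⟩ := hT₁
  exact ⟨X, Y, f, ⟨e ≪≫ e'⟩⟩

theorem rotate_distTriangles (T : Triangle (Ho D)) (hT : T ∈ distTriangles D) :
    T.rotate ∈ distTriangles D := by
  obtain ⟨K, L, f, ⟨e⟩⟩ := hT
  exact ⟨_, _, _, ⟨(rotate _).mapIso e ≪≫ triangleRotateIso f⟩⟩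

theorem shift_distTriangles (T : Triangle (Ho D)) (hT : T ∈ distTriangles D) (i : ℤ) :
    (Triangle.shiftFunctor _ i).obj T ∈ distTriangles D := by
  obtain ⟨K, L, f, ⟨e⟩⟩ := hT
  exact ⟨_, _, _, ⟨Functor.mapIso _ e ≪≫ ((toHo D).mapTriangle.commShiftIso i).symm.app _ ≪≫
    (toHo D).mapTriangle.mapIso (triangleShiftIso f i)⟩⟩

theorem invRotate_distTriangles (T : Triangle (Ho D)) (hT : T ∈ distTriangles D) :
    T.invRotate ∈ distTriangles D :=
  iso_distTriangles _
    (shift_distTriangles _ (rotate_distTriangles _ (rotate_distTriangles _ hT)) _) _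
    ((invRotateIsoRotateRotateShiftFunctorNegOne _).app T)

theorem complete_aux {M₁ N₁ M₂ N₂ : DGModule D} (f₁ : M₁ ⟶ N₁) (f₂ : M₂ ⟶ N₂)
    {X₁ Y₁ Z₁ X₂ Y₂ Z₂ : Ho D} {u₁ : X₁ ⟶ Y₁} {v₁ : Y₁ ⟶ Z₁} {w₁ : Z₁ ⟶ X₁⟦(1 : ℤ)⟧}
    {u₂ : X₂ ⟶ Y₂} {v₂ : Y₂ ⟶ Z₂} {w₂ : Z₂ ⟶ X₂⟦(1 : ℤ)⟧}
    (p₁ : X₁ ≅ (toHo D).obj M₁) (q₁ : Y₁ ≅ (toHo D).obj N₁) (r₁ : Z₁ ≅ (toHo D).obj (cone f₁))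
    (p₂ : X₂ ≅ (toHo D).obj M₂) (q₂ : Y₂ ≅ (toHo D).obj N₂) (r₂ : Z₂ ≅ (toHo D).obj (cone f₂))
    (hu₁ : u₁ ≫ q₁.hom = p₁.hom ≫ (toHo D).map f₁)
    (hv₁ : v₁ ≫ r₁.hom = q₁.hom ≫ (toHo D).map (coneIn f₁))
    (hw₁ : w₁ ≫ p₁.hom⟦(1 : ℤ)⟧' =
      r₁.hom ≫ (toHo D).map (conePr f₁) ≫ ((toHo D).commShiftIso (1 : ℤ)).hom.app M₁)
    (hu₂ : u₂ ≫ q₂.hom = p₂.hom ≫ (toHo D).map f₂)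
    (hv₂ : v₂ ≫ r₂.hom = q₂.hom ≫ (toHo D).map (coneIn f₂))
    (hw₂ : w₂ ≫ p₂.hom⟦(1 : ℤ)⟧' =
      r₂.hom ≫ (toHo D).map (conePr f₂) ≫ ((toHo D).commShiftIso (1 : ℤ)).hom.app M₂)
    (a : X₁ ⟶ X₂) (b : Y₁ ⟶ Y₂) (fac : u₁ ≫ b = a ≫ u₂) :
    ∃ c : Z₁ ⟶ Z₂, v₁ ≫ c = b ≫ v₂ ∧ w₁ ≫ a⟦(1 : ℤ)⟧' = c ≫ w₂ := by
  obtain ⟨a', ha'⟩ := (toHo D).map_surjective (p₁.inv ≫ a ≫ p₂.hom)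
  obtain ⟨b', hb'⟩ := (toHo D).map_surjective (q₁.inv ≫ b ≫ q₂.hom)
  have ha : a ≫ p₂.hom = p₁.hom ≫ (toHo D).map a' := by rw [ha', Iso.hom_inv_id_assoc]
  have hb : b ≫ q₂.hom = q₁.hom ≫ (toHo D).map b' := by rw [hb', Iso.hom_inv_id_assoc]
  have H : homotopic D (f₁ ≫ b') (a' ≫ f₂) := by
    rw [← toHo_map_eq_iff, Functor.map_comp, Functor.map_comp, ← cancel_epi p₁.hom,
      ← reassoc_of% hu₁, ← hb, ← reassoc_of% ha, ← hu₂, reassoc_of% fac]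
  obtain ⟨c, hc, hc'⟩ := exists_coneMap f₁ f₂ a' b' H
  refine ⟨r₁.hom ≫ (toHo D).map c ≫ r₂.inv, ?_, ?_⟩
  · rw [reassoc_of% hv₁, ← Functor.map_comp_assoc, hc, Functor.map_comp_assoc, ← reassoc_of% hb,
      ← reassoc_of% hv₂, Iso.hom_inv_id, Category.comp_id]
  · rw [← cancel_mono (p₂.hom⟦(1 : ℤ)⟧'), Category.assoc, ← Functor.map_comp, ha,
      Functor.map_comp, reassoc_of% hw₁, Category.assoc, Category.assoc, Category.assoc, hw₂,
      Iso.inv_hom_id_assoc, ← Functor.commShiftIso_hom_naturality, ← Functor.map_comp_assoc, hc',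
      Functor.map_comp_assoc]

theorem complete_distTriangles (T₁ T₂ : Triangle (Ho D)) (hT₁ : T₁ ∈ distTriangles D)
    (hT₂ : T₂ ∈ distTriangles D) (a : T₁.obj₁ ⟶ T₂.obj₁) (b : T₁.obj₂ ⟶ T₂.obj₂)
    (fac : T₁.mor₁ ≫ b = a ≫ T₂.mor₁) :
    ∃ c : T₁.obj₃ ⟶ T₂.obj₃, T₁.mor₂ ≫ c = b ≫ T₂.mor₂ ∧
      T₁.mor₃ ≫ a⟦(1 : ℤ)⟧' = c ≫ T₂.mor₃ := by
  obtain ⟨M₁, N₁, f₁, ⟨e₁⟩⟩ := hT₁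
  obtain ⟨M₂, N₂, f₂, ⟨e₂⟩⟩ := hT₂
  exact complete_aux f₁ f₂ (Triangle.π₁.mapIso e₁) (Triangle.π₂.mapIso e₁) (Triangle.π₃.mapIso e₁)
    (Triangle.π₁.mapIso e₂) (Triangle.π₂.mapIso e₂) (Triangle.π₃.mapIso e₂)
    e₁.hom.comm₁ e₁.hom.comm₂ e₁.hom.comm₃ e₂.hom.comm₁ e₂.hom.comm₂ e₂.hom.comm₃ a b fac

noncomputable instance : Pretriangulated (Ho D) where
  distinguishedTriangles := distTriangles D
  isomorphic_distinguished := iso_distTriangles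
  contractible_distinguished := by
    rintro ⟨M⟩
    refine ⟨_, _, 𝟙 M, ⟨Triangle.isoMk _ _ (Iso.refl _) (Iso.refl _)
      (isZero_cone_id M).isoZero.symm ?_ ((isZero_cone_id M).eq_of_tgt _ _)
      ((isZero_zero _).eq_of_src _ _)⟩⟩
    exact congrArg (𝟙 ((toHo D).obj M) ≫ ·) ((toHo D).map_id M).symm
  distinguished_cocone_triangle := by
    rintro ⟨M⟩ ⟨N⟩ f
    obtain ⟨f, rfl⟩ := (toHo D).map_surjective f
    exact ⟨_, _, _, ⟨_, _, f, ⟨Iso.refl _⟩⟩⟩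
  rotate_distinguished_triangle T :=
    ⟨rotate_distTriangles T, fun hT => iso_distTriangles _ (invRotate_distTriangles _ hT) _
      ((triangleRotation _).unitIso.app T)⟩
  complete_distinguished_triangle_morphism := complete_distTriangles

end DGModule

/-- A fully faithful functor to a triangulated category whose image is stable under shifts and
cones induces a triangulated structure: a triangle is distinguished if its image is. -/
abbrev pretriangulatedOfFullyFaithful {C : Type u₁} {T : Type u₂} [Category.{v} C] [Category.{w} T]
    [Preadditive C] [HasZeroObject C] [HasShift C ℤ] [∀ i : ℤ, (shiftFunctor C i).Additive]
    [Preadditive T] [HasZeroObject T] [HasShift T ℤ] [∀ i : ℤ, (shiftFunctor T i).Additive]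
    [Pretriangulated T] (F : C ⥤ T) [F.Full] [F.Faithful] [F.Additive] [F.CommShift ℤ]
    (hF : ∀ {A B : C} (f : A ⟶ B), ∃ (E : C) (Z : T) (g : F.obj B ⟶ Z)
      (h : Z ⟶ (F.obj A)⟦(1 : ℤ)⟧), Triangle.mk (F.map f) g h ∈ distTriang T ∧
        Nonempty (Z ≅ F.obj E)) : Pretriangulated C where
  distinguishedTriangles := {T' | F.mapTriangle.obj T' ∈ distTriang T}
  isomorphic_distinguished T₁ hT₁ T₂ e :=
    isomorphic_distinguished _ hT₁ _ (F.mapTriangle.mapIso e)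
  contractible_distinguished A := by
    refine isomorphic_distinguished _ (contractible_distinguished (F.obj A)) _
      (Triangle.isoMk _ _ (Iso.refl _) (Iso.refl _) F.mapZeroObject ?_ ?_ ?_)
    · change F.map (𝟙 A) ≫ 𝟙 (F.obj A) = 𝟙 (F.obj A) ≫ 𝟙 (F.obj A)
      rw [F.map_id]
    · exact (isZero_zero T).eq_of_tgt _ _
    · exact ((isZero_zero T).of_iso F.mapZeroObject).eq_of_src _ _
  distinguished_cocone_triangle {A B} f := by
    obtain ⟨C, Z, g, h, hT, ⟨e⟩⟩ := hF f
    refine ⟨C, F.preimage (g ≫ e.hom),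
      F.preimage (e.inv ≫ h ≫ (F.commShiftIso (1 : ℤ)).inv.app A),
      isomorphic_distinguished _ hT _ (Triangle.isoMk _ _ (Iso.refl _) (Iso.refl _) e.symm
        ?_ ?_ ?_)⟩
    · exact (Category.comp_id _).trans (Category.id_comp _).symm
    · change F.map (F.preimage (g ≫ e.hom)) ≫ e.inv = 𝟙 _ ≫ g
      rw [F.map_preimage, Category.assoc, e.hom_inv_id, Category.comp_id, Category.id_comp]
    · change (F.map (F.preimage (e.inv ≫ h ≫ (F.commShiftIso (1 : ℤ)).inv.app A)) ≫
        (F.commShiftIso (1 : ℤ)).hom.app A) ≫ (𝟙 (F.obj A))⟦(1 : ℤ)⟧' = e.inv ≫ h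
      rw [F.map_preimage, CategoryTheory.Functor.map_id]
      refine (Category.comp_id _).trans ?_
      rw [Category.assoc, Category.assoc, Iso.inv_hom_id_app]
      exact congrArg (e.inv ≫ ·) (Category.comp_id h)
  rotate_distinguished_triangle T' :=
    (rotate_distinguished_triangle (F.mapTriangle.obj T')).trans
      (distinguished_iff_of_iso (F.mapTriangleRotateIso.app T'))
  complete_distinguished_triangle_morphism T₁ T₂ hT₁ hT₂ a b comm := by
    obtain ⟨c, ⟨hc₁, hc₂⟩⟩ := complete_distinguished_triangle_morphism
      (F.mapTriangle.obj T₁) (F.mapTriangle.obj T₂) hT₁ hT₂ (F.map a) (F.map b)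
      ((F.map_comp _ _).symm.trans ((congrArg F.map comm).trans (F.map_comp _ _)))
    change F.map T₁.mor₂ ≫ c = F.map b ≫ F.map T₂.mor₂ at hc₁
    change (F.map T₁.mor₃ ≫ (F.commShiftIso (1 : ℤ)).hom.app T₁.obj₁) ≫ (F.map a)⟦(1 : ℤ)⟧' =
      c ≫ F.map T₂.mor₃ ≫ (F.commShiftIso (1 : ℤ)).hom.app T₂.obj₁ at hc₂
    have key {X Y : C} (c : F.obj X ⟶ F.obj Y) : ∃ c', F.map c' = c := F.map_surjective c
    obtain ⟨c, rfl⟩ := key c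
    refine ⟨c, F.map_injective ?_, F.map_injective ?_⟩
    · exact (F.map_comp _ _).trans (hc₁.trans (F.map_comp _ _).symm)
    · rw [← cancel_mono ((F.commShiftIso (1 : ℤ)).hom.app T₂.obj₁), F.map_comp, F.map_comp,
        Category.assoc, Category.assoc]
      refine Eq.trans ?_ hc₂
      rw [Category.assoc, F.commShiftIso_hom_naturality]

namespace DGCategory

variable {k : Type w} [Field k] {D : DGCategory.{w, v, u} k}

/-! ### The Yoneda embedding -/

/-- The representable right DG-module `Hom (-, A)`. -/
abbrev yonedaObj (A : D.Obj) : DGModule D where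
  X B n := D.Hom B A n
  d h := D.d h
  act h := D.comp h
  d_d h h' x := D.d_d h h' x
  d_act h ha hb hc x f := D.d_comp h ha hb hc x f
  act_act hab hbc h x f g := D.assoc hab hbc h x f g
  act_id x := D.comp_id x

/-- The closed morphism of degree `0` from `Hom (-, A)` to `Hom (-, B)` given by composition with
a closed morphism `A ⟶ B` of degree `0`. -/
def yonedaMap {A B : D.Obj} (f : D.cocycles A B) : yonedaObj A ⟶ yonedaObj B :=
  DGModule.mkHom (M := yonedaObj A) (N := yonedaObj B) (fun _ n => D.comp (zero_add n) f.1)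
    (fun C n m h (x : D.Hom C A n) => by
      have := D.d_comp (zero_add n) (zero_add 1) h h f.1 x
      rw [mem_cocycles.1 f.2, map_zero, LinearMap.zero_apply, zero_add, Int.negOnePow_zero,
        one_smul] at this
      exact this.symm)
    (fun C C' a b c h x g => (D.assoc (zero_add a) h (by lia) f.1 x g).symm)

theorem yonedaMap_app {A B : D.Obj} (f : D.cocycles A B) (C : D.Obj) (n : ℤ) (x : D.Hom C A n) :
    DGModule.app (yonedaMap f) C n x = D.comp (zero_add n) f.1 x := rfl

theorem yonedaMap_add {A B : D.Obj} (f g : D.cocycles A B) :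
    yonedaMap (f + g) = yonedaMap f + yonedaMap g :=
  DGModule.hom_ext fun C n (x : D.Hom C A n) => by
    rw [DGModule.add_app]
    exact LinearMap.congr_fun (map_add (D.comp (zero_add n)) f.1 g.1) x

theorem yonedaMap_homotopic {A B : D.Obj} {f g : D.cocycles A B}
    (h : ∃ h : D.Hom A B (-1), D.d (neg_add_cancel 1) h = f.1 - g.1) :
    DGModule.homotopic D (yonedaMap f) (yonedaMap g) := by
  obtain ⟨h, hh⟩ := h
  refine ⟨⟨fun C p q e => D.comp (a := -1) (b := p) (c := q) (by lia) h,
    fun {C C' a b c a' c'} e ha hc x g => ?_⟩, fun C p q r hq hr (x : D.Hom C A p) => ?_⟩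
  · exact (D.assoc (a := -1) _ e _ h x g).symm
  · rw [yonedaMap_app, yonedaMap_app, ← LinearMap.sub_apply, ← map_sub, ← hh]
    have := D.d_comp (a := -1) (b := p) (c := q) (by lia) (neg_add_cancel 1) hr hq h x
    refine eq_add_of_sub_eq ?_
    refine (sub_eq_add_neg _ _).trans ?_
    refine Eq.trans ?_ this.symm
    congr 1
    rw [Int.negOnePow_neg, Int.negOnePow_one, Units.neg_smul, one_smul]

/-- The functor `[D] ⥤ [D-dgm]` induced by the Yoneda embedding `A ↦ Hom (-, A)`. -/
def yoneda (D : DGCategory.{w, v, u} k) : D.Ho ⥤ DGModule.Ho D where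
  obj A := (DGModule.toHo D).obj (yonedaObj A.obj)
  map {A B} f := Quotient.liftOn' (show HoHom A B from f)
    (fun f => (DGModule.toHo D).map (yonedaMap f)) (fun f g h =>
      (DGModule.toHo_map_eq_iff _ _).2 (yonedaMap_homotopic
        (mem_boundaries.1 ((Submodule.quotientRel_def _).1 h))))
  map_id A := by
    refine Eq.trans ?_ ((DGModule.toHo D).map_id _)
    refine congrArg (DGModule.toHo D).map ?_
    exact DGModule.hom_ext fun C n (x : D.Hom C A.obj n) => D.id_comp x
  map_comp {A B C} f g := by
    obtain ⟨f, rfl⟩ := homMk_surjective f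
    obtain ⟨g, rfl⟩ := homMk_surjective g
    refine Eq.trans ?_ ((DGModule.toHo D).map_comp (yonedaMap f) (yonedaMap g))
    refine congrArg (DGModule.toHo D).map ?_
    exact DGModule.hom_ext fun C n (x : D.Hom C A.obj n) => D.assoc _ _ _ _ _ _

theorem yoneda_map_homMk {A B : D.Ho} (f : D.cocycles A.obj B.obj) :
    (yoneda D).map (homMk f : A ⟶ B) = (DGModule.toHo D).map (yonedaMap f) := rfl

instance : (yoneda D).Additive where
  map_add {A B f g} := by
    obtain ⟨f, rfl⟩ := homMk_surjective f
    obtain ⟨g, rfl⟩ := homMk_surjective g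
    rw [← homMk_add, yoneda_map_homMk, yonedaMap_add, Functor.map_add]
    rfl

instance : (yoneda D).Faithful where
  map_injective {A B f g} h := by
    obtain ⟨f, rfl⟩ := homMk_surjective f
    obtain ⟨g, rfl⟩ := homMk_surjective g
    obtain ⟨H, hH⟩ := (DGModule.toHo_map_eq_iff (yonedaMap f) (yonedaMap g)).1 h
    rw [homMk_eq_iff]
    refine ⟨H.h A.obj (neg_add_cancel 1) (D.id A.obj), ?_⟩
    have := hH A.obj 0 (-1) 1 (neg_add_cancel 1) (zero_add 1) (D.id A.obj)
    rw [yonedaMap_app, yonedaMap_app, D.comp_id, D.comp_id] at this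
    rw [this]
    refine Eq.trans (add_zero _).symm (congrArg _ ?_)
    refine Eq.trans (map_zero (H.h A.obj (zero_add 1))).symm (congrArg _ ?_)
    exact (D.d_id _ _).symm

instance : (yoneda D).Full where
  map_surjective {A B} f := by
    obtain ⟨f, rfl⟩ := (DGModule.toHo D).map_surjective f
    refine ⟨homMk ⟨DGModule.app f A.obj 0 (D.id A.obj), ?_⟩, ?_⟩
    · refine (DGModule.app_d f (zero_add 1) _).symm.trans ?_
      refine Eq.trans (congrArg _ ?_) (map_zero _)
      exact D.d_id _ _
    · rw [yoneda_map_homMk]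
      refine congrArg (DGModule.toHo D).map ?_
      refine DGModule.hom_ext fun C n (x : D.Hom C A.obj n) => ?_
      rw [yonedaMap_app]
      refine (DGModule.app_act f (zero_add n) (D.id A.obj) x).symm.trans (congrArg _ ?_)
      exact D.id_comp x

/-! ### Pretriangulated DG-categories -/

/-- An object of a DG-category is contractible (zero up to homotopy) if its identity is of the
form `d h`, that is if it is a zero object of `[D]`. -/
def IsContractible (D : DGCategory.{w, v, u} k) (A : D.Obj) : Prop :=
  ∃ h : D.Hom A A (-1), D.d (neg_add_cancel 1) h = D.id A

/-- A DG-category is pretriangulated if it is non-empty and, in the homotopy category of right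
DG-modules, the shifts of representable DG-modules and the cones of the closed morphisms of
degree `0` between representable DG-modules are isomorphic to representable DG-modules
(so that `[D]` is a triangulated subcategory of `[D-dgm]`). -/
class IsPretriangulated (D : DGCategory.{w, v, u} k) : Prop where
  nonempty : Nonempty D.Obj
  shift : ∀ (A : D.Obj) (i : ℤ), ∃ B : D.Obj,
    Nonempty ((DGModule.toHo D).obj ((yonedaObj A)⟦i⟧) ≅ (DGModule.toHo D).obj (yonedaObj B))
  cone : ∀ {A B : D.Obj} (f : D.cocycles A B), ∃ C : D.Obj,
    Nonempty ((DGModule.toHo D).obj (DGModule.cone (yonedaMap f)) ≅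
      (DGModule.toHo D).obj (yonedaObj C))

section

variable [IsPretriangulated D]

/-- An object of `[D]` which represents the shift of a representable DG-module. -/
noncomputable def shiftRep (A : D.Ho) (i : ℤ) : D.Ho :=
  ⟨(IsPretriangulated.shift A.obj i).choose⟩

/-- The isomorphism between a shift of a representable DG-module and a representable one. -/
noncomputable def shiftRepIso (A : D.Ho) (i : ℤ) :
    (yoneda D).obj (shiftRep A i) ≅ ((yoneda D).obj A)⟦i⟧ :=
  (IsPretriangulated.shift A.obj i).choose_spec.some.symm ≪≫
    ((DGModule.toHo D).commShiftIso i).app _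

/-- The shift functors on `[D]`, induced by those on `[D-dgm]`. -/
noncomputable def shiftFun (D : DGCategory.{w, v, u} k) [IsPretriangulated D] (i : ℤ) :
    D.Ho ⥤ D.Ho where
  obj A := shiftRep A i
  map {A B} f := (yoneda D).preimage
    ((shiftRepIso A i).hom ≫ ((yoneda D).map f)⟦i⟧' ≫ (shiftRepIso B i).inv)
  map_id A := (yoneda D).map_injective (by simp)
  map_comp f g := (yoneda D).map_injective (by simp)

/-- The shift functors on `[D]` correspond to those on `[D-dgm]`. -/
noncomputable def shiftFunIso (D : DGCategory.{w, v, u} k) [IsPretriangulated D] (i : ℤ) :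
    shiftFun D i ⋙ yoneda D ≅ yoneda D ⋙ shiftFunctor (DGModule.Ho D) i :=
  NatIso.ofComponents (fun A => shiftRepIso A i) (fun f => by simp [shiftFun])

noncomputable instance hasShift : HasShift D.Ho ℤ :=
  (Functor.FullyFaithful.ofFullyFaithful (yoneda D)).hasShift (shiftFun D) (shiftFunIso D)

noncomputable instance commShift : (yoneda D).CommShift ℤ :=
  Functor.CommShift.ofHasShiftOfFullyFaithful
    (Functor.FullyFaithful.ofFullyFaithful (yoneda D)) (shiftFun D) (shiftFunIso D)

instance (i : ℤ) : (shiftFunctor D.Ho i).Additive where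
  map_add {A B f g} := by
    have : (shiftFunctor D.Ho i ⋙ yoneda D).Additive :=
      Functor.additive_of_iso ((yoneda D).commShiftIso i).symm
    refine (yoneda D).map_injective ?_
    refine ((shiftFunctor D.Ho i ⋙ yoneda D).map_add (f := f) (g := g)).trans ?_
    exact ((yoneda D).map_add (f := f⟦i⟧') (g := g⟦i⟧')).symm

instance : HasZeroObject D.Ho := by
  obtain ⟨A⟩ := IsPretriangulated.nonempty (D := D)
  obtain ⟨C, ⟨e⟩⟩ := IsPretriangulated.cone (⟨D.id A, D.d_id _ _⟩ : D.cocycles A A)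
  have h₁ : yonedaMap (⟨D.id A, D.d_id _ _⟩ : D.cocycles A A) = 𝟙 (yonedaObj A) :=
    DGModule.hom_ext fun B n (x : D.Hom B A n) => D.id_comp x
  rw [h₁] at e
  have h₂ : IsZero ((yoneda D).obj ⟨C⟩) := (DGModule.isZero_cone_id _).of_iso e.symm
  refine ⟨⟨⟨C⟩, ?_⟩⟩
  rw [IsZero.iff_id_eq_zero]
  exact (yoneda D).map_injective (h₂.eq_of_src _ _)

/-- The triangulated structure on the homotopy category `[D]` of a pretriangulated DG-category: a
triangle is distinguished if its image in `[D-dgm]` is. -/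
noncomputable instance : Pretriangulated D.Ho :=
  pretriangulatedOfFullyFaithful (yoneda D) (fun {A B} f => by
    obtain ⟨f, rfl⟩ := homMk_surjective f
    obtain ⟨C, ⟨e⟩⟩ := IsPretriangulated.cone f
    exact ⟨⟨C⟩, _, _, _, ⟨_, _, yonedaMap f, ⟨Iso.refl _⟩⟩, ⟨e⟩⟩)

end

end DGCategory


/-! ### DG-bimodules -/

/-- A DG-bimodule `φ` over `D₁` and `D₂`, that is a right DG-module over `D₂ᵒᵖ ⊗ D₁`: a complex
`φ A₂ A₁` of vector spaces for all objects `A₂` of `D₂` and `A₁` of `D₁`, with commuting associative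
unital left action `f ⊗ x ↦ f · x` of the morphisms of `D₂` and right action `x ⊗ g ↦ x · g` of the
morphisms of `D₁`, which are morphisms of complexes. -/
structure DGBimodule {k : Type w} [Field k] (D₁ : DGCategory.{w, v, u₁} k)
    (D₂ : DGCategory.{w, v, u₂} k) where
  X : D₂.Obj → D₁.Obj → ℤ → Type v
  [addCommGroup : ∀ A₂ A₁ n, AddCommGroup (X A₂ A₁ n)]
  [module : ∀ A₂ A₁ n, Module k (X A₂ A₁ n)]
  d : ∀ {A₂ : D₂.Obj} {A₁ : D₁.Obj} {n m : ℤ}, n + 1 = m → (X A₂ A₁ n →ₗ[k] X A₂ A₁ m)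
  actL : ∀ {A₂ B₂ : D₂.Obj} {A₁ : D₁.Obj} {a b c : ℤ}, a + b = c →
    (D₂.Hom A₂ B₂ a →ₗ[k] X A₂ A₁ b →ₗ[k] X B₂ A₁ c)
  actR : ∀ {A₂ : D₂.Obj} {A₁ B₁ : D₁.Obj} {a b c : ℤ}, a + b = c →
    (X A₂ B₁ a →ₗ[k] D₁.Hom A₁ B₁ b →ₗ[k] X A₂ A₁ c)
  d_d : ∀ {A₂ : D₂.Obj} {A₁ : D₁.Obj} {n m l : ℤ} (h : n + 1 = m) (h' : m + 1 = l) (x : X A₂ A₁ n),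
    d h' (d h x) = 0
  d_actL : ∀ {A₂ B₂ : D₂.Obj} {A₁ : D₁.Obj} {a b c a' b' c' : ℤ} (h : a + b = c) (ha : a + 1 = a')
    (hb : b + 1 = b') (hc : c + 1 = c') (f : D₂.Hom A₂ B₂ a) (x : X A₂ A₁ b),
    d hc (actL h f x) = actL (by lia) (D₂.d ha f) x + a.negOnePow • actL (by lia) f (d hb x)
  d_actR : ∀ {A₂ : D₂.Obj} {A₁ B₁ : D₁.Obj} {a b c a' b' c' : ℤ} (h : a + b = c) (ha : a + 1 = a')
    (hb : b + 1 = b') (hc : c + 1 = c') (x : X A₂ B₁ a) (g : D₁.Hom A₁ B₁ b),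
    d hc (actR h x g) = actR (by lia) (d ha x) g + a.negOnePow • actR (by lia) x (D₁.d hb g)
  actL_actL : ∀ {A₂ B₂ C₂ : D₂.Obj} {A₁ : D₁.Obj} {a b c ab bc abc : ℤ} (hab : a + b = ab)
    (hbc : b + c = bc) (h : ab + c = abc) (f : D₂.Hom B₂ C₂ a) (f' : D₂.Hom A₂ B₂ b)
    (x : X A₂ A₁ c), actL h (D₂.comp hab f f') x = actL (by lia) f (actL hbc f' x)
  actR_actR : ∀ {A₂ : D₂.Obj} {A₁ B₁ C₁ : D₁.Obj} {a b c ab bc abc : ℤ} (hab : a + b = ab)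
    (hbc : b + c = bc) (h : ab + c = abc) (x : X A₂ C₁ a) (g : D₁.Hom B₁ C₁ b)
    (g' : D₁.Hom A₁ B₁ c), actR h (actR hab x g) g' = actR (by lia) x (D₁.comp hbc g g')
  actL_actR : ∀ {A₂ B₂ : D₂.Obj} {A₁ B₁ : D₁.Obj} {a b c ab bc abc : ℤ} (hab : a + b = ab)
    (hbc : b + c = bc) (h : ab + c = abc) (f : D₂.Hom A₂ B₂ a) (x : X A₂ B₁ b)
    (g : D₁.Hom A₁ B₁ c), actR h (actL hab f x) g = actL (by lia) f (actR hbc x g)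
  id_actL : ∀ {A₂ : D₂.Obj} {A₁ : D₁.Obj} {n : ℤ} (x : X A₂ A₁ n),
    actL (zero_add n) (D₂.id A₂) x = x
  actR_id : ∀ {A₂ : D₂.Obj} {A₁ : D₁.Obj} {n : ℤ} (x : X A₂ A₁ n),
    actR (add_zero n) x (D₁.id A₁) = x

attribute [instance] DGBimodule.addCommGroup DGBimodule.module

namespace DGBimodule

open DGCategory

variable {k : Type w} [Field k] {D₁ : DGCategory.{w, v, u₁} k} {D₂ : DGCategory.{w, v, u₂} k}
  (φ : DGBimodule D₁ D₂)

/-! ### The gluing -/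

/-- The objects of the gluing: triples `(M₁, M₂, μ)` with `μ ∈ φ M₂ M₁` closed of degree `0`. -/
structure GluingObj where
  fst : D₁.Obj
  snd : D₂.Obj
  elt : φ.X snd fst 0
  d_elt : φ.d (zero_add 1) elt = 0

/-- The morphisms of degree `n` from `(M₁, M₂, μ)` to `(N₁, N₂, ν)` in the gluing: triples
`(f₁, f₂, f₂₁)` with `f₁ : M₁ ⟶ N₁` and `f₂ : M₂ ⟶ N₂` of degree `n` and `f₂₁ ∈ φ N₂ M₁` of
degree `n - 1`. -/
abbrev GluingHom (M N : φ.GluingObj) (n : ℤ) : Type v :=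
  D₁.Hom M.fst N.fst n × D₂.Hom M.snd N.snd n × φ.X N.snd M.fst (n - 1)

/-- The differential of the gluing:
`d (f₁, f₂, f₂₁) = (d f₁, d f₂, - d f₂₁ - f₂ · μ + ν · f₁)`. -/
def gluingD (M N : φ.GluingObj) {n m : ℤ} (h : n + 1 = m) :
    φ.GluingHom M N n →ₗ[k] φ.GluingHom M N m where
  toFun f := (D₁.d h f.1, D₂.d h f.2.1,
    - φ.d (by lia) f.2.2 - φ.actL (by lia) f.2.1 M.elt + φ.actR (by lia) N.elt f.1)
  map_add' f g := by
    refine Prod.ext (map_add _ _ _) (Prod.ext (map_add _ _ _) ?_)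
    simp only [Prod.fst_add, Prod.snd_add, map_add, LinearMap.add_apply]
    abel
  map_smul' r f := by
    refine Prod.ext (map_smul _ _ _) (Prod.ext (map_smul _ _ _) ?_)
    simp only [Prod.smul_fst, Prod.smul_snd, map_smul, LinearMap.smul_apply, RingHom.id_apply,
      smul_add, smul_sub, smul_neg]

/-- The composition of the gluing:
`(f₁, f₂, f₂₁) ∘ (g₁, g₂, g₂₁) = (f₁ ∘ g₁, f₂ ∘ g₂, f₂₁ · g₁ + (-1) ^ (deg f₂) f₂ · g₂₁)`. -/
def gluingComp (L M N : φ.GluingObj) {a b c : ℤ} (h : a + b = c) :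
    φ.GluingHom M N a →ₗ[k] φ.GluingHom L M b →ₗ[k] φ.GluingHom L N c :=
  LinearMap.mk₂ k (fun f g => (D₁.comp h f.1 g.1, D₂.comp h f.2.1 g.2.1,
      φ.actR (by lia) f.2.2 g.1 + a.negOnePow • φ.actL (by lia) f.2.1 g.2.2))
    (by
      intro f f' g
      refine Prod.ext (by simp) (Prod.ext (by simp) ?_)
      simp only [Prod.fst_add, Prod.snd_add, map_add, LinearMap.add_apply, smul_add]
      abel)
    (by
      intro r f g
      refine Prod.ext (by simp) (Prod.ext (by simp) ?_)
      simp only [Prod.smul_fst, Prod.smul_snd, map_smul, LinearMap.smul_apply, smul_add]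
      rw [smul_comm])
    (by
      intro f g g'
      refine Prod.ext (by simp) (Prod.ext (by simp) ?_)
      simp only [Prod.fst_add, Prod.snd_add, map_add, smul_add]
      abel)
    (by
      intro r f g
      refine Prod.ext (by simp) (Prod.ext (by simp) ?_)
      simp only [Prod.smul_fst, Prod.smul_snd, map_smul, smul_add]
      rw [smul_comm])

/-- The gluing `D₁ ×_φ D₂` of two DG-categories along a DG-bimodule. -/
abbrev gluing : DGCategory.{w, v, max u₁ u₂ v} k where
  Obj := φ.GluingObj
  Hom M N n := φ.GluingHom M N n
  d {M N _ _} h := φ.gluingD M N h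
  comp {L M N _ _ _} h := φ.gluingComp L M N h
  id M := (D₁.id M.fst, D₂.id M.snd, 0)
  d_d {M N n m l} h h' f := by
    refine Prod.ext (D₁.d_d h h' _) (Prod.ext (D₂.d_d h h' _) ?_)
    subst h h'
    change - φ.d _ (- φ.d _ f.2.2 - φ.actL _ f.2.1 M.elt + φ.actR _ N.elt f.1) -
      φ.actL _ (D₂.d rfl f.2.1) M.elt + φ.actR _ N.elt (D₁.d rfl f.1) = 0
    rw [map_add, map_sub, map_neg, φ.d_d,
      φ.d_actL (a := n) (b := 0) (c := n + 1 - 1) _ rfl (zero_add 1) (by lia),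
      φ.d_actR (a := 0) (b := n) (c := n + 1 - 1) _ (zero_add 1) rfl (by lia), M.d_elt, N.d_elt]
    simp only [map_zero, smul_zero, LinearMap.zero_apply, Int.negOnePow_zero, one_smul]
    abel
  d_comp {L M N a b c a' b' c'} h ha hb hc f g := by
    refine Prod.ext (D₁.d_comp h ha hb hc _ _) (Prod.ext (D₂.d_comp h ha hb hc _ _) ?_)
    subst h ha hb hc
    change - φ.d _ (φ.actR _ f.2.2 g.1 + a.negOnePow • φ.actL _ f.2.1 g.2.2) -
      φ.actL _ (D₂.comp rfl f.2.1 g.2.1) L.elt + φ.actR _ N.elt (D₁.comp rfl f.1 g.1) =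
      (φ.actR _ (- φ.d _ f.2.2 - φ.actL _ f.2.1 M.elt + φ.actR _ N.elt f.1) g.1 +
        (a + 1).negOnePow • φ.actL _ (D₂.d rfl f.2.1) g.2.2) +
      a.negOnePow • (φ.actR _ f.2.2 (D₁.d rfl g.1) + a.negOnePow •
        φ.actL _ f.2.1 (- φ.d _ g.2.2 - φ.actL _ g.2.1 L.elt + φ.actR _ M.elt g.1))
    rw [map_add, LinearMap.map_smul_of_tower,
      φ.d_actR (a := a - 1) (b := b) (c := a + b - 1) (a' := a + 1 - 1) _ (by lia) rfl (by lia),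
      φ.d_actL (a := a) (b := b - 1) (c := a + b - 1) (b' := b + 1 - 1) _ rfl (by lia) (by lia),
      φ.actL_actL (a := a) (b := b) (c := 0) (bc := b + 1 - 1) _ (by lia),
      ← φ.actR_actR (a := 0) (b := a) (c := b) (ab := a + 1 - 1) (by lia) rfl (by lia)]
    simp only [map_add, map_sub, map_neg, LinearMap.add_apply, LinearMap.sub_apply,
      LinearMap.neg_apply, smul_add, smul_sub, smul_neg, smul_smul, Int.units_mul_self, one_smul,
      Int.negOnePow_succ, Units.neg_smul, Int.negOnePow_sub, Int.negOnePow_one, mul_neg, mul_one]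
    rw [φ.actL_actR (a := a) (b := 0) (c := b) (ab := a + 1 - 1) (bc := b + 1 - 1) (by lia)
      (by lia) (by lia)]
    abel
  assoc {K L M N a b c ab bc abc} hab hbc h f g e := by
    refine Prod.ext (D₁.assoc hab hbc h _ _ _) (Prod.ext (D₂.assoc hab hbc h _ _ _) ?_)
    change φ.actR _ (φ.actR _ f.2.2 g.1 + a.negOnePow • φ.actL _ f.2.1 g.2.2) e.1 +
      ab.negOnePow • φ.actL _ (D₂.comp hab f.2.1 g.2.1) e.2.2 =
      φ.actR _ f.2.2 (D₁.comp hbc g.1 e.1) + a.negOnePow •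
        φ.actL _ f.2.1 (φ.actR _ g.2.2 e.1 + b.negOnePow • φ.actL _ g.2.1 e.2.2)
    subst hab
    simp only [map_add, LinearMap.add_apply, smul_add, LinearMap.map_smul_of_tower,
      LinearMap.smul_apply, smul_smul, Int.negOnePow_add]
    rw [φ.actR_actR (a := a - 1) (b := b) (c := c) _ hbc,
      φ.actL_actR (a := a) (b := b - 1) (c := c) (bc := bc - 1) _ (by lia),
      φ.actL_actL (a := a) (b := b) (c := c - 1) (bc := bc - 1) _ (by lia), add_assoc]
  id_comp {M N n} f := by
    refine Prod.ext (D₁.id_comp _) (Prod.ext (D₂.id_comp _) ?_)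
    change φ.actR _ 0 f.1 + (0 : ℤ).negOnePow • φ.actL _ (D₂.id N.snd) f.2.2 = f.2.2
    rw [map_zero, LinearMap.zero_apply, zero_add, Int.negOnePow_zero, one_smul]
    exact φ.id_actL _
  comp_id {M N n} f := by
    refine Prod.ext (D₁.comp_id _) (Prod.ext (D₂.comp_id _) ?_)
    change φ.actR _ f.2.2 (D₁.id M.fst) + n.negOnePow • φ.actL _ f.2.1 0 = f.2.2
    rw [map_zero, smul_zero, add_zero]
    exact φ.actR_id _



/-! ### The embeddings of the components -/

/-- The object `(M₁, O₂, 0)` of the gluing. -/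
abbrev inclObj₁ (O₂ : D₂.Obj) (M₁ : D₁.Obj) : φ.GluingObj := ⟨M₁, O₂, 0, map_zero _⟩

/-- The object `(O₁, M₂, 0)` of the gluing. -/
abbrev inclObj₂ (O₁ : D₁.Obj) (M₂ : D₂.Obj) : φ.GluingObj := ⟨O₁, M₂, 0, map_zero _⟩

theorem d_aux {A₂ B₂ : D₂.Obj} {A₁ B₁ : D₁.Obj} {n p q : ℤ} (h : p + 1 = q) (h₂ : n + 0 = q)
    (h₁ : 0 + n = q) (f₂ : D₂.Hom A₂ B₂ n) (f₁ : D₁.Hom A₁ B₁ n) :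
    - φ.d h (0 : φ.X B₂ A₁ p) - φ.actL h₂ f₂ (0 : φ.X A₂ A₁ 0) +
      φ.actR h₁ (0 : φ.X B₂ B₁ 0) f₁ = 0 := by
  simp

theorem comp_aux {A₂ B₂ : D₂.Obj} {A₁ B₁ : D₁.Obj} {a b p q r : ℤ} (h₁ : p + b = r)
    (h₂ : a + q = r) (e : ℤˣ) (f₂ : D₂.Hom A₂ B₂ a) (f₁ : D₁.Hom A₁ B₁ b) :
    φ.actR h₁ (0 : φ.X B₂ B₁ p) f₁ + e • φ.actL h₂ f₂ (0 : φ.X A₂ A₁ q) = 0 := by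
  simp

/-- The linear map `f ↦ (f, 0, 0)` on closed morphisms of degree `0`. -/
def inclMap₁ (O₂ : D₂.Obj) (M₁ N₁ : D₁.Obj) :
    D₁.cocycles M₁ N₁ →ₗ[k] φ.gluing.cocycles (φ.inclObj₁ O₂ M₁) (φ.inclObj₁ O₂ N₁) where
  toFun f := ⟨((f.1, 0, 0) : φ.GluingHom _ _ 0), by
    refine Prod.ext (mem_cocycles.1 f.2) (Prod.ext (map_zero _) ?_)
    exact φ.d_aux _ _ _ _ _⟩
  map_add' f g := Subtype.ext (Prod.ext rfl (Prod.ext (add_zero _).symm (add_zero _).symm))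
  map_smul' r f := Subtype.ext (Prod.ext rfl (Prod.ext (smul_zero _).symm (smul_zero _).symm))

/-- The linear map `f ↦ (0, f, 0)` on closed morphisms of degree `0`. -/
def inclMap₂ (O₁ : D₁.Obj) (M₂ N₂ : D₂.Obj) :
    D₂.cocycles M₂ N₂ →ₗ[k] φ.gluing.cocycles (φ.inclObj₂ O₁ M₂) (φ.inclObj₂ O₁ N₂) where
  toFun f := ⟨((0, f.1, 0) : φ.GluingHom _ _ 0), by
    refine Prod.ext (map_zero _) (Prod.ext (mem_cocycles.1 f.2) ?_)
    exact φ.d_aux _ _ _ _ _⟩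
  map_add' f g := Subtype.ext (Prod.ext (add_zero _).symm (Prod.ext rfl (add_zero _).symm))
  map_smul' r f := Subtype.ext (Prod.ext (smul_zero _).symm (Prod.ext rfl (smul_zero _).symm))

/-- The functor `i₁ : [D₁] ⥤ [D₁ ×_φ D₂]`, `M₁ ↦ (M₁, 0, 0)`, `f ↦ (f, 0, 0)`, where the zero object
of `D₂` is given by an object `O₂` which is zero up to homotopy. -/
def incl₁ (O₂ : D₂.Obj) (hO₂ : D₂.IsContractible O₂) : D₁.Ho ⥤ φ.gluing.Ho where
  obj M := ⟨φ.inclObj₁ O₂ M.obj⟩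
  map {M N} f := Quotient.liftOn' (show HoHom M N from f)
    (fun f => homMk (φ.inclMap₁ O₂ M.obj N.obj f)) (by
      intro f g h
      obtain ⟨h, hh⟩ := mem_boundaries.1 ((Submodule.quotientRel_def _).1 h)
      rw [homMk_eq_iff]
      refine ⟨((h, 0, 0) : φ.GluingHom _ _ (-1)), ?_⟩
      refine Prod.ext hh (Prod.ext ((map_zero _).trans (sub_self _).symm) ?_)
      exact (φ.d_aux _ _ _ _ _).trans (sub_zero _).symm)
  map_id M := by
    obtain ⟨h, hh⟩ := hO₂
    refine homMk_eq_iff.2 ⟨((0, -h, 0) : φ.GluingHom _ _ (-1)), ?_⟩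
    refine Prod.ext ((map_zero _).trans (sub_self _).symm) (Prod.ext ?_ ?_)
    · exact (map_neg _ _).trans ((congrArg _ hh).trans (zero_sub _).symm)
    · exact (φ.d_aux _ _ _ _ _).trans (sub_zero _).symm
  map_comp {L M N} f g := by
    obtain ⟨f, rfl⟩ := homMk_surjective f
    obtain ⟨g, rfl⟩ := homMk_surjective g
    refine congrArg homMk (Subtype.ext (Prod.ext rfl (Prod.ext (map_zero _).symm ?_)))
    exact (φ.comp_aux _ _ _ _ _).symm

/-- The functor `i₂ : [D₂] ⥤ [D₁ ×_φ D₂]`, `M₂ ↦ (0, M₂, 0)`, `f ↦ (0, f, 0)`, where the zero object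
of `D₁` is given by an object `O₁` which is zero up to homotopy. -/
def incl₂ (O₁ : D₁.Obj) (hO₁ : D₁.IsContractible O₁) : D₂.Ho ⥤ φ.gluing.Ho where
  obj M := ⟨φ.inclObj₂ O₁ M.obj⟩
  map {M N} f := Quotient.liftOn' (show HoHom M N from f)
    (fun f => homMk (φ.inclMap₂ O₁ M.obj N.obj f)) (by
      intro f g h
      obtain ⟨h, hh⟩ := mem_boundaries.1 ((Submodule.quotientRel_def _).1 h)
      rw [homMk_eq_iff]
      refine ⟨((0, h, 0) : φ.GluingHom _ _ (-1)), ?_⟩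
      refine Prod.ext ((map_zero _).trans (sub_self _).symm) (Prod.ext hh ?_)
      exact (φ.d_aux _ _ _ _ _).trans (sub_zero _).symm)
  map_id M := by
    obtain ⟨h, hh⟩ := hO₁
    refine homMk_eq_iff.2 ⟨((-h, 0, 0) : φ.GluingHom _ _ (-1)), ?_⟩
    refine Prod.ext ?_ (Prod.ext ((map_zero _).trans (sub_self _).symm) ?_)
    · exact (map_neg _ _).trans ((congrArg _ hh).trans (zero_sub _).symm)
    · exact (φ.d_aux _ _ _ _ _).trans (sub_zero _).symm
  map_comp {L M N} f g := by
    obtain ⟨f, rfl⟩ := homMk_surjective f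
    obtain ⟨g, rfl⟩ := homMk_surjective g
    refine congrArg homMk (Subtype.ext (Prod.ext (map_zero _).symm (Prod.ext rfl ?_)))
    exact (φ.comp_aux _ _ _ _ _).symm

/-! ### The bifunctor induced by a DG-bimodule -/

/-- The closed elements of degree `0` of `φ A₂ A₁`. -/
def cocycles (A₂ : D₂.Obj) (A₁ : D₁.Obj) : Submodule k (φ.X A₂ A₁ 0) :=
  LinearMap.ker (φ.d (zero_add 1))

/-- The closed elements of degree `0` of `φ A₂ A₁` of the form `d y`, with `y` of degree `-1`. -/
def boundaries (A₂ : D₂.Obj) (A₁ : D₁.Obj) : Submodule k (φ.cocycles A₂ A₁) :=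
  (LinearMap.range (φ.d (neg_add_cancel 1) : φ.X A₂ A₁ (-1) →ₗ[k] φ.X A₂ A₁ 0)).comap
    (φ.cocycles A₂ A₁).subtype

/-- The cohomology `H ^ 0` of the complex `φ A₂ A₁`. -/
abbrev H0 (A₂ : D₂.Obj) (A₁ : D₁.Obj) : Type v := φ.cocycles A₂ A₁ ⧸ φ.boundaries A₂ A₁

/-- The class in `H ^ 0 (φ A₂ A₁)` of a closed element of degree `0`. -/
abbrev H0mk {A₂ : D₂.Obj} {A₁ : D₁.Obj} (x : φ.cocycles A₂ A₁) : φ.H0 A₂ A₁ :=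
  (φ.boundaries A₂ A₁).mkQ x

theorem H0mk_surjective {A₂ : D₂.Obj} {A₁ : D₁.Obj} (x : φ.H0 A₂ A₁) : ∃ y, φ.H0mk y = x :=
  Submodule.mkQ_surjective _ x

/-- The left action of closed morphisms of degree `0` on closed elements of degree `0`. -/
def cocyclesL {A₂ B₂ : D₂.Obj} (A₁ : D₁.Obj) :
    D₂.cocycles A₂ B₂ →ₗ[k] φ.cocycles A₂ A₁ →ₗ[k] φ.cocycles B₂ A₁ :=
  LinearMap.mk₂ k (fun f x => ⟨φ.actL (add_zero 0) f.1 x.1, by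
      refine (φ.d_actL (add_zero 0) (zero_add 1) (zero_add 1) (zero_add 1) f.1 x.1).trans ?_
      rw [mem_cocycles.1 f.2, LinearMap.mem_ker.1 x.2]
      simp⟩)
    (fun _ _ _ => Subtype.ext (by simp)) (fun _ _ _ => Subtype.ext (by simp))
    (fun _ _ _ => Subtype.ext (by simp)) (fun _ _ _ => Subtype.ext (by simp))

/-- The right action of closed morphisms of degree `0` on closed elements of degree `0`. -/
def cocyclesR (A₂ : D₂.Obj) {A₁ B₁ : D₁.Obj} :
    D₁.cocycles A₁ B₁ →ₗ[k] φ.cocycles A₂ B₁ →ₗ[k] φ.cocycles A₂ A₁ :=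
  LinearMap.mk₂ k (fun g x => ⟨φ.actR (add_zero 0) x.1 g.1, by
      refine (φ.d_actR (add_zero 0) (zero_add 1) (zero_add 1) (zero_add 1) x.1 g.1).trans ?_
      rw [mem_cocycles.1 g.2, LinearMap.mem_ker.1 x.2]
      simp⟩)
    (fun _ _ _ => Subtype.ext (by simp)) (fun _ _ _ => Subtype.ext (by simp))
    (fun _ _ _ => Subtype.ext (by simp)) (fun _ _ _ => Subtype.ext (by simp))

theorem cocyclesL_mem {A₂ B₂ : D₂.Obj} {A₁ : D₁.Obj} (f : D₂.cocycles A₂ B₂)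
    {x : φ.cocycles A₂ A₁} (hx : x ∈ φ.boundaries A₂ A₁) :
    φ.cocyclesL A₁ f x ∈ φ.boundaries B₂ A₁ := by
  obtain ⟨y, hy⟩ := hx
  refine ⟨φ.actL (zero_add (-1)) f.1 y, ?_⟩
  rw [φ.d_actL (zero_add (-1)) (zero_add 1) (neg_add_cancel 1) (neg_add_cancel 1),
    mem_cocycles.1 f.2, hy]
  simp [cocyclesL]

theorem cocyclesL_mem' {A₂ B₂ : D₂.Obj} {A₁ : D₁.Obj} {f : D₂.cocycles A₂ B₂}
    (hf : f ∈ D₂.boundaries A₂ B₂) (x : φ.cocycles A₂ A₁) :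
    φ.cocyclesL A₁ f x ∈ φ.boundaries B₂ A₁ := by
  obtain ⟨h, hh⟩ := hf
  refine ⟨φ.actL (add_zero (-1)) h x.1, ?_⟩
  rw [φ.d_actL (add_zero (-1)) (neg_add_cancel 1) (zero_add 1) (neg_add_cancel 1),
    LinearMap.mem_ker.1 x.2, hh]
  simp [cocyclesL]

theorem cocyclesR_mem {A₂ : D₂.Obj} {A₁ B₁ : D₁.Obj} (g : D₁.cocycles A₁ B₁)
    {x : φ.cocycles A₂ B₁} (hx : x ∈ φ.boundaries A₂ B₁) :
    φ.cocyclesR A₂ g x ∈ φ.boundaries A₂ A₁ := by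
  obtain ⟨y, hy⟩ := hx
  refine ⟨φ.actR (add_zero (-1)) y g.1, ?_⟩
  rw [φ.d_actR (add_zero (-1)) (neg_add_cancel 1) (zero_add 1) (neg_add_cancel 1),
    mem_cocycles.1 g.2, hy]
  simp [cocyclesR]

theorem cocyclesR_mem' {A₂ : D₂.Obj} {A₁ B₁ : D₁.Obj} {g : D₁.cocycles A₁ B₁}
    (hg : g ∈ D₁.boundaries A₁ B₁) (x : φ.cocycles A₂ B₁) :
    φ.cocyclesR A₂ g x ∈ φ.boundaries A₂ A₁ := by
  obtain ⟨h, hh⟩ := hg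
  refine ⟨φ.actR (zero_add (-1)) x.1 h, ?_⟩
  rw [φ.d_actR (zero_add (-1)) (zero_add 1) (neg_add_cancel 1) (neg_add_cancel 1),
    LinearMap.mem_ker.1 x.2, hh]
  simp [cocyclesR]

/-- The left action of morphisms of `[D₂]` on `H ^ 0 (φ A₂ A₁)`. -/
def H0L {A₂ B₂ : D₂.Ho} (A₁ : D₁.Ho) :
    (A₂ ⟶ B₂) → (φ.H0 A₂.obj A₁.obj →ₗ[k] φ.H0 B₂.obj A₁.obj) := fun f =>
  Quotient.liftOn' (show HoHom A₂ B₂ from f)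
    (fun f => Submodule.mapQ _ _ (φ.cocyclesL A₁.obj f) fun _ hx => φ.cocyclesL_mem f hx) (by
      intro f g h
      refine LinearMap.ext fun x => ?_
      obtain ⟨x, rfl⟩ := φ.H0mk_surjective x
      refine (Submodule.Quotient.eq _).2 ?_
      rw [← LinearMap.sub_apply, ← map_sub]
      exact φ.cocyclesL_mem' ((Submodule.quotientRel_def _).1 h) x)

/-- The right action of morphisms of `[D₁]` on `H ^ 0 (φ A₂ A₁)`. -/
def H0R (A₂ : D₂.Ho) {A₁ B₁ : D₁.Ho} :
    (A₁ ⟶ B₁) → (φ.H0 A₂.obj B₁.obj →ₗ[k] φ.H0 A₂.obj A₁.obj) := fun g =>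
  Quotient.liftOn' (show HoHom A₁ B₁ from g)
    (fun g => Submodule.mapQ _ _ (φ.cocyclesR A₂.obj g) fun _ hx => φ.cocyclesR_mem g hx) (by
      intro f g h
      refine LinearMap.ext fun x => ?_
      obtain ⟨x, rfl⟩ := φ.H0mk_surjective x
      refine (Submodule.Quotient.eq _).2 ?_
      rw [← LinearMap.sub_apply, ← map_sub]
      exact φ.cocyclesR_mem' ((Submodule.quotientRel_def _).1 h) x)

theorem H0L_mk {A₂ B₂ : D₂.Ho} (A₁ : D₁.Ho) (f : D₂.cocycles A₂.obj B₂.obj)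
    (x : φ.cocycles A₂.obj A₁.obj) :
    φ.H0L A₁ (homMk f : A₂ ⟶ B₂) (φ.H0mk x) = φ.H0mk (φ.cocyclesL A₁.obj f x) := rfl

theorem H0R_mk (A₂ : D₂.Ho) {A₁ B₁ : D₁.Ho} (g : D₁.cocycles A₁.obj B₁.obj)
    (x : φ.cocycles A₂.obj B₁.obj) :
    φ.H0R A₂ (homMk g : A₁ ⟶ B₁) (φ.H0mk x) = φ.H0mk (φ.cocyclesR A₂.obj g x) := rfl

theorem H0R_H0L {A₂ B₂ : D₂.Ho} {A₁ B₁ : D₁.Ho} (f : A₂ ⟶ B₂) (g : A₁ ⟶ B₁)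
    (x : φ.H0 A₂.obj B₁.obj) :
    φ.H0R B₂ g (φ.H0L B₁ f x) = φ.H0L A₁ f (φ.H0R A₂ g x) := by
  obtain ⟨f, rfl⟩ := homMk_surjective f
  obtain ⟨g, rfl⟩ := homMk_surjective g
  obtain ⟨x, rfl⟩ := φ.H0mk_surjective x
  rw [H0L_mk, H0R_mk, H0R_mk, H0L_mk]
  exact congrArg φ.H0mk (Subtype.ext (φ.actL_actR _ _ _ f.1 x.1 g.1))

theorem H0L_id (A₂ : D₂.Ho) (A₁ : D₁.Ho) (x : φ.H0 A₂.obj A₁.obj) : φ.H0L A₁ (𝟙 A₂) x = x := by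
  obtain ⟨x, rfl⟩ := φ.H0mk_surjective x
  rw [id_eq_homMk, H0L_mk]
  exact congrArg φ.H0mk (Subtype.ext (φ.id_actL x.1))

theorem H0R_id (A₂ : D₂.Ho) (A₁ : D₁.Ho) (x : φ.H0 A₂.obj A₁.obj) : φ.H0R A₂ (𝟙 A₁) x = x := by
  obtain ⟨x, rfl⟩ := φ.H0mk_surjective x
  rw [id_eq_homMk, H0R_mk]
  exact congrArg φ.H0mk (Subtype.ext (φ.actR_id x.1))

theorem H0L_comp {A₂ B₂ C₂ : D₂.Ho} (A₁ : D₁.Ho) (f : A₂ ⟶ B₂) (g : B₂ ⟶ C₂)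
    (x : φ.H0 A₂.obj A₁.obj) : φ.H0L A₁ (f ≫ g) x = φ.H0L A₁ g (φ.H0L A₁ f x) := by
  obtain ⟨f, rfl⟩ := homMk_surjective f
  obtain ⟨g, rfl⟩ := homMk_surjective g
  obtain ⟨x, rfl⟩ := φ.H0mk_surjective x
  rw [homMk_comp, H0L_mk, H0L_mk, H0L_mk]
  exact congrArg φ.H0mk (Subtype.ext (φ.actL_actL _ _ _ g.1 f.1 x.1))

theorem H0R_comp (A₂ : D₂.Ho) {A₁ B₁ C₁ : D₁.Ho} (f : A₁ ⟶ B₁) (g : B₁ ⟶ C₁)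
    (x : φ.H0 A₂.obj C₁.obj) : φ.H0R A₂ (f ≫ g) x = φ.H0R A₂ f (φ.H0R A₂ g x) := by
  obtain ⟨f, rfl⟩ := homMk_surjective f
  obtain ⟨g, rfl⟩ := homMk_surjective g
  obtain ⟨x, rfl⟩ := φ.H0mk_surjective x
  rw [homMk_comp, H0R_mk, H0R_mk, H0R_mk]
  exact congrArg φ.H0mk (Subtype.ext (φ.actR_actR _ _ _ x.1 g.1 f.1).symm)

/-- The bifunctor `(A₁, A₂) ↦ H ^ 0 (φ A₂ A₁)` induced by `φ` on the homotopy categories. -/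
def bifunctor : D₁.Hoᵒᵖ ⥤ D₂.Ho ⥤ ModuleCat.{v} k where
  obj A₁ :=
    { obj := fun A₂ => ModuleCat.of k (φ.H0 A₂.obj A₁.unop.obj)
      map := fun f => ModuleCat.ofHom (φ.H0L A₁.unop f)
      map_id := fun A₂ => ModuleCat.hom_ext (LinearMap.ext fun x => φ.H0L_id A₂ A₁.unop x)
      map_comp := fun f g =>
        ModuleCat.hom_ext (LinearMap.ext fun x => φ.H0L_comp A₁.unop f g x) }
  map g :=
    { app := fun A₂ => ModuleCat.ofHom (φ.H0R A₂ g.unop)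
      naturality := fun _ _ f =>
        ModuleCat.hom_ext (LinearMap.ext fun x => φ.H0R_H0L f g.unop x) }
  map_id A₁ := NatTrans.ext (funext fun A₂ =>
    ModuleCat.hom_ext (LinearMap.ext fun x => φ.H0R_id A₂ A₁.unop x))
  map_comp f g := NatTrans.ext (funext fun A₂ =>
    ModuleCat.hom_ext (LinearMap.ext fun x => φ.H0R_comp A₂ g.unop f.unop x))

end DGBimodule

/-! ### Semiorthogonal decompositions -/

section

variable {T : Type u} [Category.{v} T] [Preadditive T] [HasZeroObject T] [HasShift T ℤ]
  [∀ i : ℤ, (shiftFunctor T i).Additive] [Pretriangulated T]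

/-- A semiorthogonal decomposition `T = ⟨T₁, T₂⟩` of a triangulated category: strictly full
triangulated subcategories `T₁` and `T₂` such that there are no non-zero morphisms from
objects of `T₂` to objects of `T₁` and every object `F` fits into a distinguished
triangle `F₂ ⟶ F ⟶ F₁ ⟶ F₂[1]` with `F₂` in `T₂` and `F₁` in `T₁`. -/
structure IsSemiorthogonalDecomposition (T₁ T₂ : ObjectProperty T) : Prop where
  triangulated₁ : T₁.IsTriangulated
  triangulated₂ : T₂.IsTriangulated
  strict₁ : T₁.IsClosedUnderIsomorphisms
  strict₂ : T₂.IsClosedUnderIsomorphisms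
  hom_eq_zero : ∀ {F₂ F₁ : T}, T₂ F₂ → T₁ F₁ → ∀ f : F₂ ⟶ F₁, f = 0
  exists_triangle : ∀ F : T, ∃ (F₂ F₁ : T) (f : F₂ ⟶ F) (g : F ⟶ F₁) (h : F₁ ⟶ F₂⟦(1 : ℤ)⟧),
    T₂ F₂ ∧ T₁ F₁ ∧ Triangle.mk f g h ∈ distTriang T

end

/-- The gluing bifunctor `(F₁, F₂) ↦ Hom (F₁, F₂[1])` of a triangulated category with
two subcategories, the images of `i₁` and `i₂`. -/
noncomputable def gluingBifunctor (k : Type w) [Field k] {T : Type u} [Category.{v} T] [Preadditive T]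
    [Linear k T] [HasShift T ℤ] {T₁ : Type u₁} [Category.{v} T₁] {T₂ : Type u₂} [Category.{v} T₂]
    (i₁ : T₁ ⥤ T) (i₂ : T₂ ⥤ T) : T₁ᵒᵖ ⥤ T₂ ⥤ ModuleCat.{v} k :=
  i₁.op ⋙ linearCoyoneda k T ⋙
    (Functor.whiskeringLeft T₂ T (ModuleCat.{v} k)).obj (i₂ ⋙ shiftFunctor T (1 : ℤ))

/-!
Write `Y` for the Yoneda embedding of `[D]` in the homotopy category of right DG-modules over the
gluing `D = D₁ ×_φ D₂`. Everything rests on one exact sequence of DG-modules, which is split except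
for the differentials: for an object `M = (M₁, M₂, μ)`, the projection `(f₁, f₂, f₂₁) ↦ f₁` gives
`0 ⟶ E ⟶ Hom (-, M) ⟶ Hom (pr₁ -, M₁) ⟶ 0`, where `E = Hom (pr₂ -, M₂) ⊕ φ (M₂, pr₁ -)[-1]` only
depends on `M₂` (`DGBimodule.kerSplitting`). Such a sequence defines a distinguished triangle
(`SemiSplitting.triangle_distinguished`). If `O₁` and `O₂` are contractible, the sequences of
`(O₁, M₂, 0)` and `(M₁, O₂, 0)` show that `E` is `Y (O₁, M₂, 0)` and that `Hom (pr₁ -, M₁)` is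
`Y (M₁, O₂, 0)` up to homotopy. Hence every `Y M` is an extension of `Y (i₁ M₁)` by `Y (i₂ M₂)`.

Conversely, every such extension is representable (`DGBimodule.essImage_yoneda_of_triangle`): its
connecting morphism is given by a closed morphism of degree `1` from `(M₁, O₂, 0)` to `(O₁, M₂, 0)`,
which up to homotopy is of the form `(0, 0, μ)` with `μ` in `φ (M₂, M₁)` closed of degree `0`
(`DGBimodule.exists_homOne_ofElt`), and `(M₁, M₂, -μ)` represents the extension.

To see that the gluing is pretriangulated, it remains to know that the DG-modules of the two kinds
are stable under shifts and cones, as shifts and cones of the exact sequences above are again of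
this form. For the quotients `Hom (pr₁ -, M₁)` this holds because restriction along `pr₁` is a
triangulated functor. For the DG-modules `Y (i₂ M₂)` restriction along the inclusion
`f ↦ (0, f, 0)` of `D₂` is used, which is compatible with compositions but not with identities: the
DG-modules isomorphic to some `Y (i₂ M₂)` are those which are left orthogonal to the kernel of this
restriction and whose restriction is representable (`DGBimodule.nonempty_iso_of_leftOrthogonal`).

The functor `i₁` is right adjoint to the projection to `[D₁]` and `i₂` is left adjoint to the
projection to `[D₂]`, with invertible counit and unit respectively, which gives full faithfulness
and the vanishing of morphisms from the image of `i₂` to the image of `i₁`. Under the Yoneda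
embeddings `i₁` and the projection to `[D₂]` become restriction functors, hence are triangulated,
and `i₂` is triangulated as a left adjoint of a triangulated functor. The triangles of the
semiorthogonal decomposition are those above, and the isomorphism of the gluing bifunctor with the
one induced by `φ` is `μ ↦ (0, 0, μ)` (`DGBimodule.gluingEquiv`).
-/

namespace DGModule

variable {k : Type w} [Field k] {D : DGCategory.{w, v, u} k}

/-! ### The Yoneda lemma for right DG-modules -/

/-- The closed morphism `Hom (-, A) ⟶ N`, `f ↦ z · f`, defined by a closed element `z` of degree `0`
of `N A`. -/
def yonedaHom {A : D.Obj} {N : DGModule D} (z : N.X A 0) (hz : N.d (zero_add 1) z = 0) :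
    DGCategory.yonedaObj A ⟶ N :=
  mkHom (M := DGCategory.yonedaObj A) (N := N) (fun _ n => N.act (zero_add n) z)
    (fun C n m h (x : D.Hom C A n) => by
      have := N.d_act (zero_add n) (zero_add 1) h h z x
      rw [hz, map_zero, LinearMap.zero_apply, zero_add, Int.negOnePow_zero, one_smul] at this
      exact this.symm)
    (fun C C' a b c h x g => (N.act_act (zero_add a) h (by lia) z x g).symm)

theorem yonedaHom_app {A : D.Obj} {N : DGModule D} (z : N.X A 0) (hz : N.d (zero_add 1) z = 0)
    (C : D.Obj) (n : ℤ) (x : D.Hom C A n) :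
    app (yonedaHom z hz) C n x = N.act (zero_add n) z x := rfl

/-- The Yoneda lemma: a closed morphism is defined by the image of the identity. -/
theorem exists_eq_yonedaHom {A : D.Obj} {N : DGModule D} (f : DGCategory.yonedaObj A ⟶ N) :
    ∃ z hz, f = yonedaHom (N := N) z hz := by
  refine ⟨app f A 0 (D.id A), ?_, hom_ext fun C n (x : D.Hom C A n) => ?_⟩
  · refine (app_d f (zero_add 1) _).symm.trans ?_
    refine Eq.trans (congrArg _ ?_) (map_zero _)
    exact D.d_id _ _
  · rw [yonedaHom_app]
    refine Eq.trans (congrArg _ ?_) (app_act f (zero_add n) (D.id A) x)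
    exact (D.id_comp x).symm

/-- The morphisms `Hom (-, A) ⟶ N` up to homotopy are the classes of `H ^ 0 (N A)`. -/
theorem toHo_map_yonedaHom_eq_iff {A : D.Obj} {N : DGModule D} (z z' : N.X A 0)
    (hz : N.d (zero_add 1) z = 0) (hz' : N.d (zero_add 1) z' = 0) :
    (toHo D).map (yonedaHom z hz) = (toHo D).map (yonedaHom z' hz') ↔
      ∃ w : N.X A (-1), N.d (neg_add_cancel 1) w = z - z' := by
  rw [toHo_map_eq_iff]
  constructor
  · rintro ⟨H, hH⟩
    refine ⟨H.h A (neg_add_cancel 1) (D.id A), ?_⟩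
    have := hH A 0 (-1) 1 (neg_add_cancel 1) (zero_add 1) (D.id A)
    rw [yonedaHom_app, yonedaHom_app, N.act_id, N.act_id] at this
    rw [this]
    refine Eq.trans (add_zero _).symm (congrArg _ ?_)
    refine Eq.trans (map_zero (H.h A (zero_add 1))).symm (congrArg _ ?_)
    exact (D.d_id _ _).symm
  · rintro ⟨w, hw⟩
    refine ⟨⟨fun C p q e => N.act (a := -1) (b := p) (c := q) (by lia) w,
      fun {C C' a b c a' c'} e ha hc x g => ?_⟩, fun C p q r hq hr (x : D.Hom C A p) => ?_⟩
    · exact (N.act_act (a := -1) _ e _ w x g).symm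
    · rw [yonedaHom_app, yonedaHom_app, ← LinearMap.sub_apply, ← map_sub, ← hw]
      have := N.d_act (a := -1) (b := p) (c := q) (by lia) (neg_add_cancel 1) hr hq w x
      refine eq_add_of_sub_eq ?_
      refine (sub_eq_add_neg _ _).trans ?_
      refine Eq.trans ?_ this.symm
      congr 1
      rw [Int.negOnePow_neg, Int.negOnePow_one, Units.neg_smul, one_smul]

theorem toHo_map_yonedaHom_eq_zero_iff {A : D.Obj} {N : DGModule D} (z : N.X A 0)
    (hz : N.d (zero_add 1) z = 0) :
    (toHo D).map (yonedaHom z hz) = 0 ↔ ∃ w : N.X A (-1), N.d (neg_add_cancel 1) w = z := by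
  have h := toHo_map_yonedaHom_eq_iff z 0 hz (map_zero _)
  have h' : yonedaHom (N := N) (A := A) 0 (map_zero _) = 0 := hom_ext fun C n x => by
    rw [yonedaHom_app, map_zero, LinearMap.zero_apply, zero_app]
  rwa [h', Functor.map_zero, sub_zero] at h

/-! ### Semi-split exact sequences of DG-modules -/

/-- A short exact sequence `0 ⟶ E ⟶ N ⟶ P ⟶ 0` of right DG-modules with a splitting `s`, `r` which
is compatible with the grading and with the action, but not with the differentials. The
compatibility of the retraction `r` with the action follows from that of the section `s`. -/
structure SemiSplitting {E N P : DGModule D} (i : E ⟶ N) (p : N ⟶ P) where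
  s : ∀ (A : D.Obj) (n : ℤ), P.X A n →ₗ[k] N.X A n
  r : ∀ (A : D.Obj) (n : ℤ), N.X A n →ₗ[k] E.X A n
  s_act : ∀ {A B : D.Obj} {a b c : ℤ} (h : a + b = c) (x : P.X B a) (g : D.Hom A B b),
    s A c (P.act h x g) = N.act h (s B a x) g
  p_s : ∀ {A : D.Obj} {n : ℤ} (x : P.X A n), app p A n (s A n x) = x
  r_i : ∀ {A : D.Obj} {n : ℤ} (x : E.X A n), r A n (app i A n x) = x
  p_i : ∀ {A : D.Obj} {n : ℤ} (x : E.X A n), app p A n (app i A n x) = 0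
  i_r : ∀ {A : D.Obj} {n : ℤ} (x : N.X A n), app i A n (r A n x) + s A n (app p A n x) = x

namespace SemiSplitting

variable {E N P : DGModule D} {i : E ⟶ N} {p : N ⟶ P} (S : SemiSplitting i p)

include S in
theorem i_injective {A : D.Obj} {n : ℤ} {x y : E.X A n} (h : app i A n x = app i A n y) :
    x = y := by
  rw [← S.r_i x, h, S.r_i]

theorem i_r' {A : D.Obj} {n : ℤ} (x : N.X A n) :
    app i A n (S.r A n x) = x - S.s A n (app p A n x) := eq_sub_of_add_eq (S.i_r x)

theorem r_act {A B : D.Obj} {a b c : ℤ} (h : a + b = c) (x : N.X B a) (g : D.Hom A B b) :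
    S.r A c (N.act h x g) = E.act h (S.r B a x) g := by
  refine S.i_injective ?_
  rw [S.i_r', app_act i, S.i_r', app_act p, S.s_act, map_sub, LinearMap.sub_apply]

theorem r_s {A : D.Obj} {n : ℤ} (x : P.X A n) : S.r A n (S.s A n x) = 0 := by
  refine S.i_injective ?_
  rw [S.i_r', S.p_s, sub_self, map_zero]

/-- The component `x ↦ r (d (s x))` of the differential of `N`. -/
def rds (A : D.Obj) {n m : ℤ} (h : n + 1 = m) : P.X A n →ₗ[k] E.X A m :=
  S.r A m ∘ₗ N.d h ∘ₗ S.s A n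

theorem rds_apply (A : D.Obj) {n m : ℤ} (h : n + 1 = m) (x : P.X A n) :
    S.rds A h x = S.r A m (N.d h (S.s A n x)) := rfl

theorem i_rds (A : D.Obj) {n m : ℤ} (h : n + 1 = m) (x : P.X A n) :
    app i A m (S.rds A h x) = N.d h (S.s A n x) - S.s A m (P.d h x) := by
  rw [rds_apply, S.i_r', app_d, S.p_s]

theorem rds_d (A : D.Obj) {n m l : ℤ} (h : n + 1 = m) (h' : m + 1 = l) (x : P.X A n) :
    S.rds A h' (P.d h x) = - E.d h' (S.rds A h x) := by
  refine S.i_injective ?_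
  rw [map_neg, app_d, i_rds, i_rds, map_sub, P.d_d, map_zero, sub_zero, N.d_d, zero_sub, neg_neg]

theorem rds_act {A B : D.Obj} {a b c a' c' : ℤ} (h : a + b = c) (ha : a + 1 = a') (hc : c + 1 = c')
    (x : P.X B a) (g : D.Hom A B b) :
    S.rds A hc (P.act h x g) = E.act (by lia) (S.rds B ha x) g := by
  rw [rds_apply, rds_apply, S.s_act, N.d_act h ha rfl hc, map_add, S.r_act,
    LinearMap.map_smul_of_tower, S.r_act, S.r_s, map_zero, LinearMap.zero_apply, smul_zero,
    add_zero]

/-- The connecting morphism `P ⟶ E[1]`, `x ↦ - r (d (s x))`. -/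
def δ : P ⟶ E⟦(1 : ℤ)⟧ :=
  mkHom (M := P) (N := shiftObj E 1) (fun A n => - S.rds A rfl)
    (fun A n m h x => by
      subst h
      rw [shiftObj_d, LinearMap.neg_apply, rds_d _ _ rfl, Int.negOnePow_one, Units.neg_smul,
        one_smul, LinearMap.neg_apply, map_neg])
    (fun A B a b c h x g => by
      rw [LinearMap.neg_apply, S.rds_act h rfl rfl, LinearMap.neg_apply, map_neg,
        LinearMap.neg_apply])

/-- The section `x ↦ (s x, - r (d (s x)))` of the morphism `cone i ⟶ P` induced by `p`. -/
def toCone : P ⟶ cone i :=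
  mkHom (M := P) (N := cone i) (fun A n => LinearMap.prod (S.s A n) (- S.rds A rfl))
    (fun A n m h x => by
      subst h
      refine Prod.ext ?_ ?_
      · simp [Function.prod, i_rds]
      · simp [Function.prod, S.rds_d _ rfl])
    (fun A B a b c h x g => by
      refine Prod.ext ?_ ?_
      · simp [Function.prod, S.s_act]
      · simp [Function.prod, S.rds_act h rfl rfl])

theorem toCone_conePr : S.toCone ≫ conePr i = S.δ := rfl

include S in
/-- The morphism `cone i ⟶ P` induced by `p`. -/
def fromCone : cone i ⟶ P :=
  mkHom (M := cone i) (N := P) (fun A n => app p A n ∘ₗ LinearMap.fst k _ _)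
    (fun A n m h x => by
      subst h
      simp [Function.prod, app_d, S.p_i])
    (fun A B a b c h x g => by simp [app_act])

theorem toCone_fromCone : S.toCone ≫ S.fromCone = 𝟙 P := hom_ext fun _ _ x => S.p_s x

/-- The composition is homotopic to the identity through `(x, y) ↦ (0, r x)`. -/
theorem fromCone_toCone : (toHo D).map S.fromCone ≫ (toHo D).map S.toCone = 𝟙 _ := by
  rw [← Functor.map_comp, ← (toHo D).map_id, eq_comm, toHo_map_eq_iff]
  refine ⟨⟨fun A p q e => LinearMap.inr k _ _ ∘ₗ E.cast A e.symm ∘ₗ S.r A p ∘ₗ LinearMap.fst k _ _,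
    fun {A B a b c a' c'} e ha hc x g => ?_⟩, fun A n q r hq hr x => ?_⟩
  · subst ha hc
    simp [S.r_act]
  · subst hq hr
    have e : S.r A (q + 1 + 1) (N.d rfl (S.s A (q + 1) (app p A (q + 1) x.1))) =
        S.r A (q + 1 + 1) (N.d rfl x.1) - E.d rfl (S.r A (q + 1) x.1) := by
      have h := congrArg (fun y => S.r A (q + 1 + 1) (N.d rfl y)) (S.i_r x.1)
      simp only [map_add, ← app_d, S.r_i] at h
      exact eq_sub_of_add_eq' h
    refine Prod.ext ?_ ?_
    · change x.1 - S.s A _ (app p A _ x.1) = _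
      simp [Function.prod, S.i_r']
    · change x.2 - - S.r A _ (N.d rfl (S.s A _ (app p A _ x.1))) = _
      rw [e]
      simp [Function.prod, S.r_i]
      abel

/-- The isomorphism `cone i ≅ P` in the homotopy category. -/
def coneIso : (toHo D).obj (cone i) ≅ (toHo D).obj P where
  hom := (toHo D).map S.fromCone
  inv := (toHo D).map S.toCone
  hom_inv_id := S.fromCone_toCone
  inv_hom_id := by
    rw [← Functor.map_comp, S.toCone_fromCone]
    exact (toHo D).map_id _

/-- The triangle defined by a semi-split exact sequence. -/
noncomputable abbrev triangle : Triangle (Ho D) :=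
  (toHo D).mapTriangle.obj (Triangle.mk i p S.δ)

/-- The triangle of a semi-split exact sequence is isomorphic to the standard triangle of `i`. -/
theorem triangle_distinguished : S.triangle ∈ distTriang (Ho D) := by
  refine ⟨_, _, i, ⟨Triangle.isoMk _ _ (Iso.refl _) (Iso.refl _) S.coneIso.symm ?_ ?_ ?_⟩⟩
  · exact (Category.comp_id _).trans (Category.id_comp _).symm
  · refine Eq.trans ?_ (Category.id_comp _).symm
    refine (Iso.comp_inv_eq S.coneIso).2 ?_
    exact (toHo D).map_comp (coneIn i) S.fromCone
  · change ((toHo D).map S.δ ≫ ((toHo D).commShiftIso (1 : ℤ)).hom.app E) ≫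
      (𝟙 ((toHo D).obj E))⟦(1 : ℤ)⟧' = (toHo D).map S.toCone ≫ (toHo D).map (conePr i) ≫
        ((toHo D).commShiftIso (1 : ℤ)).hom.app E
    rw [CategoryTheory.Functor.map_id]
    refine (Category.comp_id _).trans ?_
    rw [← S.toCone_conePr, Functor.map_comp, Category.assoc]

end SemiSplitting

/-! ### Cones of semi-split exact sequences -/

/-- The morphism of cones defined by a commutative square. -/
def coneMap {M N M' N' : DGModule D} {f : M ⟶ N} {f' : M' ⟶ N'} (a : M ⟶ M') (b : N ⟶ N')
    (h : f ≫ b = a ≫ f') : cone f ⟶ cone f' :=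
  mkHom (M := cone f) (N := cone f') (fun A n => LinearMap.prodMap (app b A n) (app a A (n + 1)))
    (fun A n m e x => by
      subst e
      have := congrArg (fun φ => app φ A (n + 1) x.2) h
      rw [comp_app, comp_app] at this
      simp [Function.prod, app_d, this])
    (fun A B a b c e x g => by simp [app_act])

/-- The cones of the vertical morphisms of a morphism of semi-split exact sequences form a
semi-split exact sequence. -/
def SemiSplitting.cone {E N P E' N' P' : DGModule D} {i : E ⟶ N} {p : N ⟶ P} {i' : E' ⟶ N'}
    {p' : N' ⟶ P'} (S : SemiSplitting i p) (S' : SemiSplitting i' p') {a : E ⟶ E'} {b : N ⟶ N'}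
    {c : P ⟶ P'} (hi : a ≫ i' = i ≫ b) (hp : b ≫ p' = p ≫ c) :
    SemiSplitting (coneMap i i' hi) (coneMap p p' hp) where
  s A n := LinearMap.prodMap (S'.s A n) (S.s A (n + 1))
  r A n := LinearMap.prodMap (S'.r A n) (S.r A (n + 1))
  s_act h x g := Prod.ext (S'.s_act h x.1 g) (S.s_act _ x.2 g)
  p_s x := Prod.ext (S'.p_s x.1) (S.p_s x.2)
  r_i x := Prod.ext (S'.r_i x.1) (S.r_i x.2)
  p_i x := Prod.ext (S'.p_i x.1) (S.p_i x.2)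
  i_r x := Prod.ext (S'.i_r x.1) (S.i_r x.2)

end DGModule

/-! ### Restriction of DG-modules along non-unital DG-functors -/

/-- A DG-functor which is not required to preserve the identities, so that the image `e A` of the
identity of `A` is only a closed idempotent of degree `0`. The inclusion `f ↦ (0, f, 0)` of the
second component in a gluing is of this kind. -/
structure NonUnitalDGFunctor {k : Type w} [Field k] (D' : DGCategory.{w, v, u₁} k)
    (D : DGCategory.{w, v, u₂} k) where
  obj : D'.Obj → D.Obj
  map : ∀ {A B : D'.Obj} {n : ℤ}, D'.Hom A B n →ₗ[k] D.Hom (obj A) (obj B) n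
  map_d : ∀ {A B : D'.Obj} {n m : ℤ} (h : n + 1 = m) (f : D'.Hom A B n),
    map (D'.d h f) = D.d h (map f)
  map_comp : ∀ {A B C : D'.Obj} {a b c : ℤ} (h : a + b = c) (f : D'.Hom B C a) (g : D'.Hom A B b),
    map (D'.comp h f g) = D.comp h (map f) (map g)

namespace NonUnitalDGFunctor

open DGModule

variable {k : Type w} [Field k] {D' : DGCategory.{w, v, u₁} k} {D : DGCategory.{w, v, u₂} k}
  (F : NonUnitalDGFunctor D' D)

/-- The idempotent image of the identity of `A`. -/
def e (A : D'.Obj) : D.Hom (F.obj A) (F.obj A) 0 := F.map (D'.id A)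

theorem d_e (A : D'.Obj) {n : ℤ} (h : 0 + 1 = n) : D.d h (F.e A) = 0 := by
  rw [e, ← F.map_d, D'.d_id, map_zero]

theorem map_e {A B : D'.Obj} {n m : ℤ} (h : n + 0 = m) (h' : n = m) (f : D'.Hom A B n) :
    D.comp h (F.map f) (F.e A) = h' ▸ F.map f := by
  subst h'
  rw [e, ← F.map_comp, D'.comp_id]

/-- The elements `z` of `M (F A)` such that `z · e A = z`: the direct factor `M (F A) · e A`. -/
abbrev fixed (M : DGModule D) (A : D'.Obj) (n : ℤ) : Submodule k (M.X (F.obj A) n) :=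
  LinearMap.eqLocus ((M.act (add_zero n)).flip (F.e A)) LinearMap.id

variable {F} in
theorem mem_fixed {M : DGModule D} {A : D'.Obj} {n : ℤ} {z : M.X (F.obj A) n} :
    z ∈ F.fixed M A n ↔ M.act (add_zero n) z (F.e A) = z := Iff.rfl

theorem act_map_mem_fixed (M : DGModule D) {A B : D'.Obj} {a b c : ℤ} (h : a + b = c)
    (z : M.X (F.obj B) a) (f : D'.Hom A B b) : M.act h z (F.map f) ∈ F.fixed M A c := by
  rw [mem_fixed, M.act_act h (add_zero b), F.map_e _ rfl]

theorem d_mem_fixed (M : DGModule D) {A : D'.Obj} {n m : ℤ} (h : n + 1 = m)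
    {z : M.X (F.obj A) n} (hz : z ∈ F.fixed M A n) : M.d h z ∈ F.fixed M A m := by
  have := M.d_act (add_zero n) h (zero_add 1) h z (F.e A)
  rw [F.d_e, map_zero, smul_zero, add_zero, mem_fixed.1 hz] at this
  exact this.symm

theorem app_mem_fixed {M N : DGModule D} (f : M ⟶ N) {A : D'.Obj} {n : ℤ}
    {z : M.X (F.obj A) n} (hz : z ∈ F.fixed M A n) : app f (F.obj A) n z ∈ F.fixed N A n := by
  rw [mem_fixed, ← app_act, mem_fixed.1 hz]

/-- The restriction of a right DG-module along a non-unital DG-functor: `A ↦ M (F A) · e A`. -/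
abbrev resObj (M : DGModule D) : DGModule D' where
  X A n := F.fixed M A n
  d {A n m} h := (M.d h).restrict (p := F.fixed M A n) (q := F.fixed M A m)
    fun _ hz => F.d_mem_fixed M h hz
  act {A B a b c} h := LinearMap.mk₂ k
    (fun z f => ⟨M.act h z.1 (F.map f), F.act_map_mem_fixed M h z.1 f⟩)
    (fun _ _ _ => Subtype.ext (by simp)) (fun _ _ _ => Subtype.ext (by simp))
    (fun _ _ _ => Subtype.ext (by simp)) (fun _ _ _ => Subtype.ext (by simp))
  d_d h h' z := Subtype.ext (M.d_d h h' z.1)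
  d_act h ha hb hc z f := Subtype.ext (by
    refine (M.d_act h ha hb hc z.1 (F.map f)).trans ?_
    rw [← F.map_d]
    rfl)
  act_act hab hbc h z f g := Subtype.ext (by
    refine (M.act_act hab hbc h z.1 (F.map f) (F.map g)).trans ?_
    rw [← F.map_comp]
    rfl)
  act_id z := Subtype.ext z.2

/-- The restriction functor on right DG-modules and closed morphisms of degree `0`. -/
abbrev res : DGModule D ⥤ DGModule D' where
  obj M := F.resObj M
  map {M N} f := mkHom (M := F.resObj M) (N := F.resObj N)
    (fun A n => (app f (F.obj A) n).restrict fun _ hz => F.app_mem_fixed f hz)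
    (fun _ _ _ h z => Subtype.ext (app_d f h z.1))
    (fun _ _ _ _ _ h z g => Subtype.ext (app_act f h z.1 (F.map g)))

theorem res_cast (M : DGModule D) (A : D'.Obj) {p q : ℤ} (h : p = q) (z : F.fixed M A p) :
    ((F.resObj M).cast A h z : F.fixed M A q).1 = M.cast (F.obj A) h z.1 := by
  subst h; rfl

/-- The restriction commutes with the shifts. -/
def resShiftIso (M : DGModule D) (i : ℤ) : F.resObj (shiftObj M i) ≅ shiftObj (F.resObj M) i where
  hom := mkHom (M := F.resObj (shiftObj M i)) (N := shiftObj (F.resObj M) i)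
    (fun _ _ => LinearMap.id) (fun _ _ _ _ _ => rfl) (fun _ _ _ _ _ _ _ _ => rfl)
  inv := mkHom (M := shiftObj (F.resObj M) i) (N := F.resObj (shiftObj M i))
    (fun _ _ => LinearMap.id) (fun _ _ _ _ _ => rfl) (fun _ _ _ _ _ _ _ _ => rfl)
  hom_inv_id := rfl
  inv_hom_id := rfl

instance : F.res.CommShift ℤ where
  commShiftIso i := NatIso.ofComponents (fun M => F.resShiftIso M i) (fun _ => rfl)
  commShiftIso_zero := by
    refine Iso.ext (NatTrans.ext (funext fun M => hom_ext fun A n z => ?_))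
    rw [Functor.CommShift.isoZero_hom_app]
    refine Subtype.ext ?_
    exact ((F.res_cast M A (add_zero n).symm _).trans (M.cast_cast (F.obj A) _ _ z.1)).symm
  commShiftIso_add a b := by
    refine Iso.ext (NatTrans.ext (funext fun M => hom_ext fun A n z => ?_))
    rw [Functor.CommShift.isoAdd_hom_app]
    refine Subtype.ext ?_
    exact ((F.res_cast M A (show n + b + a = n + (a + b) by lia) _).trans
      (M.cast_cast (F.obj A) _ _ z.1)).symm

/-- The restriction commutes with the cones. -/
def resConeIso {M N : DGModule D} (f : M ⟶ N) : F.resObj (cone f) ≅ cone (F.res.map f) where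
  hom := mkHom (M := F.resObj (cone f)) (N := cone (F.res.map f))
    (fun A n => LinearMap.prod
      ((LinearMap.fst k _ _).restrict fun _ hz => congrArg Prod.fst hz)
      ((LinearMap.snd k _ _).restrict fun _ hz => congrArg Prod.snd hz))
    (fun A n m h z => by
      subst h
      rfl)
    (fun A B a b c h z g => rfl)
  inv := mkHom (M := cone (F.res.map f)) (N := F.resObj (cone f))
    (fun A n => LinearMap.codRestrict _
      (LinearMap.prodMap (F.fixed N A n).subtype (F.fixed M A (n + 1)).subtype)
      (fun z => Prod.ext z.1.2 z.2.2))
    (fun A n m h z => by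
      subst h
      rfl)
    (fun A B a b c h z g => rfl)
  hom_inv_id := rfl
  inv_hom_id := rfl

theorem homotopic_res {M N : DGModule D} {f g : M ⟶ N} (h : homotopic D f g) :
    homotopic D' (F.res.map f) (F.res.map g) := by
  obtain ⟨H, hH⟩ := h
  refine ⟨⟨fun A {p q} e => (H.h (F.obj A) e).restrict (p := F.fixed M A p) (q := F.fixed N A q)
      fun z hz => ?_,
    fun {A B a b c a' c'} e ha hc x g => Subtype.ext (H.h_act e ha hc x.1 (F.map g))⟩,
    fun A p q r hq hr x => Subtype.ext (hH (F.obj A) p q r hq hr x.1)⟩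
  have := H.h_act (add_zero p) e e z (F.e A)
  rw [mem_fixed.1 hz] at this
  exact this.symm

/-- The restriction functor on the homotopy categories of right DG-modules. -/
def resHo : Ho D ⥤ Ho D' :=
  CategoryTheory.Quotient.lift (homotopic D) (F.res ⋙ toHo D') fun _ _ _ _ h =>
    (toHo_map_eq_iff _ _).2 (F.homotopic_res h)

noncomputable instance : F.resHo.CommShift ℤ :=
  inferInstanceAs ((CategoryTheory.Quotient.lift (homotopic D) (F.res ⋙ toHo D') _).CommShift ℤ)

/-- The restriction functor on the homotopy categories is induced by the one on DG-modules. -/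
noncomputable def resHoIso : toHo D ⋙ F.resHo ≅ F.res ⋙ toHo D' :=
  CategoryTheory.Quotient.lift.isLift _ _ _

instance : NatTrans.CommShift F.resHoIso.hom ℤ :=
  inferInstanceAs (NatTrans.CommShift (CategoryTheory.Quotient.lift.isLift _ _ _).hom ℤ)

theorem resHo_map {M N : DGModule D} (f : M ⟶ N) :
    F.resHo.map ((toHo D).map f) = (toHo D').map (F.res.map f) := rfl

/-- The restriction of a standard triangle is isomorphic to a standard triangle. -/
noncomputable def resTriangleIso {M N : DGModule D} (f : M ⟶ N) :
    F.res.mapTriangle.obj (triangle f) ≅ triangle (F.res.map f) :=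
  Triangle.isoMk _ _ (Iso.refl _) (Iso.refl _) (F.resConeIso f) rfl rfl (by
    refine hom_ext fun A n z => ?_
    rfl)

instance : F.resHo.IsTriangulated where
  map_distinguished T hT := by
    obtain ⟨M, N, f, ⟨e⟩⟩ := hT
    refine ⟨_, _, F.res.map f, ⟨F.resHo.mapTriangle.mapIso e ≪≫
      (Functor.mapTriangleCompIso (toHo D) F.resHo).symm.app (triangle f) ≪≫
      (Functor.mapTriangleIso F.resHoIso).app (triangle f) ≪≫
      (Functor.mapTriangleCompIso F.res (toHo D')).app (triangle f) ≪≫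
      (toHo D').mapTriangle.mapIso (F.resTriangleIso f)⟩⟩

/-! ### Morphisms from representable DG-modules and restriction -/

/-- The canonical morphism `Hom (-, A) ⟶ Hom (F -, F A)`. -/
def yonedaUnit (A : D'.Obj) :
    DGCategory.yonedaObj A ⟶ F.resObj (DGCategory.yonedaObj (F.obj A)) :=
  mkHom (M := DGCategory.yonedaObj A) (N := F.resObj (DGCategory.yonedaObj (F.obj A)))
    (fun B n => LinearMap.codRestrict (F.fixed (DGCategory.yonedaObj (F.obj A)) B n) F.map
      fun f => F.map_e (add_zero n) rfl f)
    (fun _ _ _ h f => Subtype.ext (F.map_d h f))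
    (fun _ _ _ _ _ h f g => Subtype.ext (F.map_comp h f g))

theorem d_act_e {N : DGModule D} {A : D'.Obj} {z : N.X (F.obj A) 0}
    (hz : N.d (zero_add 1) z = 0) :
    (F.resObj N).d (A := A) (zero_add 1)
      ⟨N.act (add_zero 0) z (F.e A), F.act_map_mem_fixed N _ z (D'.id A)⟩ = 0 := by
  refine Subtype.ext ((N.d_act (add_zero 0) (zero_add 1) (zero_add 1) (zero_add 1) z
    (F.e A)).trans ?_)
  rw [hz, F.d_e]
  simp

theorem yonedaUnit_comp {N : DGModule D} {A : D'.Obj} (z : N.X (F.obj A) 0)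
    (hz : N.d (zero_add 1) z = 0) :
    F.yonedaUnit A ≫ F.res.map (yonedaHom z hz) = yonedaHom _ (F.d_act_e hz) := by
  refine hom_ext fun B n (x : D'.Hom B A n) => Subtype.ext ?_
  refine Eq.trans ?_ (N.act_act (add_zero 0) (zero_add n) (zero_add n) z (F.e A) (F.map x)).symm
  exact congrArg (N.act (zero_add n) z) ((congrArg F.map (D'.id_comp x).symm).trans
    (F.map_comp (zero_add n) (D'.id A) x))

/-- A morphism from a representable DG-module to a restriction extends to a morphism from the
corresponding representable DG-module over `D`. -/
theorem exists_yonedaUnit_comp_eq {N : Ho D} {A : D'.Obj}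
    (f : (toHo D').obj (DGCategory.yonedaObj A) ⟶ F.resHo.obj N) :
    ∃ g : (toHo D).obj (DGCategory.yonedaObj (F.obj A)) ⟶ N,
      (toHo D').map (F.yonedaUnit A) ≫ F.resHo.map g = f := by
  obtain ⟨N⟩ := N
  obtain ⟨f, rfl⟩ := (toHo D').map_surjective f
  obtain ⟨z, hz, rfl⟩ := exists_eq_yonedaHom (N := F.resObj N) f
  have hz' : N.d (zero_add 1) z.1 = 0 := congrArg Subtype.val hz
  refine ⟨(toHo D).map (yonedaHom z.1 hz'), ?_⟩
  rw [resHo_map]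
  refine Eq.trans ((toHo D').map_comp _ _).symm (congrArg _ ?_)
  exact hom_ext fun B n (x : D'.Hom B A n) => Subtype.ext rfl

/-- If the idempotent `e A` is homotopic to the identity, then a morphism from the DG-module
represented by `F A` is determined by its restriction. -/
theorem eq_zero_of_resHo_map_eq_zero {A : D'.Obj}
    (hA : ∃ h : D.Hom (F.obj A) (F.obj A) (-1), D.d (neg_add_cancel 1) h = D.id (F.obj A) - F.e A)
    {N : Ho D} (g : (toHo D).obj (DGCategory.yonedaObj (F.obj A)) ⟶ N)
    (hg : F.resHo.map g = 0) : g = 0 := by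
  obtain ⟨N⟩ := N
  obtain ⟨g, rfl⟩ := (toHo D).map_surjective g
  obtain ⟨z, hz, rfl⟩ := exists_eq_yonedaHom g
  obtain ⟨h, hh⟩ := hA
  have h₁ : (toHo D').map (yonedaHom _ (F.d_act_e hz)) = 0 := by
    rw [← F.yonedaUnit_comp z hz, Functor.map_comp, ← resHo_map, hg]
    exact comp_zero
  obtain ⟨w, hw⟩ := (toHo_map_yonedaHom_eq_zero_iff _ (F.d_act_e hz)).1 h₁
  have hw' : N.d (neg_add_cancel 1) w.1 = N.act (add_zero 0) z (F.e A) := congrArg Subtype.val hw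
  -- `z = z · e A + z · (id - e A)`, where `z · e A = d w` and `z · (id - e A) = d (z · h)`.
  refine (toHo_map_yonedaHom_eq_zero_iff z hz).2 ⟨w.1 + N.act (zero_add (-1)) z h, ?_⟩
  have h₂ := N.d_act (zero_add (-1)) (zero_add 1) (neg_add_cancel 1) (neg_add_cancel 1) z h
  rw [hz, map_zero, LinearMap.zero_apply, zero_add, Int.negOnePow_zero, one_smul, hh, map_sub] at h₂
  rw [map_add, h₂, hw']
  exact (add_sub_cancel _ _).trans (N.act_id z)

end NonUnitalDGFunctor

/-! ### Contractible objects -/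

namespace DGCategory

variable {k : Type w} [Field k] {D : DGCategory.{w, v, u} k}

theorem isContractible_iff_isZero (A : D.Obj) : D.IsContractible A ↔ IsZero (⟨A⟩ : D.Ho) := by
  rw [IsZero.iff_id_eq_zero, id_eq_homMk]
  refine Iff.trans ?_ (homMk_eq_iff (X := ⟨A⟩) (Y := ⟨A⟩) (g := 0)).symm
  exact exists_congr fun h => by rw [ZeroMemClass.coe_zero, sub_zero]

theorem IsContractible.isZero_yoneda {A : D.Obj} (hA : D.IsContractible A) :
    IsZero ((DGModule.toHo D).obj (yonedaObj A)) :=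
  (yoneda D).map_isZero ((isContractible_iff_isZero A).1 hA)

theorem exists_isContractible (D : DGCategory.{w, v, u} k) [IsPretriangulated D] :
    ∃ A : D.Obj, D.IsContractible A := by
  obtain ⟨A, hA⟩ := HasZeroObject.zero (C := D.Ho)
  exact ⟨A.obj, (isContractible_iff_isZero _).2 hA⟩

end DGCategory

/-! ### The filtration of the representable DG-modules over a gluing -/

namespace DGBimodule

open DGCategory DGModule

variable {k : Type w} [Field k] {D₁ : DGCategory.{w, v, u₁} k} {D₂ : DGCategory.{w, v, u₂} k}
  (φ : DGBimodule D₁ D₂)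

/-- The projection of the gluing to `D₁`, which is a DG-functor. -/
def proj₁ : NonUnitalDGFunctor φ.gluing D₁ where
  obj M := M.fst
  map := LinearMap.fst k _ _
  map_d _ _ := rfl
  map_comp _ _ _ := rfl

/-- The inclusion `M₂ ↦ (O₁, M₂, 0)`, `f ↦ (0, f, 0)` of `D₂` in the gluing. -/
abbrev inc₂ (O₁ : D₁.Obj) : NonUnitalDGFunctor D₂ φ.gluing where
  obj M₂ := φ.inclObj₂ O₁ M₂
  map := LinearMap.inr k _ _ ∘ₗ LinearMap.inl k _ _
  map_d h f := by
    refine Eq.symm (Prod.ext (map_zero _) (Prod.ext rfl ?_))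
    exact φ.d_aux _ _ _ f 0
  map_comp h f g := by
    refine Eq.symm (Prod.ext (map_zero _) (Prod.ext rfl ?_))
    exact φ.comp_aux _ _ _ f 0

/-- The right DG-module `(A₁, A₂, α) ↦ Hom (A₂, M₂) ⊕ φ (M₂, A₁)[-1]` over the gluing: the kernel of
the projection `(f₁, f₂, f₂₁) ↦ f₁` on the DG-module represented by any `(M₁, M₂, μ)`. -/
abbrev kerObj (M₂ : D₂.Obj) : DGModule φ.gluing where
  X A n := D₂.Hom A.snd M₂ n × φ.X M₂ A.fst (n - 1)
  d {A n m} h := LinearMap.prod (D₂.d h ∘ₗ LinearMap.fst k _ _)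
    (- φ.d (by lia) ∘ₗ LinearMap.snd k _ _ -
      (φ.actL (a := n) (b := 0) (c := m - 1) (by lia)).flip A.elt ∘ₗ LinearMap.fst k _ _)
  act {A B a b c} h := LinearMap.mk₂ k (fun x g => (D₂.comp h x.1 g.2.1,
      φ.actR (by lia) x.2 g.1 + a.negOnePow • φ.actL (by lia) x.1 g.2.2))
    (by
      intro f f' g
      refine Prod.ext (by simp) ?_
      simp only [Prod.fst_add, Prod.snd_add, map_add, LinearMap.add_apply, smul_add]
      abel)
    (by
      intro r f g
      refine Prod.ext (by simp) ?_
      simp only [Prod.smul_fst, Prod.smul_snd, map_smul, LinearMap.smul_apply, smul_add]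
      rw [smul_comm])
    (by
      intro f g g'
      refine Prod.ext (by simp) ?_
      simp only [Prod.fst_add, Prod.snd_add, map_add, smul_add]
      abel)
    (by
      intro r f g
      refine Prod.ext (by simp) ?_
      simp only [Prod.smul_fst, Prod.smul_snd, map_smul, smul_add]
      rw [smul_comm])
  d_d {A n m l} h h' x := by
    refine Prod.ext (D₂.d_d h h' _) ?_
    subst h h'
    change - φ.d _ (- φ.d _ x.2 - φ.actL _ x.1 A.elt) - φ.actL _ (D₂.d rfl x.1) A.elt = 0
    rw [map_sub, map_neg, φ.d_d,
      φ.d_actL (a := n) (b := 0) (c := n + 1 - 1) _ rfl (zero_add 1) (by lia), A.d_elt]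
    simp
  d_act {A B a b c a' b' c'} h ha hb hc x g := by
    refine Prod.ext (D₂.d_comp h ha hb hc _ _) ?_
    subst h ha hb hc
    change - φ.d _ (φ.actR _ x.2 g.1 + a.negOnePow • φ.actL _ x.1 g.2.2) -
      φ.actL _ (D₂.comp rfl x.1 g.2.1) A.elt =
      (φ.actR _ (- φ.d _ x.2 - φ.actL _ x.1 B.elt) g.1 +
        (a + 1).negOnePow • φ.actL _ (D₂.d rfl x.1) g.2.2) +
      a.negOnePow • (φ.actR _ x.2 (D₁.d rfl g.1) + a.negOnePow •
        φ.actL _ x.1 (- φ.d _ g.2.2 - φ.actL _ g.2.1 A.elt + φ.actR _ B.elt g.1))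
    rw [map_add, LinearMap.map_smul_of_tower,
      φ.d_actR (a := a - 1) (b := b) (c := a + b - 1) (a' := a + 1 - 1) _ (by lia) rfl (by lia),
      φ.d_actL (a := a) (b := b - 1) (c := a + b - 1) (b' := b + 1 - 1) _ rfl (by lia) (by lia),
      φ.actL_actL (a := a) (b := b) (c := 0) (bc := b + 1 - 1) _ (by lia)]
    simp only [map_add, map_sub, map_neg, LinearMap.sub_apply,
      LinearMap.neg_apply, smul_add, smul_sub, smul_neg, smul_smul, Int.units_mul_self, one_smul,
      Int.negOnePow_succ, Units.neg_smul, Int.negOnePow_sub, Int.negOnePow_one, mul_neg, mul_one]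
    rw [φ.actL_actR (a := a) (b := 0) (c := b) (ab := a + 1 - 1) (bc := b + 1 - 1) (by lia)
      (by lia) (by lia)]
    abel
  act_act {A B C a b c ab bc abc} hab hbc h x f g := by
    refine Prod.ext (D₂.assoc hab hbc h _ _ _) ?_
    change φ.actR _ (φ.actR _ x.2 f.1 + a.negOnePow • φ.actL _ x.1 f.2.2) g.1 +
      ab.negOnePow • φ.actL _ (D₂.comp hab x.1 f.2.1) g.2.2 =
      φ.actR _ x.2 (D₁.comp hbc f.1 g.1) + a.negOnePow •
        φ.actL _ x.1 (φ.actR _ f.2.2 g.1 + b.negOnePow • φ.actL _ f.2.1 g.2.2)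
    subst hab
    simp only [map_add, LinearMap.add_apply, smul_add, LinearMap.map_smul_of_tower,
      LinearMap.smul_apply, smul_smul, Int.negOnePow_add]
    rw [φ.actR_actR (a := a - 1) (b := b) (c := c) _ hbc,
      φ.actL_actR (a := a) (b := b - 1) (c := c) (bc := bc - 1) _ (by lia),
      φ.actL_actL (a := a) (b := b) (c := c - 1) (bc := bc - 1) _ (by lia), add_assoc]
  act_id {A n} x := by
    refine Prod.ext (D₂.comp_id _) ?_
    change φ.actR _ x.2 (D₁.id A.fst) + n.negOnePow • φ.actL _ x.1 0 = x.2
    rw [map_zero, smul_zero, add_zero]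
    exact φ.actR_id _

/-- The inclusion of the kernel of the projection `(f₁, f₂, f₂₁) ↦ f₁`. -/
def kerIncl (M : φ.GluingObj) : φ.kerObj M.snd ⟶ yonedaObj (D := φ.gluing) M :=
  mkHom (M := φ.kerObj M.snd) (N := yonedaObj (D := φ.gluing) M)
    (fun A n => LinearMap.inr k (D₁.Hom A.fst M.fst n)
      (D₂.Hom A.snd M.snd n × φ.X M.snd A.fst (n - 1)))
    (fun A n m h x => by
      refine Eq.symm (Prod.ext (map_zero _) (Prod.ext rfl ?_))
      change - φ.d _ x.2 - φ.actL _ x.1 A.elt + φ.actR _ M.elt 0 = - φ.d _ x.2 - φ.actL _ x.1 A.elt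
      rw [map_zero, add_zero])
    (fun A B a b c h x g => by
      refine Eq.symm (Prod.ext ?_ rfl)
      exact LinearMap.congr_fun (map_zero (D₁.comp h)) g.1)

/-- The projection `(f₁, f₂, f₂₁) ↦ f₁` on the DG-module represented by `M = (M₁, M₂, μ)`. -/
def kerProj (M : φ.GluingObj) :
    yonedaObj (D := φ.gluing) M ⟶ φ.proj₁.resObj (yonedaObj M.fst) :=
  mkHom (M := yonedaObj (D := φ.gluing) M) (N := φ.proj₁.resObj (yonedaObj M.fst))
    (fun A n => LinearMap.codRestrict (φ.proj₁.fixed (yonedaObj M.fst) A n)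
      (LinearMap.fst k (D₁.Hom A.fst M.fst n) (D₂.Hom A.snd M.snd n × φ.X M.snd A.fst (n - 1)))
      fun f => D₁.comp_id f.1)
    (fun _ _ _ _ _ => rfl) (fun _ _ _ _ _ _ _ _ => rfl)

/-- The exact sequence `0 ⟶ Hom (-, M₂) ⊕ φ (M₂, -)[-1] ⟶ Hom (-, M) ⟶ Hom (-, M₁) ⟶ 0`. -/
def kerSplitting (M : φ.GluingObj) : SemiSplitting (φ.kerIncl M) (φ.kerProj M) where
  s A n := LinearMap.inl k (D₁.Hom A.fst M.fst n)
    (D₂.Hom A.snd M.snd n × φ.X M.snd A.fst (n - 1)) ∘ₗ Submodule.subtype _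
  r A n := LinearMap.snd k (D₁.Hom A.fst M.fst n) (D₂.Hom A.snd M.snd n × φ.X M.snd A.fst (n - 1))
  s_act h x g := Prod.ext rfl (Prod.ext
    (LinearMap.congr_fun (map_zero (D₂.comp h)) g.2.1).symm (by
      change 0 = φ.actR _ 0 g.1 + _ • φ.actL _ 0 g.2.2
      simp))
  p_s _ := rfl
  r_i _ := rfl
  p_i _ := rfl
  i_r {A n} x := by
    refine Prod.ext ?_ ?_
    · exact zero_add (M := D₁.Hom A.fst M.fst n) _
    · exact add_zero (M := D₂.Hom A.snd M.snd n × φ.X M.snd A.fst (n - 1)) _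

/-- The morphism between the kernels of the projections defined by a closed morphism of `D₂`. -/
def kerMap {M₂ N₂ : D₂.Obj} (f : D₂.cocycles M₂ N₂) : φ.kerObj M₂ ⟶ φ.kerObj N₂ :=
  mkHom (M := φ.kerObj M₂) (N := φ.kerObj N₂)
    (fun A n => LinearMap.prodMap (D₂.comp (zero_add n) f.1) (φ.actL (zero_add (n - 1)) f.1))
    (fun A n m h x => by
      subst h
      refine Prod.ext ?_ ?_
      · have := D₂.d_comp (zero_add n) (zero_add 1) rfl rfl f.1 x.1
        rw [mem_cocycles.1 f.2, map_zero, LinearMap.zero_apply, zero_add, Int.negOnePow_zero,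
          one_smul] at this
        exact this.symm
      · have := φ.d_actL (a := 0) (b := n - 1) (c := n - 1) (b' := n + 1 - 1) (c' := n + 1 - 1)
          (zero_add _) (zero_add 1) (by lia) (by lia) f.1 x.2
        rw [mem_cocycles.1 f.2, map_zero, LinearMap.zero_apply, zero_add, Int.negOnePow_zero,
          one_smul] at this
        change φ.actL _ f.1 (- φ.d _ x.2 - φ.actL _ x.1 A.elt) =
          - φ.d _ (φ.actL _ f.1 x.2) - φ.actL _ (D₂.comp _ f.1 x.1) A.elt
        rw [this, map_sub, map_neg,
          φ.actL_actL (a := 0) (b := n) (c := 0) (bc := n + 1 - 1) _ (by lia)])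
    (fun A B a b c h x g => by
      refine Prod.ext (D₂.assoc (zero_add a) h _ f.1 x.1 g.2.1).symm ?_
      change φ.actL _ f.1 (φ.actR _ x.2 g.1 + a.negOnePow • φ.actL _ x.1 g.2.2) =
        φ.actR _ (φ.actL _ f.1 x.2) g.1 + a.negOnePow • φ.actL _ (D₂.comp _ f.1 x.1) g.2.2
      rw [map_add, LinearMap.map_smul_of_tower,
        φ.actL_actL (a := 0) (b := a) (c := b - 1) (bc := c - 1) _ (by lia),
        φ.actL_actR (a := 0) (b := a - 1) (c := b) (bc := c - 1) _ (by lia)])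

/-- The kernel of the projection is represented by `(O₁, M₂, 0)` up to homotopy. -/
theorem isIso_kerIncl {M : φ.GluingObj} (hM : D₁.IsContractible M.fst) :
    IsIso ((toHo φ.gluing).map (φ.kerIncl M)) :=
  (Triangle.isZero₃_iff_isIso₁ _ (φ.kerSplitting M).triangle_distinguished).1
    (φ.proj₁.resHo.map_isZero hM.isZero_yoneda)

theorem isContractible_gluing {M : φ.GluingObj} (h₁ : D₁.IsContractible M.fst)
    (h₂ : D₂.IsContractible M.snd) (hM : M.elt = 0) : φ.gluing.IsContractible M := by
  obtain ⟨a, ha⟩ := h₁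
  obtain ⟨b, hb⟩ := h₂
  refine ⟨((a, b, 0) : φ.GluingHom M M (-1)), Prod.ext ha (Prod.ext hb ?_)⟩
  change - φ.d _ 0 - φ.actL _ b M.elt + φ.actR _ M.elt a = 0
  rw [hM]
  exact φ.d_aux _ _ _ b a

/-- The restriction of `Hom (-, M₁)` to the gluing is represented by `(M₁, O₂, 0)` up to
homotopy. -/
theorem isIso_kerProj [IsPretriangulated D₁] {M : φ.GluingObj} (hM : D₂.IsContractible M.snd) :
    IsIso ((toHo φ.gluing).map (φ.kerProj M)) := by
  refine (Triangle.isZero₁_iff_isIso₂ _ (φ.kerSplitting M).triangle_distinguished).1 ?_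
  obtain ⟨O₁, hO₁⟩ := exists_isContractible D₁
  have := φ.isIso_kerIncl (M := φ.inclObj₂ O₁ M.snd) hO₁
  exact (φ.isContractible_gluing (M := φ.inclObj₂ O₁ M.snd) hO₁ hM rfl).isZero_yoneda.of_iso
    (@asIso _ _ _ _ _ this)

end DGBimodule

namespace DGBimodule

open DGCategory DGModule

variable {k : Type w} [Field k] {D₁ : DGCategory.{w, v, u₁} k} {D₂ : DGCategory.{w, v, u₂} k}
  (φ : DGBimodule D₁ D₂)

/-! ### Restriction to the second component -/

/-- The restriction to `D₂` of the DG-module represented by `(M₁, M₂, μ)` is represented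
by `M₂`. -/
def resYonedaIso (O₁ : D₁.Obj) (M : φ.GluingObj) :
    yonedaObj M.snd ≅ (φ.inc₂ O₁).resObj (yonedaObj (D := φ.gluing) M) where
  hom := mkHom (M := yonedaObj M.snd) (N := (φ.inc₂ O₁).resObj (yonedaObj (D := φ.gluing) M))
    (fun A n => LinearMap.codRestrict ((φ.inc₂ O₁).fixed (yonedaObj (D := φ.gluing) M) A n)
      (LinearMap.inr k (D₁.Hom O₁ M.fst n) (D₂.Hom A M.snd n × φ.X M.snd O₁ (n - 1)) ∘ₗ
        LinearMap.inl k (D₂.Hom A M.snd n) (φ.X M.snd O₁ (n - 1)))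
      (fun f => by
        refine Prod.ext ?_ (Prod.ext ?_ ?_)
        · exact map_zero _
        · exact D₂.comp_id f
        · exact φ.comp_aux _ _ _ f 0))
    (fun A n m h f => by
      refine Subtype.ext (Eq.symm (Prod.ext (map_zero _) (Prod.ext rfl ?_)))
      change - φ.d _ 0 - φ.actL _ f 0 + φ.actR _ M.elt 0 = 0
      simp)
    (fun A B a b c h f g => by
      refine Subtype.ext (Eq.symm (Prod.ext (map_zero _) (Prod.ext rfl ?_)))
      exact φ.comp_aux _ _ _ f 0)
  inv := mkHom (M := (φ.inc₂ O₁).resObj (yonedaObj (D := φ.gluing) M)) (N := yonedaObj M.snd)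
    (fun A n => LinearMap.fst k (D₂.Hom A M.snd n) (φ.X M.snd O₁ (n - 1)) ∘ₗ
      LinearMap.snd k (D₁.Hom O₁ M.fst n) (D₂.Hom A M.snd n × φ.X M.snd O₁ (n - 1)) ∘ₗ
        Submodule.subtype _)
    (fun A n m h f => rfl)
    (fun A B a b c h f g => rfl)
  hom_inv_id := rfl
  inv_hom_id := hom_ext fun A n f => by
    obtain ⟨f, hf⟩ := f
    have h := NonUnitalDGFunctor.mem_fixed.1 hf
    refine Subtype.ext (Eq.trans ?_ h)
    refine Prod.ext ?_ (Prod.ext ?_ ?_)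
    · exact (map_zero (D₁.comp (add_zero n) f.1)).symm
    · exact (D₂.comp_id f.2.1).symm
    · change 0 = φ.actR _ f.2.2 0 + n.negOnePow • φ.actL _ f.2.1 0
      simp

variable {φ} in
/-- The identity of `(O₁, M₂, 0)` is homotopic to `(0, id, 0)` if `O₁` is contractible. -/
theorem exists_d_eq_id_sub_e {O₁ : D₁.Obj} (hO₁ : D₁.IsContractible O₁) (M₂ : D₂.Obj) :
    ∃ h : φ.GluingHom (φ.inclObj₂ O₁ M₂) (φ.inclObj₂ O₁ M₂) (-1),
      φ.gluing.d (neg_add_cancel 1) h =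
        φ.gluing.id (φ.inclObj₂ O₁ M₂) - (φ.inc₂ O₁).e M₂ := by
  obtain ⟨a, ha⟩ := hO₁
  refine ⟨(a, 0, 0), ?_⟩
  refine Prod.ext ?_ (Prod.ext ?_ ?_)
  · exact ha.trans (sub_zero _).symm
  · exact (map_zero _).trans (sub_self _).symm
  · exact (φ.d_aux _ _ _ 0 a).trans (sub_zero _).symm

section

variable {O₁ : D₁.Obj}

/-- The DG-modules over the gluing whose restriction to `D₂` vanishes up to homotopy. -/
def resZero (O₁ : D₁.Obj) : ObjectProperty (DGModule.Ho φ.gluing) :=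
  fun Z => IsZero ((φ.inc₂ O₁).resHo.obj Z)

instance : (φ.resZero O₁).IsStableUnderShift ℤ where
  isStableUnderShiftBy n := ⟨fun Z hZ =>
    ((shiftFunctor (DGModule.Ho D₂) n).map_isZero hZ).of_iso
      (((φ.inc₂ O₁).resHo.commShiftIso n).app Z)⟩

/-- By the Yoneda lemma, morphisms from the DG-module represented by `(O₁, M₂, 0)` are
determined by their restrictions to `D₂`. -/
theorem leftOrthogonal_resZero (hO₁ : D₁.IsContractible O₁) (M₂ : D₂.Obj) :
    (φ.resZero O₁).leftOrthogonal ((toHo φ.gluing).obj (yonedaObj (φ.inclObj₂ O₁ M₂))) :=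
  fun _ _ hZ => (φ.inc₂ O₁).eq_zero_of_resHo_map_eq_zero (exists_d_eq_id_sub_e hO₁ M₂) _
    (hZ.eq_of_tgt _ _)

/-- A DG-module which is left orthogonal to those with zero restriction to `D₂` is determined by its
restriction to `D₂`. -/
theorem nonempty_iso_of_leftOrthogonal (hO₁ : D₁.IsContractible O₁) {N : DGModule.Ho φ.gluing}
    (hN : (φ.resZero O₁).leftOrthogonal N) {M₂ : D₂.Obj}
    (e : (φ.inc₂ O₁).resHo.obj N ≅ (toHo D₂).obj (yonedaObj M₂)) :
    Nonempty (N ≅ (toHo φ.gluing).obj (yonedaObj (φ.inclObj₂ O₁ M₂))) := by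
  obtain ⟨g, hg⟩ := (φ.inc₂ O₁).exists_yonedaUnit_comp_eq e.inv
  -- The morphism `g` induces an isomorphism after restriction, so that its cone `Z` has zero
  -- restriction; being left orthogonal to such DG-modules, `Z` vanishes.
  have : IsIso ((φ.inc₂ O₁).resHo.map g) := by
    have h : IsIso ((toHo D₂).map ((φ.inc₂ O₁).yonedaUnit M₂)) :=
      inferInstanceAs (IsIso ((toHo D₂).map (φ.resYonedaIso O₁ (φ.inclObj₂ O₁ M₂)).hom))
    have h' : IsIso ((toHo D₂).map ((φ.inc₂ O₁).yonedaUnit M₂) ≫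
      (φ.inc₂ O₁).resHo.map g) := by rw [hg]; infer_instance
    exact IsIso.of_isIso_comp_left ((toHo D₂).map ((φ.inc₂ O₁).yonedaUnit M₂)) _
  obtain ⟨Z, a, b, hT⟩ := distinguished_cocone_triangle g
  have hZ : φ.resZero O₁ Z := (Triangle.isZero₃_iff_isIso₁ _
    ((φ.inc₂ O₁).resHo.map_distinguished _ hT)).2 this
  have hZ' : (φ.resZero O₁).leftOrthogonal Z :=
    ObjectProperty.ext_of_isTriangulatedClosed₃ _ _ hT (φ.leftOrthogonal_resZero hO₁ M₂) hN
  have : IsIso g := (Triangle.isZero₃_iff_isIso₁ _ hT).1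
    ((IsZero.iff_id_eq_zero _).2 (hZ' _ hZ))
  exact ⟨(asIso g).symm⟩

end

end DGBimodule

/-! ### Closed morphisms of degree `1` -/

namespace DGCategory

open DGModule

variable {k : Type w} [Field k] {D : DGCategory.{w, v, u} k}

/-- The closed morphisms of degree `1`. -/
def cocyclesOne (A B : D.Obj) : Submodule k (D.Hom A B 1) :=
  LinearMap.ker (D.d one_add_one_eq_two)

theorem mem_cocyclesOne {A B : D.Obj} {z : D.Hom A B 1} :
    z ∈ D.cocyclesOne A B ↔ D.d one_add_one_eq_two z = 0 := Iff.rfl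

theorem shiftObj_d_eq_zero {A B : D.Obj} (z : D.cocyclesOne A B) :
    (shiftObj (yonedaObj B) 1).d (A := A) (n := 0) (zero_add 1) z.1 = 0 := by
  rw [shiftObj_d]
  refine Eq.trans (congrArg _ ?_) (smul_zero _)
  exact z.2

/-- The morphism `Hom (-, A) ⟶ Hom (-, B)[1]` of DG-modules defined by a closed morphism of
degree `1` from `A` to `B`. -/
def yonedaOne {A B : D.Obj} (z : D.cocyclesOne A B) : yonedaObj A ⟶ (yonedaObj B)⟦(1 : ℤ)⟧ :=
  yonedaHom (N := shiftObj (yonedaObj B) 1) (A := A) z.1 (shiftObj_d_eq_zero z)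

theorem yonedaOne_app {A B : D.Obj} (z : D.cocyclesOne A B) (C : D.Obj) (n : ℤ) (x : D.Hom C A n) :
    app (yonedaOne z) C n x = D.comp (add_comm 1 n) z.1 x := rfl

/-- The morphism `Hom (-, A) ⟶ Hom (-, B)[1]` in the homotopy category of DG-modules defined by a
closed morphism of degree `1` from `A` to `B`. -/
noncomputable def homOne {A B : D.Obj} :
    D.cocyclesOne A B →+
      ((toHo D).obj (yonedaObj A) ⟶ ((toHo D).obj (yonedaObj B))⟦(1 : ℤ)⟧) :=
  AddMonoidHom.mk' (fun z => (toHo D).map (yonedaOne z) ≫ ((toHo D).commShiftIso 1).hom.app _)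
    (fun z z' => by
      rw [← Preadditive.add_comp, ← Functor.map_add]
      congr 2
      refine hom_ext fun C n x => ?_
      rw [add_app, yonedaOne_app, yonedaOne_app, yonedaOne_app]
      exact LinearMap.congr_fun (map_add (D.comp (add_comm 1 n)) z.1 z'.1) x)

theorem homOne_apply {A B : D.Obj} (z : D.cocyclesOne A B) :
    homOne z = (toHo D).map (yonedaOne z) ≫ ((toHo D).commShiftIso 1).hom.app _ := rfl

theorem homOne_surjective {A B : D.Obj} : Function.Surjective (homOne (A := A) (B := B)) := by
  intro f
  obtain ⟨g, hg⟩ := (toHo D).map_surjective (f ≫ ((toHo D).commShiftIso (1 : ℤ)).inv.app _)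
  obtain ⟨z, hz, rfl⟩ := exists_eq_yonedaHom (N := shiftObj (yonedaObj B) 1) g
  refine ⟨⟨z, ?_⟩, ?_⟩
  · rw [shiftObj_d, Int.negOnePow_one, Units.neg_smul, one_smul, neg_eq_zero] at hz
    exact hz
  · rw [homOne_apply]
    refine (congrArg (· ≫ _) hg).trans ?_
    simp

theorem homOne_eq_zero_iff {A B : D.Obj} (z : D.cocyclesOne A B) :
    homOne z = 0 ↔ ∃ h : D.Hom A B 0, D.d (zero_add 1) h = z.1 := by
  rw [homOne_apply, Preadditive.IsIso.comp_right_eq_zero]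
  refine (toHo_map_yonedaHom_eq_zero_iff _ _).trans ?_
  constructor
  · rintro ⟨h, hh⟩
    refine ⟨- (show D.Hom A B 0 from h), ?_⟩
    have hh' : (1 : ℤ).negOnePow • D.d (zero_add 1) (show D.Hom A B 0 from h) = z.1 := hh
    rw [Int.negOnePow_one, Units.neg_smul, one_smul] at hh'
    exact (map_neg _ _).trans hh'
  · rintro ⟨h, hh⟩
    have hh' : (1 : ℤ).negOnePow • D.d (zero_add 1) (-h) = z.1 := by
      rw [Int.negOnePow_one, Units.neg_smul, one_smul, map_neg, neg_neg, hh]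
    exact ⟨(- h : D.Hom A B 0), hh'⟩

/-- Composition of closed morphisms of degrees `0` and `1`. -/
def cocyclesOneComp {A B C : D.Obj} (g : D.cocycles A B) (z : D.cocyclesOne B C) :
    D.cocyclesOne A C :=
  ⟨D.comp (add_zero 1) z.1 g.1, by
    rw [mem_cocyclesOne, D.d_comp (add_zero 1) one_add_one_eq_two (zero_add 1) one_add_one_eq_two,
      mem_cocycles.1 g.2, mem_cocyclesOne.1 z.2]
    simp⟩

/-- Composition of closed morphisms of degrees `1` and `0`. -/
def compCocyclesOne {A B C : D.Obj} (z : D.cocyclesOne A B) (g : D.cocycles B C) :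
    D.cocyclesOne A C :=
  ⟨D.comp (zero_add 1) g.1 z.1, by
    rw [mem_cocyclesOne, D.d_comp (zero_add 1) (zero_add 1) one_add_one_eq_two one_add_one_eq_two,
      mem_cocycles.1 g.2, mem_cocyclesOne.1 z.2]
    simp⟩

theorem yonedaMap_comp_homOne {A B C : D.Obj} (g : D.cocycles A B) (z : D.cocyclesOne B C) :
    (toHo D).map (yonedaMap g) ≫ homOne z = homOne (cocyclesOneComp g z) := by
  rw [homOne_apply, homOne_apply, ← Category.assoc]
  congr 1
  rw [← Functor.map_comp]
  congr 1
  exact hom_ext fun E n (x : D.Hom E A n) => (D.assoc _ _ _ _ _ _).symm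

theorem homOne_comp_yonedaMap {A B C : D.Obj} (z : D.cocyclesOne A B) (g : D.cocycles B C) :
    homOne z ≫ ((toHo D).map (yonedaMap g))⟦(1 : ℤ)⟧' = homOne (compCocyclesOne z g) := by
  rw [homOne_apply, homOne_apply, Category.assoc, ← (toHo D).commShiftIso_hom_naturality,
    ← Category.assoc]
  congr 1
  rw [← Functor.map_comp]
  congr 1
  exact hom_ext fun E n (x : D.Hom E A n) => (D.assoc _ _ _ _ _ _).symm

end DGCategory

namespace DGBimodule

open DGCategory DGModule

variable {k : Type w} [Field k] {D₁ : DGCategory.{w, v, u₁} k} {D₂ : DGCategory.{w, v, u₂} k}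
  (φ : DGBimodule D₁ D₂)

section

variable (O₁ : D₁.Obj) (O₂ : D₂.Obj)

/-- The closed morphism `(0, 0, μ)` of degree `1` from `(M₁, O₂, 0)` to `(O₁, M₂, 0)` defined by a
closed element `μ` of `φ M₂ M₁` of degree `0`. -/
def ofElt {M₁ : D₁.Obj} {M₂ : D₂.Obj} :
    φ.cocycles M₂ M₁ →ₗ[k] φ.gluing.cocyclesOne (φ.inclObj₁ O₂ M₁) (φ.inclObj₂ O₁ M₂) where
  toFun μ := ⟨((0, 0, μ.1) : φ.GluingHom (φ.inclObj₁ O₂ M₁) (φ.inclObj₂ O₁ M₂) 1), by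
    refine Prod.ext (map_zero _) (Prod.ext (map_zero _) ?_)
    have h : (- φ.d (n := 0) (m := 1) (zero_add 1) μ.1 - φ.actL (a := 1) (b := 0) (c := 1)
        (add_zero 1) 0 (0 : φ.X O₂ M₁ 0) + φ.actR (a := 0) (b := 1) (c := 1) (zero_add 1)
        (0 : φ.X M₂ O₁ 0) 0 : φ.X M₂ M₁ 1) = 0 := by
      rw [LinearMap.mem_ker.1 μ.2]
      simp
    exact h⟩
  map_add' μ ν := Subtype.ext (Prod.ext (add_zero _).symm (Prod.ext (add_zero _).symm rfl))
  map_smul' r μ := Subtype.ext (Prod.ext (smul_zero _).symm (Prod.ext (smul_zero _).symm rfl))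

variable {O₁ O₂}

/-- Up to homotopy, every closed morphism of degree `1` from `(M₁, O₂, 0)` to `(O₁, M₂, 0)` is of
the form `(0, 0, μ)`. -/
theorem exists_homOne_ofElt (hO₁ : D₁.IsContractible O₁) (hO₂ : D₂.IsContractible O₂) {M₁ : D₁.Obj}
    {M₂ : D₂.Obj} (w : φ.gluing.cocyclesOne (φ.inclObj₁ O₂ M₁) (φ.inclObj₂ O₁ M₂)) :
    ∃ μ : φ.cocycles M₂ M₁, homOne (φ.ofElt O₁ O₂ μ) = homOne w := by
  obtain ⟨a, ha⟩ := hO₁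
  obtain ⟨b, hb⟩ := hO₂
  obtain ⟨⟨w₁, w₂, μ⟩, hw⟩ := w
  have h₁ : D₁.d one_add_one_eq_two w₁ = 0 := congrArg Prod.fst hw
  have h₂ : D₂.d one_add_one_eq_two w₂ = 0 := congrArg (fun x => x.2.1) hw
  have h₃ : - φ.d (n := 0) (m := 1) (zero_add 1) μ - φ.actL (a := 1) (b := 0) (c := 1) (add_zero 1)
      w₂ (0 : φ.X O₂ M₁ 0) + φ.actR (a := 0) (b := 1) (c := 1) (zero_add 1) (0 : φ.X M₂ O₁ 0) w₁ =
      0 := congrArg (fun x => x.2.2) hw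
  refine ⟨⟨μ, LinearMap.mem_ker.2 (by simpa using h₃)⟩, ?_⟩
  rw [eq_comm, ← sub_eq_zero, ← map_sub, homOne_eq_zero_iff]
  -- The homotopy contracts the components `w₁ : M₁ ⟶ O₁` and `w₂ : O₂ ⟶ M₂` separately.
  refine ⟨((D₁.comp (neg_add_cancel 1) a w₁, - D₂.comp (add_neg_cancel 1) w₂ b, 0) :
    φ.GluingHom (φ.inclObj₁ O₂ M₁) (φ.inclObj₂ O₁ M₂) 0), ?_⟩
  refine Prod.ext ?_ (Prod.ext ?_ ?_)
  · have := D₁.d_comp (neg_add_cancel 1) (neg_add_cancel 1) one_add_one_eq_two (zero_add 1) a w₁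
    rw [h₁, ha, map_zero, smul_zero, add_zero] at this
    refine this.trans ?_
    exact (D₁.id_comp w₁).trans (sub_zero _).symm
  · have := D₂.d_comp (add_neg_cancel 1) one_add_one_eq_two (neg_add_cancel 1) (zero_add 1) w₂ b
    rw [h₂, hb, map_zero, LinearMap.zero_apply, zero_add, Int.negOnePow_one, Units.neg_smul,
      one_smul] at this
    refine (map_neg _ _).trans ?_
    rw [this, neg_neg]
    exact (D₂.comp_id w₂).trans (sub_zero _).symm
  · refine Eq.trans ?_ (sub_self μ).symm
    exact φ.d_aux _ _ _ _ _

/-- The components of a morphism of degree `0` in `Hom (M₁, O₁)` and `Hom (O₂, M₂)` do not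
contribute to the last component of its differential, as `(M₁, O₂, 0)` and `(O₁, M₂, 0)` have zero
elements. -/
theorem homOne_ofElt_eq_zero_iff {M₁ : D₁.Obj} {M₂ : D₂.Obj} (μ : φ.cocycles M₂ M₁) :
    homOne (φ.ofElt O₁ O₂ μ) = 0 ↔ μ ∈ φ.boundaries M₂ M₁ := by
  rw [homOne_eq_zero_iff]
  constructor
  · rintro ⟨⟨h₁, h₂, y⟩, hh⟩
    have h₃ : - φ.d (n := -1) (m := 0) (neg_add_cancel 1) y -
        φ.actL (a := 0) (b := 0) (c := 0) (add_zero 0) h₂ (0 : φ.X O₂ M₁ 0) +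
        φ.actR (a := 0) (b := 0) (c := 0) (zero_add 0) (0 : φ.X M₂ O₁ 0) h₁ = μ.1 :=
      congrArg (fun x => x.2.2) hh
    refine ⟨- y, ?_⟩
    simpa using h₃
  · rintro ⟨y, hy⟩
    refine ⟨((0, 0, (-y : φ.X M₂ M₁ (-1))) : φ.GluingHom (φ.inclObj₁ O₂ M₁) (φ.inclObj₂ O₁ M₂) 0),
      Prod.ext (map_zero _) (Prod.ext (map_zero _) ?_)⟩
    have h : (- φ.d (n := -1) (m := 0) (neg_add_cancel 1) (-y) -
        φ.actL (a := 0) (b := 0) (c := 0) (add_zero 0) 0 (0 : φ.X O₂ M₁ 0) +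
        φ.actR (a := 0) (b := 0) (c := 0) (zero_add 0) (0 : φ.X M₂ O₁ 0) 0 : φ.X M₂ M₁ 0) =
        μ.1 := by
      rw [map_neg, hy]
      simp
    exact h

end

end DGBimodule

/-! ### The gluing is pretriangulated -/

namespace DGCategory

variable {k : Type w} [Field k] {D : DGCategory.{w, v, u} k}

instance [IsPretriangulated D] : (yoneda D).IsTriangulated where
  map_distinguished _ hT := hT

end DGCategory

/-- The middle object of a distinguished triangle is determined by the connecting morphism. -/
theorem CategoryTheory.Pretriangulated.nonempty_iso_obj₂ {C : Type*} [Category* C]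
    [Preadditive C] [HasZeroObject C] [HasShift C ℤ]
    [∀ n : ℤ, (shiftFunctor C n).Additive] [Pretriangulated C] {T T' : Triangle C}
    (hT : T ∈ distTriang C) (hT' : T' ∈ distTriang C) {X : C} (e₁ : T.obj₁ ≅ X)
    (e₁' : T'.obj₁ ≅ X) (e₃ : T'.obj₃ ≅ T.obj₃)
    (h : e₃.hom ≫ T.mor₃ ≫ e₁.hom⟦(1 : ℤ)⟧' = T'.mor₃ ≫ e₁'.hom⟦(1 : ℤ)⟧') :
    Nonempty (T.obj₂ ≅ T'.obj₂) :=
  ⟨Triangle.π₂.mapIso (isoTriangleOfIso₁₃ T T' hT hT' (e₁ ≪≫ e₁'.symm) e₃.symm (by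
    rw [← cancel_epi e₃.hom, Iso.trans_hom, Functor.map_comp, ← Category.assoc T.mor₃,
      ← Category.assoc e₃.hom, h, Iso.symm_hom, Iso.symm_hom, Iso.hom_inv_id_assoc,
      Category.assoc, ← Functor.map_comp, Iso.hom_inv_id,
      CategoryTheory.Functor.map_id, Category.comp_id]))⟩

namespace DGBimodule

open DGCategory DGModule

variable {k : Type w} [Field k] {D₁ : DGCategory.{w, v, u₁} k} {D₂ : DGCategory.{w, v, u₂} k}
  (φ : DGBimodule D₁ D₂)

/-- The extension of DG-modules `Hom (-, (M₁, M₂, μ))` is classified by `-μ`. -/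
theorem kerProj_δ_kerIncl (O₁ : D₁.Obj) (O₂ : D₂.Obj) (M : φ.GluingObj) :
    φ.kerProj (φ.inclObj₁ O₂ M.fst) ≫ (φ.kerSplitting M).δ ≫
      (φ.kerIncl (φ.inclObj₂ O₁ M.snd))⟦(1 : ℤ)⟧' =
        yonedaOne (D := φ.gluing) (φ.ofElt O₁ O₂ (-⟨M.elt, M.d_elt⟩)) := by
  refine hom_ext fun A n (f : φ.GluingHom A (φ.inclObj₁ O₂ M.fst) n) => ?_
  refine Prod.ext ?_ (Prod.ext ?_ ?_)
  · exact (LinearMap.congr_fun (map_zero (D₁.comp (add_comm 1 n))) f.1).symm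
  · refine Eq.trans ?_ (LinearMap.congr_fun (map_zero (D₂.comp (add_comm 1 n))) f.2.1).symm
    exact (congrArg Neg.neg (map_zero (D₂.d (rfl : n + 1 = n + 1)))).trans neg_zero
  · have h : (-(- φ.d (n := n - 1) (m := n + 1 - 1) (by lia) 0 -
        φ.actL (a := n) (b := 0) (c := n + 1 - 1) (by lia) 0 A.elt +
        φ.actR (a := 0) (b := n) (c := n + 1 - 1) (by lia) M.elt f.1) :
          φ.X M.snd A.fst (n + 1 - 1)) =
        φ.actR (a := 0) (b := n) (c := n + 1 - 1) (by lia) (-M.elt) f.1 + (1 : ℤ).negOnePow •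
          φ.actL (a := 1) (b := n - 1) (c := n + 1 - 1) (by lia) 0 f.2.2 := by
      simp
    exact h

section

variable {O₁ : D₁.Obj} {O₂ : D₂.Obj}

/-- The DG-modules over the gluing which, up to homotopy, are represented by an object
`(O₁, M₂, 0)`. -/
abbrev repr₂ (O₁ : D₁.Obj) : ObjectProperty (DGModule.Ho φ.gluing) :=
  (φ.resZero O₁).leftOrthogonal ⊓ (yoneda D₂).essImage.inverseImage (φ.inc₂ O₁).resHo

instance [IsPretriangulated D₂] : (φ.repr₂ O₁).IsTriangulated := inferInstance

theorem repr₂_kerObj (hO₁ : D₁.IsContractible O₁) (M₂ : D₂.Obj) :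
    φ.repr₂ O₁ ((toHo φ.gluing).obj (φ.kerObj M₂)) := by
  have := φ.isIso_kerIncl (M := φ.inclObj₂ O₁ M₂) hO₁
  let e := @asIso _ _ _ _ ((toHo φ.gluing).map (φ.kerIncl (φ.inclObj₂ O₁ M₂))) this
  refine ⟨ObjectProperty.prop_of_iso _ e.symm (φ.leftOrthogonal_resZero hO₁ M₂),
    ⟨M₂⟩, ⟨?_⟩⟩
  exact (toHo D₂).mapIso (φ.resYonedaIso O₁ (φ.inclObj₂ O₁ M₂)) ≪≫
    (φ.inc₂ O₁).resHo.mapIso e.symm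

/-- An extension of `Hom (-, M₁)` by `Hom (-, (O₁, M₂, 0))` is represented by a triple
`(M₁, M₂, μ)`. -/
theorem essImage_yoneda_of_triangle [IsPretriangulated D₁] [IsPretriangulated D₂]
    (hO₁ : D₁.IsContractible O₁) {T : Triangle (DGModule.Ho φ.gluing)} (hT : T ∈ distTriang _)
    (h₂ : φ.repr₂ O₁ T.obj₁) (h₁ : (yoneda D₁ ⋙ φ.proj₁.resHo).essImage T.obj₃) :
    (yoneda φ.gluing).essImage T.obj₂ := by
  obtain ⟨O₂, hO₂⟩ := exists_isContractible D₂
  obtain ⟨h₂, ⟨M₂⟩, ⟨e₂⟩⟩ := h₂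
  obtain ⟨⟨M₁⟩, ⟨e₃⟩⟩ := h₁
  obtain ⟨e₁⟩ := φ.nonempty_iso_of_leftOrthogonal hO₁ h₂ e₂.symm
  have := φ.isIso_kerIncl (M := φ.inclObj₂ O₁ M₂) hO₁
  have := φ.isIso_kerProj (M := φ.inclObj₁ O₂ M₁) hO₂
  let α := @asIso _ _ _ _ ((toHo φ.gluing).map (φ.kerIncl (φ.inclObj₂ O₁ M₂))) ‹_›
  let β := @asIso _ _ _ _ ((toHo φ.gluing).map (φ.kerProj (φ.inclObj₁ O₂ M₁))) ‹_›
  obtain ⟨w, hw⟩ := homOne_surjective (D := φ.gluing)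
    (β.hom ≫ e₃.hom ≫ T.mor₃ ≫ e₁.hom⟦(1 : ℤ)⟧')
  obtain ⟨μ, hμ⟩ := φ.exists_homOne_ofElt hO₁ hO₂ w
  -- The connecting morphism of the DG-module represented by `(M₁, M₂, -μ)` is given by `μ`.
  let M : φ.GluingObj := ⟨M₁, M₂, (-μ).1, (-μ).2⟩
  have hM : -(⟨M.elt, M.d_elt⟩ : φ.cocycles M₂ M₁) = μ := Subtype.ext (neg_neg μ.1)
  have h := (toHo φ.gluing).congr_map (φ.kerProj_δ_kerIncl O₁ O₂ M)
  rw [hM] at h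
  have h' : homOne (φ.ofElt O₁ O₂ μ) =
    β.hom ≫ (φ.kerSplitting M).triangle.mor₃ ≫ α.hom⟦(1 : ℤ)⟧' := by
    rw [homOne_apply, ← h, Functor.map_comp, Functor.map_comp, Category.assoc, Category.assoc,
      (toHo φ.gluing).commShiftIso_hom_naturality]
    rw [← Category.assoc ((toHo φ.gluing).map (φ.kerSplitting M).δ)]
    rfl
  rw [hμ, hw] at h'
  have h'' := (cancel_epi β.hom).1 h'
  obtain ⟨e⟩ := nonempty_iso_obj₂ hT (φ.kerSplitting M).triangle_distinguished e₁ α e₃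
    ((cancel_epi β.hom).1 h')
  exact ⟨⟨M⟩, ⟨e.symm⟩⟩

end

/-- The first component of a closed morphism of degree `0` of the gluing. -/
def cocyclesFst {M N : φ.GluingObj} (f : φ.gluing.cocycles M N) : D₁.cocycles M.fst N.fst :=
  ⟨f.1.1, congrArg Prod.fst f.2⟩

/-- The second component of a closed morphism of degree `0` of the gluing. -/
def cocyclesSnd {M N : φ.GluingObj} (f : φ.gluing.cocycles M N) : D₂.cocycles M.snd N.snd :=
  ⟨f.1.2.1, congrArg (fun x : φ.GluingHom M N 1 => x.2.1) f.2⟩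

/-- Together with `yonedaMap_kerProj`: `kerSplitting` is functorial for closed morphisms of
degree `0`. -/
theorem kerMap_kerIncl {M N : φ.GluingObj} (f : φ.gluing.cocycles M N) :
    φ.kerMap (φ.cocyclesSnd f) ≫ φ.kerIncl N = φ.kerIncl M ≫ yonedaMap (D := φ.gluing) f := by
  refine hom_ext fun A n x => ?_
  refine Eq.symm (Prod.ext (map_zero _) (Prod.ext rfl ?_))
  have h : (φ.actR (a := -1) (b := n) (c := n - 1) (by lia) f.1.2.2 0 + (0 : ℤ).negOnePow •
      φ.actL (zero_add (n - 1)) f.1.2.1 x.2 : φ.X N.snd A.fst (n - 1)) =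
      φ.actL (zero_add (n - 1)) f.1.2.1 x.2 := by
    simp
  exact h

theorem yonedaMap_kerProj {M N : φ.GluingObj} (f : φ.gluing.cocycles M N) :
    yonedaMap (D := φ.gluing) f ≫ φ.kerProj N =
      φ.kerProj M ≫ φ.proj₁.res.map (yonedaMap (φ.cocyclesFst f)) := rfl

/-- Shifts and cones of the extensions `kerSplitting` are extensions of the same kind, hence
representable by `essImage_yoneda_of_triangle`. -/
instance isPretriangulated_gluing [IsPretriangulated D₁] [IsPretriangulated D₂] :
    IsPretriangulated φ.gluing where
  nonempty := by
    obtain ⟨O₁, _⟩ := exists_isContractible D₁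
    obtain ⟨O₂, _⟩ := exists_isContractible D₂
    exact ⟨φ.inclObj₁ O₂ O₁⟩
  shift M i := by
    obtain ⟨O₁, hO₁⟩ := exists_isContractible D₁
    obtain ⟨N, ⟨e⟩⟩ := φ.essImage_yoneda_of_triangle hO₁
      (Triangle.shift_distinguished _ (φ.kerSplitting M).triangle_distinguished i)
      ((φ.repr₂ O₁).le_shift i _ (φ.repr₂_kerObj hO₁ M.snd)) (by
        obtain ⟨B, ⟨e⟩⟩ := IsPretriangulated.shift M.fst i
        exact ⟨⟨B⟩, ⟨φ.proj₁.resHo.mapIso (e.symm ≪≫ ((toHo D₁).commShiftIso i).app _) ≪≫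
          (φ.proj₁.resHo.commShiftIso i).app _⟩⟩)
    exact ⟨N.obj, ⟨((toHo φ.gluing).commShiftIso i).app _ ≪≫ e.symm⟩⟩
  cone {M N} f := by
    obtain ⟨O₁, hO₁⟩ := exists_isContractible D₁
    obtain ⟨L, ⟨e⟩⟩ := φ.essImage_yoneda_of_triangle hO₁
      ((φ.kerSplitting M).cone (φ.kerSplitting N) (φ.kerMap_kerIncl f)
        (φ.yonedaMap_kerProj f)).triangle_distinguished
      (ObjectProperty.ext_of_isTriangulatedClosed₃ _
        (triangleh (φ.kerMap (φ.cocyclesSnd f))) ⟨_, _, _, ⟨Iso.refl _⟩⟩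
        (φ.repr₂_kerObj hO₁ M.snd) (φ.repr₂_kerObj hO₁ N.snd)) (by
        obtain ⟨C, ⟨e⟩⟩ := IsPretriangulated.cone (φ.cocyclesFst f)
        exact ⟨⟨C⟩, ⟨φ.proj₁.resHo.mapIso e.symm ≪≫ (toHo φ.gluing).mapIso
          (φ.proj₁.resConeIso (yonedaMap (φ.cocyclesFst f)))⟩⟩)
    exact ⟨L.obj, ⟨e.symm⟩⟩

end DGBimodule

/-! ### The functors between the homotopy categories -/

namespace NonUnitalDGFunctor

open DGCategory

variable {k : Type w} [Field k] {D' : DGCategory.{w, v, u₁} k} {D : DGCategory.{w, v, u₂} k}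
  (F : NonUnitalDGFunctor D' D)

/-- The action on closed morphisms of degree `0`. -/
def cocyclesMap {A B : D'.Obj} (f : D'.cocycles A B) : D.cocycles (F.obj A) (F.obj B) :=
  ⟨F.map f.1, by rw [mem_cocycles, ← F.map_d, mem_cocycles.1 f.2, map_zero]⟩

/-- The functor on homotopy categories induced by a DG-functor which preserves the identities. -/
def ho (hF : ∀ A, F.e A = D.id (F.obj A)) : D'.Ho ⥤ D.Ho where
  obj A := ⟨F.obj A.obj⟩
  map {A B} f := Quotient.liftOn' (show HoHom A B from f)
    (fun f => homMk (X := ⟨F.obj A.obj⟩) (Y := ⟨F.obj B.obj⟩) (F.cocyclesMap f)) (by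
      intro f g h
      obtain ⟨h, hh⟩ := mem_boundaries.1 ((Submodule.quotientRel_def _).1 h)
      refine homMk_eq_iff.2 ⟨F.map h, ?_⟩
      rw [← F.map_d, hh]
      exact map_sub _ _ _)
  map_id A := congrArg homMk (Subtype.ext (hF A.obj))
  map_comp {A B C} f g := by
    obtain ⟨f, rfl⟩ := homMk_surjective f
    obtain ⟨g, rfl⟩ := homMk_surjective g
    exact congrArg homMk (Subtype.ext (F.map_comp _ _ _))

end NonUnitalDGFunctor

namespace DGBimodule

open DGCategory DGModule

variable {k : Type w} [Field k] {D₁ : DGCategory.{w, v, u₁} k} {D₂ : DGCategory.{w, v, u₂} k}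
  (φ : DGBimodule D₁ D₂)

/-- The projection of the gluing to `D₂`, which is a DG-functor. -/
def proj₂ : NonUnitalDGFunctor φ.gluing D₂ where
  obj M := M.snd
  map := LinearMap.fst k _ _ ∘ₗ LinearMap.snd k _ _
  map_d _ _ := rfl
  map_comp _ _ _ := rfl

/-- The projection `[D₁ ×_φ D₂] ⥤ [D₁]`. -/
abbrev projHo₁ : φ.gluing.Ho ⥤ D₁.Ho := φ.proj₁.ho fun _ => rfl

/-- The projection `[D₁ ×_φ D₂] ⥤ [D₂]`. -/
abbrev projHo₂ : φ.gluing.Ho ⥤ D₂.Ho := φ.proj₂.ho fun _ => rfl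

/-- The closed morphism `(id, 0, 0)` from `M = (M₁, M₂, μ)` to `(M₁, O₂, 0)`. -/
def unit₁ (O₂ : D₂.Obj) (M : φ.GluingObj) : φ.gluing.cocycles M (φ.inclObj₁ O₂ M.fst) :=
  ⟨((D₁.id M.fst, 0, 0) : φ.GluingHom M (φ.inclObj₁ O₂ M.fst) 0), by
    refine Prod.ext (D₁.d_id _ _) (Prod.ext (map_zero _) ?_)
    have h : (- φ.d (n := -1) (m := 0) (neg_add_cancel 1) 0 -
        φ.actL (a := 0) (b := 0) (c := 0) (add_zero 0) 0 M.elt +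
        φ.actR (a := 0) (b := 0) (c := 0) (add_zero 0) 0 (D₁.id M.fst) : φ.X O₂ M.fst 0) = 0 := by
      simp
    exact h⟩

/-- The closed morphism `(0, id, 0)` from `(O₁, M₂, 0)` to `M = (M₁, M₂, μ)`. -/
def counit₂ (O₁ : D₁.Obj) (M : φ.GluingObj) : φ.gluing.cocycles (φ.inclObj₂ O₁ M.snd) M :=
  ⟨((0, D₂.id M.snd, 0) : φ.GluingHom (φ.inclObj₂ O₁ M.snd) M 0), by
    refine Prod.ext (map_zero _) (Prod.ext (D₂.d_id _ _) ?_)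
    have h : (- φ.d (n := -1) (m := 0) (neg_add_cancel 1) 0 -
        φ.actL (a := 0) (b := 0) (c := 0) (add_zero 0) (D₂.id M.snd) 0 +
        φ.actR (a := 0) (b := 0) (c := 0) (add_zero 0) M.elt 0 : φ.X M.snd O₁ 0) = 0 := by
      simp
    exact h⟩

theorem comp_aux₁ {A₂ B₂ : D₂.Obj} {A₁ B₁ : D₁.Obj} {a b p q r : ℤ} (h₁ : p + b = r)
    (h₂ : a + q = r) (e : ℤˣ) (f₁ : D₁.Hom A₁ B₁ b) (x : φ.X A₂ A₁ q) :
    φ.actR h₁ (0 : φ.X B₂ B₁ p) f₁ + e • φ.actL h₂ (0 : D₂.Hom A₂ B₂ a) x = 0 := by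
  simp

theorem comp_aux₂ {A₂ B₂ : D₂.Obj} {A₁ B₁ : D₁.Obj} {a b p q r : ℤ} (h₁ : p + b = r)
    (h₂ : a + q = r) (e : ℤˣ) (f₂ : D₂.Hom A₂ B₂ a) (x : φ.X B₂ B₁ p) :
    φ.actR h₁ x (0 : D₁.Hom A₁ B₁ b) + e • φ.actL h₂ f₂ (0 : φ.X A₂ A₁ q) = 0 := by
  simp

/-- The projection to `[D₁]` is left adjoint to the embedding of `[D₁]`. -/
def adj₁ (O₂ : D₂.Obj) (hO₂ : D₂.IsContractible O₂) : φ.projHo₁ ⊣ φ.incl₁ O₂ hO₂ :=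
  Adjunction.mkOfUnitCounit {
    unit := {
      app := fun M => homMk (X := M) (Y := ⟨φ.inclObj₁ O₂ M.obj.fst⟩) (φ.unit₁ O₂ M.obj)
      naturality := fun M N f => by
        obtain ⟨f, rfl⟩ := homMk_surjective f
        refine congrArg homMk (Subtype.ext (Prod.ext ?_ (Prod.ext ?_ ?_)))
        · exact (D₁.id_comp _).trans (D₁.comp_id _).symm
        · exact (LinearMap.congr_fun (map_zero (D₂.comp (add_zero 0))) _).trans
            (map_zero (D₂.comp (add_zero 0) _)).symm
        · exact (φ.comp_aux₁ _ _ _ _ _).trans (φ.comp_aux _ _ _ _ _).symm }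
    counit := {
      app := fun M => 𝟙 M
      naturality := fun M N f => by
        obtain ⟨f, rfl⟩ := homMk_surjective f
        exact (Category.comp_id _).trans (Category.id_comp _).symm }
    left_triangle := by
      ext M
      refine (congrArg (_ ≫ ·) (Category.id_comp _)).trans ?_
      exact Category.comp_id (𝟙 (φ.projHo₁.obj M))
    right_triangle := by
      ext M
      refine (congrArg (_ ≫ ·) (Category.id_comp _)).trans ?_
      refine (congrArg (_ ≫ ·) ((φ.incl₁ O₂ hO₂).map_id M)).trans ?_
      exact (Category.comp_id _).trans ((φ.incl₁ O₂ hO₂).map_id M) }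

/-- The projection to `[D₂]` is right adjoint to the embedding of `[D₂]`. -/
def adj₂ (O₁ : D₁.Obj) (hO₁ : D₁.IsContractible O₁) : φ.incl₂ O₁ hO₁ ⊣ φ.projHo₂ :=
  Adjunction.mkOfUnitCounit {
    unit := {
      app := fun M => 𝟙 M
      naturality := fun M N f => by
        obtain ⟨f, rfl⟩ := homMk_surjective f
        exact (Category.comp_id _).trans (Category.id_comp _).symm }
    counit := {
      app := fun M => homMk (X := ⟨φ.inclObj₂ O₁ M.obj.snd⟩) (Y := M) (φ.counit₂ O₁ M.obj)
      naturality := fun M N f => by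
        obtain ⟨f, rfl⟩ := homMk_surjective f
        refine congrArg homMk (Subtype.ext (Prod.ext ?_ (Prod.ext ?_ ?_)))
        · exact (map_zero (D₁.comp (add_zero 0) _)).trans
            (map_zero (D₁.comp (add_zero 0) _)).symm
        · exact (D₂.id_comp _).trans (D₂.comp_id _).symm
        · exact (φ.comp_aux _ _ _ _ _).trans (φ.comp_aux₂ _ _ _ _ _).symm }
    left_triangle := by
      ext M
      refine (congrArg (_ ≫ ·) (Category.id_comp _)).trans ?_
      refine (congrArg (· ≫ _) ((φ.incl₂ O₁ hO₁).map_id M)).trans ?_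
      exact (Category.id_comp _).trans ((φ.incl₂ O₁ hO₁).map_id M)
    right_triangle := by
      ext M
      refine (congrArg (_ ≫ ·) (Category.id_comp _)).trans ?_
      exact Category.id_comp (𝟙 (φ.projHo₂.obj M)) }

/-- The embedding of `[D₁]` is fully faithful, as the counit of the adjunction is the identity. -/
noncomputable def fullyFaithfulIncl₁ (O₂ : D₂.Obj) (hO₂ : D₂.IsContractible O₂) :
    (φ.incl₁ O₂ hO₂).FullyFaithful :=
  have (M : D₁.Ho) : IsIso ((φ.adj₁ O₂ hO₂).counit.app M) := inferInstanceAs (IsIso (𝟙 M))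
  have := NatIso.isIso_of_isIso_app (φ.adj₁ O₂ hO₂).counit
  (φ.adj₁ O₂ hO₂).fullyFaithfulROfIsIsoCounit

/-- The embedding of `[D₂]` is fully faithful, as the unit of the adjunction is the identity. -/
noncomputable def fullyFaithfulIncl₂ (O₁ : D₁.Obj) (hO₁ : D₁.IsContractible O₁) :
    (φ.incl₂ O₁ hO₁).FullyFaithful :=
  have (M : D₂.Ho) : IsIso ((φ.adj₂ O₁ hO₁).unit.app M) := inferInstanceAs (IsIso (𝟙 M))
  have := NatIso.isIso_of_isIso_app (φ.adj₂ O₁ hO₁).unit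
  (φ.adj₂ O₁ hO₁).fullyFaithfulLOfIsIsoUnit

/-- By adjunction, such a morphism amounts to a morphism `M₂ ⟶ O₂` in `[D₂]`. -/
theorem incl₂_hom_incl₁_eq_zero {O₁ : D₁.Obj} (hO₁ : D₁.IsContractible O₁) {O₂ : D₂.Obj}
    (hO₂ : D₂.IsContractible O₂) {M₂ : D₂.Ho} {M₁ : D₁.Ho}
    (f : (φ.incl₂ O₁ hO₁).obj M₂ ⟶ (φ.incl₁ O₂ hO₂).obj M₁) : f = 0 := by
  refine ((φ.adj₂ O₁ hO₁).homEquiv _ _).injective ?_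
  exact ((isContractible_iff_isZero _).1 hO₂).eq_of_tgt _ _

section

variable [IsPretriangulated D₁] [IsPretriangulated D₂]

/-- On representable DG-modules, the embedding of `[D₁]` is the restriction along the projection
to `D₁`. -/
noncomputable def incl₁YonedaIso (O₂ : D₂.Obj) (hO₂ : D₂.IsContractible O₂) :
    φ.incl₁ O₂ hO₂ ⋙ yoneda φ.gluing ≅ yoneda D₁ ⋙ φ.proj₁.resHo :=
  NatIso.ofComponents
    (fun M => @asIso _ _ _ _ ((toHo φ.gluing).map (φ.kerProj (φ.inclObj₁ O₂ M.obj)))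
      (φ.isIso_kerProj (M := φ.inclObj₁ O₂ M.obj) hO₂))
    (fun {M N} f => by
      obtain ⟨f, rfl⟩ := homMk_surjective f
      refine ((toHo φ.gluing).map_comp _ _).symm.trans (Eq.trans ?_ ((toHo φ.gluing).map_comp _ _))
      rfl)

/-- On representable DG-modules, the projection to `[D₂]` is the restriction along the inclusion
of `D₂`. -/
noncomputable def projHo₂YonedaIso (O₁ : D₁.Obj) :
    φ.projHo₂ ⋙ yoneda D₂ ≅ yoneda φ.gluing ⋙ (φ.inc₂ O₁).resHo :=
  NatIso.ofComponents (fun M => (toHo D₂).mapIso (φ.resYonedaIso O₁ M.obj))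
    (fun {M N} f => by
      obtain ⟨f, rfl⟩ := homMk_surjective f
      refine ((toHo D₂).map_comp _ _).symm.trans (Eq.trans ?_ ((toHo D₂).map_comp _ _))
      refine congrArg _ (hom_ext fun A n x => Subtype.ext (Eq.symm ?_))
      refine Prod.ext (map_zero (D₁.comp (zero_add n) _)) (Prod.ext rfl ?_)
      exact φ.comp_aux₂ _ _ _ _ _)

/-- The composition with the fully faithful triangulated Yoneda embedding is triangulated. -/
theorem exists_isTriangulated_incl₁ (O₂ : D₂.Obj) (hO₂ : D₂.IsContractible O₂) :
    ∃ _ : (φ.incl₁ O₂ hO₂).CommShift ℤ, (φ.incl₁ O₂ hO₂).IsTriangulated := by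
  let e := φ.incl₁YonedaIso O₂ hO₂
  let := Functor.CommShift.ofComp e ℤ
  have := Functor.CommShift.ofComp_compatibility e ℤ
  exact ⟨inferInstance, (Functor.isTriangulated_iff_comp_right e).2 inferInstance⟩

/-- The embedding of `[D₂]` is left adjoint to the projection, which is triangulated since its
composition with the Yoneda embedding is. -/
theorem exists_isTriangulated_incl₂ (O₁ : D₁.Obj) (hO₁ : D₁.IsContractible O₁) :
    ∃ _ : (φ.incl₂ O₁ hO₁).CommShift ℤ, (φ.incl₂ O₁ hO₁).IsTriangulated := by
  let e := φ.projHo₂YonedaIso O₁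
  let := Functor.CommShift.ofComp e ℤ
  have := Functor.CommShift.ofComp_compatibility e ℤ
  have : φ.projHo₂.IsTriangulated := (Functor.isTriangulated_iff_comp_right e).2 inferInstance
  let adj := φ.adj₂ O₁ hO₁
  let := adj.leftAdjointCommShift ℤ
  have := adj.commShift_of_rightAdjoint ℤ
  exact ⟨inferInstance, adj.isTriangulated_leftAdjoint⟩

end

end DGBimodule

/-! ### Morphisms of degree `1` in the homotopy category -/

namespace DGCategory

open DGModule

variable {k : Type w} [Field k] {D : DGCategory.{w, v, u} k} [IsPretriangulated D]

/-- The morphism `A ⟶ B[1]` of the homotopy category whose image under the Yoneda embedding is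
`homOne z`. -/
noncomputable def extMap {A B : D.Obj} (z : D.cocyclesOne A B) :
    (⟨A⟩ : D.Ho) ⟶ (⟨B⟩ : D.Ho)⟦(1 : ℤ)⟧ :=
  (yoneda D).preimage (homOne z ≫ ((yoneda D).commShiftIso (1 : ℤ)).inv.app _)

theorem yoneda_map_extMap {A B : D.Obj} (z : D.cocyclesOne A B) :
    (yoneda D).map (extMap z) = homOne z ≫ ((yoneda D).commShiftIso (1 : ℤ)).inv.app ⟨B⟩ :=
  (yoneda D).map_preimage _

theorem homMk_comp_extMap {A B C : D.Obj} (g : D.cocycles A B) (z : D.cocyclesOne B C) :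
    (homMk g : (⟨A⟩ : D.Ho) ⟶ ⟨B⟩) ≫ extMap z = extMap (cocyclesOneComp g z) := by
  refine (yoneda D).map_injective ?_
  refine ((yoneda D).map_comp _ _).trans ?_
  refine (congrArg (_ ≫ ·) (yoneda_map_extMap z)).trans ?_
  refine (Category.assoc _ _ _).symm.trans ?_
  exact (congrArg (· ≫ _) (yonedaMap_comp_homOne g z)).trans (yoneda_map_extMap _).symm

theorem extMap_comp_homMk {A B C : D.Obj} (z : D.cocyclesOne A B) (g : D.cocycles B C) :
    extMap z ≫ (homMk g : (⟨B⟩ : D.Ho) ⟶ ⟨C⟩)⟦(1 : ℤ)⟧' = extMap (compCocyclesOne z g) := by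
  refine (yoneda D).map_injective ?_
  refine ((yoneda D).map_comp _ _).trans ?_
  refine (congrArg (· ≫ _) (yoneda_map_extMap z)).trans ?_
  refine (Category.assoc _ _ _).trans ?_
  refine (congrArg (_ ≫ ·) ((yoneda D).commShiftIso_inv_naturality _ (1 : ℤ)).symm).trans ?_
  refine (Category.assoc _ _ _).symm.trans ?_
  exact (congrArg (· ≫ _) (homOne_comp_yonedaMap z g)).trans (yoneda_map_extMap _).symm

/-- The map `extMap` is linear. -/
noncomputable def ext₁ {A B : D.Obj} :
    D.cocyclesOne A B →ₗ[k] ((⟨A⟩ : D.Ho) ⟶ (⟨B⟩ : D.Ho)⟦(1 : ℤ)⟧) where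
  toFun := extMap
  map_add' z z' := by
    refine (yoneda D).map_injective ?_
    rw [Functor.map_add, yoneda_map_extMap, yoneda_map_extMap, yoneda_map_extMap, map_add]
    exact Preadditive.add_comp _ _ _ _ _ _
  map_smul' r z := by
    -- The scalar `r` acts by composition with `r • id`.
    have h : cocyclesOneComp (r • ⟨D.id A, D.d_id _ _⟩) z = r • z :=
      Subtype.ext ((map_smul (D.comp (add_zero 1) z.1) r (D.id A)).trans
        (congrArg (r • ·) (D.comp_id z.1)))
    rw [← h, ← homMk_comp_extMap, homMk_smul, Linear.smul_comp]
    exact congrArg (r • ·) (Category.id_comp _)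

theorem ext₁_surjective {A B : D.Obj} : Function.Surjective (ext₁ (A := A) (B := B)) := by
  intro f
  obtain ⟨z, hz⟩ := homOne_surjective
    ((yoneda D).map f ≫ ((yoneda D).commShiftIso (1 : ℤ)).hom.app _)
  refine ⟨z, (yoneda D).map_injective ?_⟩
  refine (yoneda_map_extMap z).trans ?_
  rw [hz]
  refine (Category.assoc _ _ _).trans ?_
  refine (congrArg (_ ≫ ·) (((yoneda D).commShiftIso (1 : ℤ)).hom_inv_id_app _)).trans ?_
  exact Category.comp_id _

theorem ext₁_eq_zero_iff {A B : D.Obj} (z : D.cocyclesOne A B) : ext₁ z = 0 ↔ homOne z = 0 := by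
  rw [← (yoneda D).map_eq_zero_iff]
  refine Iff.trans ?_ (Preadditive.IsIso.comp_right_eq_zero _
    (((yoneda D).commShiftIso (1 : ℤ)).inv.app ⟨B⟩))
  exact Eq.congr_left (yoneda_map_extMap z)

end DGCategory

namespace DGBimodule

open DGCategory DGModule

variable {k : Type w} [Field k] {D₁ : DGCategory.{w, v, u₁} k} {D₂ : DGCategory.{w, v, u₂} k}
  (φ : DGBimodule D₁ D₂) [IsPretriangulated D₁] [IsPretriangulated D₂]
  {O₁ : D₁.Obj} (hO₁ : D₁.IsContractible O₁) {O₂ : D₂.Obj} (hO₂ : D₂.IsContractible O₂)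

/-! ### The gluing bifunctor -/

/-- The isomorphism `H ^ 0 (φ M₂ M₁) ≅ Hom (i₁ M₁, (i₂ M₂)[1])`, `μ ↦ (0, 0, μ)`. -/
noncomputable def gluingEquiv (M₁ : D₁.Ho) (M₂ : D₂.Ho) :
    φ.H0 M₂.obj M₁.obj ≃ₗ[k]
      ((φ.incl₁ O₂ hO₂).obj M₁ ⟶ ((φ.incl₂ O₁ hO₁).obj M₂)⟦(1 : ℤ)⟧) :=
  LinearEquiv.ofBijective
    (Submodule.liftQ _ (ext₁ (D := φ.gluing) ∘ₗ φ.ofElt O₁ O₂) fun μ hμ =>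
      (ext₁_eq_zero_iff _).2 ((φ.homOne_ofElt_eq_zero_iff μ).2 hμ))
    (by
      refine ⟨?_, fun f => ?_⟩
      · refine (injective_iff_map_eq_zero _).2 fun x hx => ?_
        obtain ⟨μ, rfl⟩ := φ.H0mk_surjective x
        refine (Submodule.Quotient.mk_eq_zero _).2 ?_
        exact (φ.homOne_ofElt_eq_zero_iff μ).1 ((ext₁_eq_zero_iff _).1 hx)
      · obtain ⟨w, rfl⟩ := ext₁_surjective (D := φ.gluing) f
        obtain ⟨μ, hμ⟩ := φ.exists_homOne_ofElt hO₁ hO₂ w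
        refine ⟨φ.H0mk μ, ?_⟩
        refine sub_eq_zero.1 ((map_sub (ext₁ (D := φ.gluing)) _ _).symm.trans ?_)
        exact (ext₁_eq_zero_iff _).2 ((map_sub homOne _ _).trans (sub_eq_zero.2 hμ)))

theorem gluingEquiv_H0L (M₁ : D₁.Ho) {M₂ N₂ : D₂.Ho} (f : M₂ ⟶ N₂) (x : φ.H0 M₂.obj M₁.obj) :
    φ.gluingEquiv hO₁ hO₂ M₁ N₂ (φ.H0L M₁ f x) =
      φ.gluingEquiv hO₁ hO₂ M₁ M₂ x ≫ ((φ.incl₂ O₁ hO₁).map f)⟦(1 : ℤ)⟧' := by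
  obtain ⟨f, rfl⟩ := homMk_surjective f
  obtain ⟨x, rfl⟩ := φ.H0mk_surjective x
  refine Eq.trans ?_ (extMap_comp_homMk (D := φ.gluing) (φ.ofElt O₁ O₂ x)
    (φ.inclMap₂ O₁ _ _ f)).symm
  refine congrArg extMap (Subtype.ext (Prod.ext ?_ (Prod.ext ?_ ?_)))
  · exact (map_zero (D₁.comp (zero_add 1) _)).symm
  · exact (map_zero (D₂.comp (zero_add 1) _)).symm
  · have h : φ.actL (add_zero 0) f.1 x.1 = φ.actR (a := -1) (b := 1) (c := 0) (by lia)
        (0 : φ.X N₂.obj O₁ (-1)) 0 + (0 : ℤ).negOnePow • φ.actL (add_zero 0) f.1 x.1 := by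
      simp
    exact h

theorem gluingEquiv_H0R {M₁ N₁ : D₁.Ho} (M₂ : D₂.Ho) (g : M₁ ⟶ N₁) (x : φ.H0 M₂.obj N₁.obj) :
    φ.gluingEquiv hO₁ hO₂ M₁ M₂ (φ.H0R M₂ g x) =
      (φ.incl₁ O₂ hO₂).map g ≫ φ.gluingEquiv hO₁ hO₂ N₁ M₂ x := by
  obtain ⟨g, rfl⟩ := homMk_surjective g
  obtain ⟨x, rfl⟩ := φ.H0mk_surjective x
  refine Eq.trans ?_ (homMk_comp_extMap (D := φ.gluing) (φ.inclMap₁ O₂ _ _ g)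
    (φ.ofElt O₁ O₂ x)).symm
  refine congrArg extMap (Subtype.ext (Prod.ext ?_ (Prod.ext ?_ ?_)))
  · exact (LinearMap.congr_fun (map_zero (D₁.comp (add_zero 1))) _).symm
  · exact (map_zero (D₂.comp (add_zero 1) _)).symm
  · have h : φ.actR (add_zero 0) x.1 g.1 = φ.actR (add_zero 0) x.1 g.1 + (1 : ℤ).negOnePow •
        φ.actL (a := 1) (b := -1) (c := 0) (by lia) 0 (0 : φ.X O₂ M₁.obj (-1)) := by
      simp
    exact h

/-- The gluing bifunctor of the semiorthogonal decomposition is induced by `φ`. -/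
noncomputable def gluingBifunctorIso :
    gluingBifunctor k (φ.incl₁ O₂ hO₂) (φ.incl₂ O₁ hO₁) ≅ φ.bifunctor :=
  Iso.symm (NatIso.ofComponents
    (fun M₁ => NatIso.ofComponents
      (fun M₂ => (φ.gluingEquiv hO₁ hO₂ M₁.unop M₂).toModuleIso)
      (fun f => ModuleCat.hom_ext (LinearMap.ext fun x => φ.gluingEquiv_H0L hO₁ hO₂ M₁.unop f x)))
    (fun g => NatTrans.ext (funext fun M₂ =>
      ModuleCat.hom_ext (LinearMap.ext fun x => φ.gluingEquiv_H0R hO₁ hO₂ M₂ g.unop x))))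

/-! ### The semiorthogonal decomposition -/

/-- The triangle is the image of `kerSplitting M`: the kernel is represented by `(O₁, M₂, 0)` and
the quotient by `(M₁, O₂, 0)`. -/
theorem exists_triangle (M : φ.gluing.Ho) :
    ∃ (M₂ M₁ : φ.gluing.Ho) (f : M₂ ⟶ M) (g : M ⟶ M₁) (h : M₁ ⟶ M₂⟦(1 : ℤ)⟧),
      (φ.incl₂ O₁ hO₁).essImage M₂ ∧ (φ.incl₁ O₂ hO₂).essImage M₁ ∧
        Triangle.mk f g h ∈ distTriang φ.gluing.Ho := by
  have h₂ := φ.isIso_kerIncl (M := φ.inclObj₂ O₁ M.obj.snd) hO₁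
  have h₁ := φ.isIso_kerProj (M := φ.inclObj₁ O₂ M.obj.fst) hO₂
  let α := @asIso _ _ _ _ ((toHo φ.gluing).map (φ.kerIncl (φ.inclObj₂ O₁ M.obj.snd))) h₂
  let β := @asIso _ _ _ _ ((toHo φ.gluing).map (φ.kerProj (φ.inclObj₁ O₂ M.obj.fst))) h₁
  obtain ⟨f, hf⟩ := (yoneda φ.gluing).map_surjective
    (X := (φ.incl₂ O₁ hO₁).obj ⟨M.obj.snd⟩) (Y := M)
    (α.inv ≫ (toHo φ.gluing).map (φ.kerIncl M.obj))
  obtain ⟨C, g, h, hT⟩ := distinguished_cocone_triangle f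
  refine ⟨_, C, f, g, h, ⟨_, ⟨Iso.refl _⟩⟩, ⟨⟨M.obj.fst⟩, ⟨?_⟩⟩, hT⟩
  let e := isoTriangleOfIso₁₂ _ _ ((yoneda φ.gluing).map_distinguished _ hT)
    (φ.kerSplitting M.obj).triangle_distinguished α.symm (Iso.refl _)
    ((Category.comp_id _).trans hf)
  exact ((yoneda φ.gluing).preimageIso (Triangle.π₃.mapIso e ≪≫ β.symm)).symm

theorem isSemiorthogonalDecomposition :
    IsSemiorthogonalDecomposition (φ.incl₁ O₂ hO₂).essImage (φ.incl₂ O₁ hO₁).essImage where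
  triangulated₁ := by
    have := (φ.fullyFaithfulIncl₁ O₂ hO₂).full
    obtain ⟨_, _⟩ := φ.exists_isTriangulated_incl₁ O₂ hO₂
    infer_instance
  triangulated₂ := by
    have := (φ.fullyFaithfulIncl₂ O₁ hO₁).full
    obtain ⟨_, _⟩ := φ.exists_isTriangulated_incl₂ O₁ hO₁
    infer_instance
  strict₁ := inferInstance
  strict₂ := inferInstance
  hom_eq_zero := by
    rintro F₂ F₁ ⟨M₂, ⟨e₂⟩⟩ ⟨M₁, ⟨e₁⟩⟩ f
    rw [← cancel_epi e₂.hom, ← cancel_mono e₁.inv, comp_zero, zero_comp]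
    exact φ.incl₂_hom_incl₁_eq_zero hO₁ hO₂ _
  exists_triangle := φ.exists_triangle hO₁ hO₂

end DGBimodule

theorem mainTheorem10 {k : Type w} [Field k] (D₁ : DGCategory.{w, v, u₁} k)
    (D₂ : DGCategory.{w, v, u₂} k) (φ : DGBimodule D₁ D₂)
    [DGCategory.IsPretriangulated D₁] [DGCategory.IsPretriangulated D₂] :
    ∃ _ : DGCategory.IsPretriangulated φ.gluing,
      (∃ O₁ : D₁.Obj, D₁.IsContractible O₁) ∧ (∃ O₂ : D₂.Obj, D₂.IsContractible O₂) ∧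
      ∀ (O₁ : D₁.Obj) (hO₁ : D₁.IsContractible O₁) (O₂ : D₂.Obj) (hO₂ : D₂.IsContractible O₂),
        (φ.incl₁ O₂ hO₂).Full ∧ (φ.incl₁ O₂ hO₂).Faithful ∧
        (φ.incl₂ O₁ hO₁).Full ∧ (φ.incl₂ O₁ hO₁).Faithful ∧
        (∃ _ : (φ.incl₁ O₂ hO₂).CommShift ℤ, (φ.incl₁ O₂ hO₂).IsTriangulated) ∧
        (∃ _ : (φ.incl₂ O₁ hO₁).CommShift ℤ, (φ.incl₂ O₁ hO₁).IsTriangulated) ∧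
        IsSemiorthogonalDecomposition (φ.incl₁ O₂ hO₂).essImage (φ.incl₂ O₁ hO₁).essImage ∧
        Nonempty (gluingBifunctor k (φ.incl₁ O₂ hO₂) (φ.incl₂ O₁ hO₁) ≅ φ.bifunctor) :=
  ⟨φ.isPretriangulated_gluing, DGCategory.exists_isContractible D₁,
    DGCategory.exists_isContractible D₂, fun O₁ hO₁ O₂ hO₂ =>
      ⟨(φ.fullyFaithfulIncl₁ O₂ hO₂).full, (φ.fullyFaithfulIncl₁ O₂ hO₂).faithful,
        (φ.fullyFaithfulIncl₂ O₁ hO₁).full, (φ.fullyFaithfulIncl₂ O₁ hO₁).faithful,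
        φ.exists_isTriangulated_incl₁ O₂ hO₂, φ.exists_isTriangulated_incl₂ O₁ hO₁,
        φ.isSemiorthogonalDecomposition hO₁ hO₂, ⟨φ.gluingBifunctorIso hO₁ hO₂⟩⟩⟩
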